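/- Let $k$ be a field and let $H$ be a Hopf algebra over $k$ with bijective antipode that is co-Frobenius, i.e. there is a nonzero left integral $\lambda\in H^*$, meaning $h_{(1)}\lambda(h_{(2)})=\lambda(h)1$ for all $h\in H$. Let $R$ be a Hopf algebra in the braided category ${}^H_H\mathcal{YD}$ of left Yetter–Drinfeld modules over $H$ (compatibility $\rho(h\cdot v)=h_{(1)}v_{(-1)}\mathcal S(h_{(3)})\otimes h_{(2)}\cdot v_{(0)}$, braiding $v\otimes w\mapsto v_{(-1)}\cdot w\otimes v_{(0)}$). A left (respectively right) integral on $R$ is $\lambda\in R^*$ with $r^{(1)}\lambda(r^{(2)})=\lambda(r)1$ (respectively $\lambda(r^{(1)})r^{(2)}=\lambda(r)1$) for all $r\in R$, and $R$ is called left (right) co-Frobenius if it has a nonzero left (right) integral. Let ${}^R\underline{\mathcal M}$ be the category of left $R$-comodules inside the monoidal category of left $H$-comodules: vector spaces $V$ with a left $H$-coaction and a left $R$-coaction $V\to R\otimes V$ that is a morphism of $H$-comodules; morphisms are the linear maps that are colinear over both. In it, $E_R(M)$ denotes the injective hull of $M$, and $k$ is the unit object with coactions $c\mapsto 1\otimes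 c$. Then the following are equivalent: (i) $R$ is co-Frobenius (being left co-Frobenius and being right co-Frobenius are both equivalent to each of the conditions below); (ii) $E_R(S)$ is finite-dimensional for every simple object $S$ of ${}^R\underline{\mathcal M}$; (iii) $E_R(k)$ is finite-dimensional; (iv) there is a nonzero finite-dimensional injective object in ${}^R\underline{\mathcal M}$; (v) every nonzero object of ${}^R\underline{\mathcal M}$ has a nonzero finite-dimensional quotient; (vi) every nonzero injective object of ${}^R\underline{\mathcal M}$ has a nonzero finite-dimensional quotient; (vii) there is a nonzero injective object of ${}^R\underline{\mathcal M}$ with a nonzero finite-dimensional quotient; (viii) ${}^R\underline{\mathcal M}$ has a nonzero projective object; (ix) every object of ${}^R\underline{\mathcal M}$ has a projective cover; (x) every injective object of ${}^R\underline{\mathcal M}$ is projective. -/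

import Mathlib

open scoped TensorProduct
open CategoryTheory

universe u

namespace BraidedCoFrob

noncomputable section

/-! ### Coactions and integrals -/

section Coalg

variable {k C M : Type u} [Field k] [AddCommGroup C] [Module k C] [Coalgebra k C]
  [AddCommGroup M] [Module k M]

/-- `ρ : M → C ⊗ M` is a (coassociative, counital) left coaction of the coalgebra `C` on `M`. -/
structure IsCoaction (ρ : M →ₗ[k] C ⊗[k] M) : Prop where
  coassoc : ∀ m, TensorProduct.assoc k C C M ((Coalgebra.comul (R := k) (A := C)).rTensor M (ρ m)) =
    ρ.lTensor C (ρ m)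
  counit : ∀ m, TensorProduct.lid k M ((Coalgebra.counit (R := k) (A := C)).rTensor M (ρ m)) = m

/-- `c₍₁₎ λ(c₍₂₎) = λ(c) 1` for all `c`. -/
def IsLeftIntegral [One C] (l : Module.Dual k C) : Prop :=
  ∀ c : C, TensorProduct.rid k C (l.lTensor C (Coalgebra.comul (R := k) c)) = l c • (1 : C)

/-- `λ(c₍₁₎) c₍₂₎ = λ(c) 1` for all `c`. -/
def IsRightIntegral [One C] (l : Module.Dual k C) : Prop :=
  ∀ c : C, TensorProduct.lid k C (l.rTensor C (Coalgebra.comul (R := k) c)) = l c • (1 : C)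

variable (k C)

/-- There is a nonzero left integral. -/
def IsLeftCoFrobenius [One C] : Prop := ∃ l : Module.Dual k C, l ≠ 0 ∧ IsLeftIntegral l

/-- There is a nonzero right integral. -/
def IsRightCoFrobenius [One C] : Prop := ∃ l : Module.Dual k C, l ≠ 0 ∧ IsRightIntegral l

end Coalg

/-! ### Yetter–Drinfeld modules and braided Hopf algebras -/

section YD

variable {k H V W : Type u} [Field k] [Ring H] [HopfAlgebra k H]
  [AddCommGroup V] [Module k V] [AddCommGroup W] [Module k W]

/-- The diagonal action `h · (v ⊗ w) = h₍₁₎ · v ⊗ h₍₂₎ · w`. -/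
def tensorAct (a : H →ₗ[k] Module.End k V) (b : H →ₗ[k] Module.End k W) :
    H →ₗ[k] Module.End k (V ⊗[k] W) :=
  TensorProduct.homTensorHomMap (.id k) V W V W ∘ₗ TensorProduct.map a b ∘ₗ Coalgebra.comul

/-- The codiagonal coaction `v ⊗ w ↦ v₍₋₁₎ w₍₋₁₎ ⊗ (v₍₀₎ ⊗ w₍₀₎)`. -/
def tensorCoact (ρ : V →ₗ[k] H ⊗[k] V) (σ : W →ₗ[k] H ⊗[k] W) :
    V ⊗[k] W →ₗ[k] H ⊗[k] (V ⊗[k] W) :=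
  (LinearMap.mul' k H).rTensor (V ⊗[k] W) ∘ₗ
    (TensorProduct.tensorTensorTensorComm k H V H W).toLinearMap ∘ₗ TensorProduct.map ρ σ

/-- The linear map sending `a ⊗ (b ⊗ c)` to the endomorphism
`x ⊗ v ↦ a x S(c) ⊗ b · v` of `H ⊗ V`. -/
def ydOperator (a : H →ₗ[k] Module.End k V) :
    H ⊗[k] (H ⊗[k] H) →ₗ[k] Module.End k (H ⊗[k] V) :=
  LinearMap.mul' k (Module.End k (H ⊗[k] V)) ∘ₗ
    TensorProduct.map (LinearMap.rTensorHom V ∘ₗ LinearMap.mul k H)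
      (LinearMap.mul' k (Module.End k (H ⊗[k] V)) ∘ₗ
        TensorProduct.map (LinearMap.lTensorHom H ∘ₗ a)
          (LinearMap.rTensorHom V ∘ₗ (LinearMap.mul k H).flip ∘ₗ HopfAlgebra.antipode k))

theorem ydOperator_tmul (a : H →ₗ[k] Module.End k V) (x y z t : H) (v : V) :
    ydOperator a (x ⊗ₜ (y ⊗ₜ z)) (t ⊗ₜ v) =
      (x * t * HopfAlgebra.antipode k z) ⊗ₜ a y v := by
  simp [ydOperator, mul_assoc]

variable (k H V) in
/-- A left-left Yetter–Drinfeld module structure over `H` on the vector space `V`: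
`compat` says `ρ(h · v) = h₍₁₎ v₍₋₁₎ S(h₍₃₎) ⊗ h₍₂₎ · v₍₀₎`. -/
structure YetterDrinfeld where
  act : H →ₐ[k] Module.End k V
  coact : V →ₗ[k] H ⊗[k] V
  isCoaction : IsCoaction coact
  compat : ∀ (h : H) (v : V), coact (act h v) =
    ydOperator act.toLinearMap
      ((Coalgebra.comul (R := k) (A := H)).lTensor H (Coalgebra.comul (R := k) h)) (coact v)

/-- The braiding `v ⊗ w ↦ v₍₋₁₎ · w ⊗ v₍₀₎`, from a coaction on `V` and an action on `W`. -/
def braiding (ρ : V →ₗ[k] H ⊗[k] V) (b : H →ₗ[k] Module.End k W) :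
    V ⊗[k] W →ₗ[k] W ⊗[k] V :=
  (TensorProduct.lift b).rTensor V ∘ₗ (TensorProduct.assoc k H W V).symm.toLinearMap ∘ₗ
    (TensorProduct.comm k V W).toLinearMap.lTensor H ∘ₗ
      (TensorProduct.assoc k H V W).toLinearMap ∘ₗ ρ.rTensor W

/-- The multiplication of `R ⊗ R` twisted by a map `c : R ⊗ R → R ⊗ R`:
`(mul ⊗ mul) ∘ (id ⊗ c ⊗ id)`. -/
def twistedMul {R : Type u} [Ring R] [Algebra k R] (c : R ⊗[k] R →ₗ[k] R ⊗[k] R) :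
    (R ⊗[k] R) ⊗[k] (R ⊗[k] R) →ₗ[k] R ⊗[k] R :=
  TensorProduct.map (LinearMap.mul' k R) (LinearMap.mul' k R) ∘ₗ
    (TensorProduct.assoc k R R (R ⊗[k] R)).symm.toLinearMap ∘ₗ
      ((TensorProduct.assoc k R R R).toLinearMap ∘ₗ c.rTensor R ∘ₗ
        (TensorProduct.assoc k R R R).symm.toLinearMap).lTensor R ∘ₗ
          (TensorProduct.assoc k R R (R ⊗[k] R)).toLinearMap

end YD

section Braided

variable (k H R : Type u) [Field k] [Ring H] [HopfAlgebra k H]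
  [Ring R] [Algebra k R] [Coalgebra k R]

/-- A structure of Hopf algebra in the braided category of Yetter–Drinfeld modules over `H` on
the algebra and coalgebra `R`: all structure maps are linear and colinear over `H`, `Δ` is
multiplicative for the braided product of `R ⊗ R`, and there is an antipode. -/
structure BraidedHopfAlgebra extends YetterDrinfeld k H R where
  act_mul : ∀ (h : H) (x : R ⊗[k] R), act h (LinearMap.mul' k R x) =
    LinearMap.mul' k R (tensorAct act.toLinearMap act.toLinearMap h x)
  act_one : ∀ h : H, act h 1 = Coalgebra.counit (R := k) h • (1 : R)
  coact_mul : ∀ x : R ⊗[k] R, coact (LinearMap.mul' k R x) =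
    (LinearMap.mul' k R).lTensor H (tensorCoact coact coact x)
  coact_one : coact 1 = (1 : H) ⊗ₜ[k] (1 : R)
  comul_act : ∀ (h : H) (r : R), Coalgebra.comul (R := k) (act h r) =
    tensorAct act.toLinearMap act.toLinearMap h (Coalgebra.comul (R := k) r)
  counit_act : ∀ (h : H) (r : R), Coalgebra.counit (R := k) (act h r) =
    Coalgebra.counit (R := k) h * Coalgebra.counit (R := k) r
  comul_coact : ∀ r : R, (Coalgebra.comul (R := k) (A := R)).lTensor H (coact r) =
    tensorCoact coact coact (Coalgebra.comul (R := k) r)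
  counit_coact : ∀ r : R,
    TensorProduct.rid k H ((Coalgebra.counit (R := k) (A := R)).lTensor H (coact r)) =
      Coalgebra.counit (R := k) r • (1 : H)
  comul_mul : ∀ r s : R, Coalgebra.comul (R := k) (r * s) =
    twistedMul (braiding coact act.toLinearMap)
      (Coalgebra.comul (R := k) r ⊗ₜ[k] Coalgebra.comul (R := k) s)
  comul_one : Coalgebra.comul (R := k) (1 : R) = 1 ⊗ₜ[k] 1
  counit_mul : ∀ r s : R, Coalgebra.counit (R := k) (r * s) =
    Coalgebra.counit (R := k) r * Coalgebra.counit (R := k) s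
  counit_one : Coalgebra.counit (R := k) (1 : R) = 1
  antipode : R →ₗ[k] R
  antipode_act : ∀ (h : H) (r : R), antipode (act h r) = act h (antipode r)
  antipode_coact : ∀ r : R, coact (antipode r) = antipode.lTensor H (coact r)
  mul_antipode_left : ∀ r : R,
    LinearMap.mul' k R (antipode.rTensor R (Coalgebra.comul (R := k) r)) =
      Coalgebra.counit (R := k) r • (1 : R)
  mul_antipode_right : ∀ r : R,
    LinearMap.mul' k R (antipode.lTensor R (Coalgebra.comul (R := k) r)) =
      Coalgebra.counit (R := k) r • (1 : R)

end Braided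

/-! ### The category of left `R`-comodules inside left `H`-comodules -/

section Comod

variable {k H R : Type u} [Field k] [Ring H] [HopfAlgebra k H]
  [Ring R] [Algebra k R] [Coalgebra k R]

/-- A left `R`-comodule in the monoidal category of left `H`-comodules. -/
structure BrComod (B : BraidedHopfAlgebra k H R) where
  carrier : Type u
  [addCommGroup : AddCommGroup carrier]
  [module : Module k carrier]
  hcoact : carrier →ₗ[k] H ⊗[k] carrier
  rcoact : carrier →ₗ[k] R ⊗[k] carrier
  hcoact_isCoaction : IsCoaction hcoact
  rcoact_isCoaction : IsCoaction rcoact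
  /-- The `R`-coaction is a morphism of `H`-comodules. -/
  colinear : ∀ v, rcoact.lTensor H (hcoact v) = tensorCoact B.coact hcoact (rcoact v)

namespace BrComod

attribute [instance] BrComod.addCommGroup BrComod.module

variable {B : BraidedHopfAlgebra k H R}

/-- Linear maps that are colinear over both `H` and `R`. -/
@[ext]
structure Hom (M N : BrComod B) where
  toLin : M.carrier →ₗ[k] N.carrier
  hcolinear : ∀ m, N.hcoact (toLin m) = toLin.lTensor H (M.hcoact m)
  rcolinear : ∀ m, N.rcoact (toLin m) = toLin.lTensor R (M.rcoact m)

instance : Category (BrComod B) where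
  Hom := Hom
  id M := ⟨LinearMap.id, by simp, by simp⟩
  comp f g := ⟨g.toLin ∘ₗ f.toLin,
    fun m => by simp [g.hcolinear, f.hcolinear, LinearMap.lTensor_comp],
    fun m => by simp [g.rcolinear, f.rcolinear, LinearMap.lTensor_comp]⟩

instance : Limits.HasZeroMorphisms (BrComod B) where
  zero M N := ⟨⟨0, by simp, by simp⟩⟩
  comp_zero f N := Hom.ext (LinearMap.zero_comp _)
  zero_comp M _ _ f := Hom.ext (LinearMap.comp_zero _)

/-- The underlying linear map of a morphism. -/
def lin {M N : BrComod B} (f : M ⟶ N) : M.carrier →ₗ[k] N.carrier := Hom.toLin f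

/-- The underlying vector space is finite-dimensional. -/
def FinDim (M : BrComod B) : Prop := Module.Finite k M.carrier

/-- The underlying vector space is nonzero. -/
def NonZero (M : BrComod B) : Prop := Nontrivial M.carrier

variable (B) in
/-- The unit object `k`, with coactions `c ↦ 1 ⊗ c`. -/
def unit : BrComod B where
  carrier := k
  hcoact := TensorProduct.mk k H k 1
  rcoact := TensorProduct.mk k R k 1
  hcoact_isCoaction := ⟨fun m => by simp [Algebra.TensorProduct.one_def], fun m => by simp⟩
  rcoact_isCoaction := ⟨fun m => by simp [B.comul_one], fun m => by simp [B.counit_one]⟩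
  colinear v := by simp [tensorCoact, B.coact_one]

/-- `i : M ⟶ E` is an injective hull: an essential monomorphism into an injective object. -/
structure IsInjectiveHull {M E : BrComod B} (i : M ⟶ E) : Prop where
  injective : Injective E
  mono : Mono i
  essential : ∀ {X : BrComod B} (g : E ⟶ X), Mono (i ≫ g) → Mono g

/-- `p : P ⟶ M` is a projective cover: a superfluous epimorphism from a projective object. -/
structure IsProjectiveCover {P M : BrComod B} (p : P ⟶ M) : Prop where
  projective : Projective P
  epi : Epi p
  superfluous : ∀ {X : BrComod B} (g : X ⟶ P), Epi (g ≫ p) → Epi g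

/-- The injective hull of `M` exists and is finite-dimensional. -/
def HasFinDimInjectiveHull (M : BrComod B) : Prop :=
  ∃ (E : BrComod B) (i : M ⟶ E), IsInjectiveHull i ∧ E.FinDim

/-- `M` has a projective cover. -/
def HasProjectiveCover (M : BrComod B) : Prop :=
  ∃ (P : BrComod B) (p : P ⟶ M), IsProjectiveCover p

/-- `M` has a nonzero finite-dimensional quotient. -/
def HasFinDimQuotient (M : BrComod B) : Prop :=
  ∃ (N : BrComod B) (p : M ⟶ N), Function.Surjective (lin p) ∧ N.NonZero ∧ N.FinDim

end BrComod

end Comod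

end

end BraidedCoFrob

open BraidedCoFrob

/-! The braided statement is reduced to an ordinary Hopf algebra, the bosonization A = R # H
(`Bos`). It is R ⊗ H with the smash product and with Δ(r # h) = r⁽¹⁾ # r⁽²⁾₍₋₁₎ h₍₁₎ ⊗ r⁽²⁾₍₀₎ #
h₍₂₎. Composing the R-coaction with the H-coaction, V → R ⊗ V → R ⊗ H ⊗ V, turns an R-comodule among
H-comodules into an A-comodule with the same underlying space. This functor `toBos` is an
equivalence, inverted by corestriction along the projections of A onto R and H. All the categorical
conditions thus become conditions on left A-comodules.

For an ordinary Hopf algebra A the equivalences (`LComod.tfae_isLeftCoFrobenius`) rest on tensor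
products and duals. A finite-dimensional M has a dual M* with M ⊗ - left adjoint to M* ⊗ - and - ⊗
M* left adjoint to - ⊗ M. If I is injective, so is I ⊗ M for every M, because a cofree comodule
tensored with anything is cofree. A left integral is a colinear map A → k. A nonzero map from an
injective object to a finite-dimensional one can be transposed to an embedding of E(k) into a
finite-dimensional comodule (`hull_unit_finDim_of_hom`). Conversely, for a finite-dimensional
injective E ≠ 0, extending the evaluation E ⊗ E* → k to a cofree comodule produces an integral. For
such an E every E ⊗ X is projective, since E* ⊗ - splits short exact sequences; this gives
projective covers, and injectives are projective. In the other direction, a nonzero projective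
object yields a nonzero finite-dimensional projective one, by a maximal dimension argument on
superfluous covers of k. A finite-dimensional projective splits off every finite-dimensional
overobject, so it equals its injective hull.

Left and right integrals on an ordinary A exist simultaneously
(`isLeftCoFrobenius_iff_isRightCoFrobenius`), because the linear dual of a finite-dimensional
injective A-comodule is projective over the opposite co-opposite Hopf algebra, whose left integrals
are the right integrals of A.

Finally, integrals are moved between R and A. With l on R and μ on H, the functionals r # h ↦
μ(r₍₋₁₎ l(r₍₀₎) h) and r # h ↦ l(r) μ(h) are left and right integrals on A when l, μ are so. From Λ
on A one returns to R by r ↦ Λ(r # h) on the left and r ↦ Λ(r₍₀₎ # S⁻¹(r₍₋₁₎) h) on the right. The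
bijectivity of the antipode of H enters only here. -/

namespace BraidedCoFrob
noncomputable section

/-! ### Contraction of tensors against functionals -/

section Contract

variable {k C V W : Type u} [Field k] [AddCommGroup C] [Module k C]
  [AddCommGroup V] [Module k V] [AddCommGroup W] [Module k W]

/-- The map `c ⊗ v ↦ f(c) v`. -/
def contract (f : Module.Dual k C) : C ⊗[k] V →ₗ[k] V :=
  (TensorProduct.lid k V).toLinearMap ∘ₗ f.rTensor V

@[simp]
theorem contract_tmul (f : Module.Dual k C) (c : C) (v : V) :
    contract f (c ⊗ₜ[k] v) = f c • v := by
  simp [contract]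

theorem contract_lTensor (f : Module.Dual k C) (g : V →ₗ[k] W) (x : C ⊗[k] V) :
    contract f (g.lTensor C x) = g (contract f x) := by
  induction x with
  | zero => simp
  | tmul c v => simp
  | add x y hx hy => simp only [map_add, hx, hy]

/-- The coordinate functionals of a basis of `C` already detect a tensor. Coactions can therefore be
compared through the operators `m ↦ f(m₍₋₁₎) m₍₀₎`. -/
theorem eq_zero_of_contract {x : C ⊗[k] V} (h : ∀ f : Module.Dual k C, contract f x = 0) :
    x = 0 := by
  classical
  let b := Module.Basis.ofVectorSpace k C
  apply (TensorProduct.equivFinsuppOfBasisLeft (N := V) b).injective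
  ext i
  have key : ∀ y : C ⊗[k] V,
      TensorProduct.equivFinsuppOfBasisLeft (N := V) b y i = contract (b.coord i) y := by
    intro y
    induction y with
    | zero => simp
    | tmul c v => simp
    | add x y hx hy => simp only [map_add, Finsupp.add_apply, hx, hy]
  rw [key, h]; simp

theorem eq_of_contract {x y : C ⊗[k] V}
    (h : ∀ f : Module.Dual k C, contract f x = contract f y) : x = y := by
  rw [← sub_eq_zero]
  exact eq_zero_of_contract fun f => by rw [map_sub, h, sub_self]

theorem lTensor_injective_of_injective {g : V →ₗ[k] W} (hg : Function.Injective g) :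
    Function.Injective (g.lTensor C) :=
  Module.Flat.lTensor_preserves_injective_linearMap g hg

/-- By exactness of `C ⊗ -` it suffices that the image of `x` in `C ⊗ V/U` vanishes, and all its
contractions do. -/
theorem mem_range_lTensor_subtype {U : Submodule k V} {x : C ⊗[k] V}
    (h : ∀ f : Module.Dual k C, contract f x ∈ U) :
    x ∈ LinearMap.range (U.subtype.lTensor C) := by
  have hex : Function.Exact (U.subtype.lTensor C) (U.mkQ.lTensor C) :=
    lTensor_exact C (by rw [LinearMap.exact_iff]; simp) U.mkQ_surjective
  rw [← LinearMap.exact_iff.mp hex, LinearMap.mem_ker]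
  refine eq_zero_of_contract fun f => ?_
  rw [contract_lTensor]
  simpa using h f

end Contract

/-! ### Coactions along injective and surjective maps -/

section Coaction

variable {k C V W : Type u} [Field k] [AddCommGroup C] [Module k C]
  [AddCommGroup V] [Module k V] [AddCommGroup W] [Module k W]

theorem lTensor_lTensor_apply (g : V →ₗ[k] W) (ρ : V →ₗ[k] C ⊗[k] V) (σ : W →ₗ[k] C ⊗[k] W)
    (h : ∀ v, σ (g v) = g.lTensor C (ρ v)) (x : C ⊗[k] V) :
    σ.lTensor C (g.lTensor C x) = (g.lTensor C).lTensor C (ρ.lTensor C x) := by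
  rw [← LinearMap.comp_apply, ← LinearMap.comp_apply, ← LinearMap.lTensor_comp,
    ← LinearMap.lTensor_comp]
  congr 2
  exact LinearMap.ext h

variable [Coalgebra k C]

theorem assoc_rTensor_comul_lTensor (g : V →ₗ[k] W) (x : C ⊗[k] V) :
    TensorProduct.assoc k C C W
      ((Coalgebra.comul (R := k) (A := C)).rTensor W (g.lTensor C x)) =
    (g.lTensor C).lTensor C (TensorProduct.assoc k C C V
      ((Coalgebra.comul (R := k) (A := C)).rTensor V x)) := by
  induction x with
  | zero => simp
  | add x y hx hy => simp only [map_add, hx, hy]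
  | tmul c v =>
    simp only [LinearMap.lTensor_tmul, LinearMap.rTensor_tmul]
    generalize Coalgebra.comul (R := k) c = d
    induction d with
    | zero => simp
    | add x y hx hy => simp only [TensorProduct.add_tmul, map_add, hx, hy]
    | tmul a b => simp

theorem IsCoaction.contract_counit {ρ : V →ₗ[k] C ⊗[k] V} (h : IsCoaction ρ) (v : V) :
    contract Coalgebra.counit (ρ v) = v := h.counit v

theorem IsCoaction.of_injective {ρ : V →ₗ[k] C ⊗[k] V} {σ : W →ₗ[k] C ⊗[k] W}
    (hσ : IsCoaction σ) {g : V →ₗ[k] W} (hg : Function.Injective g)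
    (h : ∀ v, σ (g v) = g.lTensor C (ρ v)) : IsCoaction ρ where
  coassoc v := by
    apply lTensor_injective_of_injective (C := C) (lTensor_injective_of_injective (C := C) hg)
    rw [← assoc_rTensor_comul_lTensor, ← h, hσ.coassoc, h, lTensor_lTensor_apply g ρ σ h]
  counit v := by
    apply hg
    change g (contract _ (ρ v)) = _
    rw [← contract_lTensor, ← h, hσ.contract_counit]

theorem IsCoaction.of_surjective {ρ : V →ₗ[k] C ⊗[k] V} {σ : W →ₗ[k] C ⊗[k] W}
    (hρ : IsCoaction ρ) {g : V →ₗ[k] W} (hg : Function.Surjective g)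
    (h : ∀ v, σ (g v) = g.lTensor C (ρ v)) : IsCoaction σ where
  coassoc w := by
    obtain ⟨v, rfl⟩ := hg w
    rw [h, assoc_rTensor_comul_lTensor, hρ.coassoc, lTensor_lTensor_apply g ρ σ h]
  counit w := by
    obtain ⟨v, rfl⟩ := hg w
    change contract _ _ = _
    rw [h, contract_lTensor, hρ.contract_counit]

end Coaction

/-! ### The category of left comodules over a coalgebra -/

/-- A left comodule over the coalgebra `C`. -/
structure LComod (k C : Type u) [Field k] [AddCommGroup C] [Module k C] [Coalgebra k C] where
  carrier : Type u
  [addCommGroup : AddCommGroup carrier]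
  [module : Module k carrier]
  coact : carrier →ₗ[k] C ⊗[k] carrier
  isCoaction : IsCoaction coact

namespace LComod

variable {k C : Type u} [Field k] [AddCommGroup C] [Module k C] [Coalgebra k C]

instance : CoeSort (LComod k C) (Type u) := ⟨carrier⟩

attribute [instance] LComod.addCommGroup LComod.module

/-- Colinear maps. -/
@[ext]
structure Hom (M N : LComod k C) where
  toLin : M →ₗ[k] N
  colinear : ∀ m, N.coact (toLin m) = toLin.lTensor C (M.coact m)

instance : Category (LComod k C) where
  Hom := Hom
  id M := ⟨LinearMap.id, by simp⟩
  comp f g := ⟨g.toLin ∘ₗ f.toLin,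
    fun m => by simp [g.colinear, f.colinear, LinearMap.lTensor_comp]⟩

instance : Limits.HasZeroMorphisms (LComod k C) where
  zero M N := ⟨⟨0, by simp⟩⟩
  comp_zero f N := Hom.ext (LinearMap.zero_comp _)
  zero_comp M _ _ f := Hom.ext (LinearMap.comp_zero _)

/-- The underlying linear map of a morphism. -/
def lin {M N : LComod k C} (f : M ⟶ N) : M →ₗ[k] N := Hom.toLin f

theorem lin_colinear {M N : LComod k C} (f : M ⟶ N) (m : M) :
    N.coact (lin f m) = (lin f).lTensor C (M.coact m) := Hom.colinear f m

/-- A colinear map as a morphism. -/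
def mkHom {M N : LComod k C} (g : M →ₗ[k] N)
    (h : ∀ m, N.coact (g m) = g.lTensor C (M.coact m)) : M ⟶ N := Hom.mk g h

@[simp] theorem lin_mkHom {M N : LComod k C} (g : M →ₗ[k] N) (h) :
    lin (mkHom g h) = g := rfl

@[simp] theorem lin_id (M : LComod k C) : lin (𝟙 M) = LinearMap.id := rfl

@[simp] theorem lin_comp {M N P : LComod k C} (f : M ⟶ N) (g : N ⟶ P) :
    lin (f ≫ g) = lin g ∘ₗ lin f := rfl

@[simp] theorem lin_zero (M N : LComod k C) : lin (0 : M ⟶ N) = 0 := rfl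

theorem hom_ext {M N : LComod k C} {f g : M ⟶ N} (h : lin f = lin g) : f = g := Hom.ext h

theorem hom_ext' {M N : LComod k C} {f g : M ⟶ N} (h : ∀ m, lin f m = lin g m) : f = g :=
  hom_ext (LinearMap.ext h)

/-! #### The action of functionals -/

variable (k C) in
/-- The free algebra on the functionals on `C`; it acts on every comodule, with the subcomodules
as submodules and the colinear maps as linear maps. -/
abbrev FunAlg : Type u := FreeAlgebra k (Module.Dual k C)

/-- The operator `m ↦ f(m₍₋₁₎) m₍₀₎`. -/
def act (M : LComod k C) (f : Module.Dual k C) : Module.End k M := contract f ∘ₗ M.coact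

theorem act_apply (M : LComod k C) (f : Module.Dual k C) (m : M) :
    M.act f m = contract f (M.coact m) := rfl

/-- The representation of the free algebra on a comodule. -/
def rep (M : LComod k C) : FunAlg k C →ₐ[k] Module.End k M := FreeAlgebra.lift k M.act

/-- Viewing comodules as modules makes submodule theory available: simple, semisimple and Artinian
modules, the Jacobson radical. The relations of the convolution algebra are not needed, since
submodules and linear maps depend only on the operators by which functionals act. -/
instance funAlgModule (M : LComod k C) : Module (FunAlg k C) M :=
  Module.compHom M M.rep.toRingHom

theorem smul_def (M : LComod k C) (d : FunAlg k C) (m : M) : d • m = M.rep d m := rfl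

theorem ι_smul (M : LComod k C) (f : Module.Dual k C) (m : M) :
    FreeAlgebra.ι k f • m = M.act f m := by
  simp [smul_def, rep]

instance (M : LComod k C) : IsScalarTower k (FunAlg k C) M where
  smul_assoc c d m := by rw [smul_def, map_smul]; rfl

theorem act_lin {M N : LComod k C} (g : M ⟶ N) (f : Module.Dual k C) (m : M) :
    lin g (M.act f m) = N.act f (lin g m) := by
  rw [act_apply, act_apply, lin_colinear, contract_lTensor]

/-- A morphism as a linear map over the free algebra. -/
def toD {M N : LComod k C} (g : M ⟶ N) : M →ₗ[FunAlg k C] N where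
  toFun := lin g
  map_add' := map_add _
  map_smul' d m := by
    simp only [RingHom.id_apply]
    induction d using FreeAlgebra.induction generalizing m with
    | grade0 c => simp
    | grade1 f => rw [ι_smul, ι_smul, act_lin]
    | mul a b ha hb => rw [mul_smul, mul_smul, ha, hb]
    | add a b ha hb => rw [add_smul, add_smul, map_add, ha, hb]

@[simp] theorem toD_apply {M N : LComod k C} (g : M ⟶ N) (m : M) : toD g m = lin g m := rfl

/-- A linear map over the free algebra as a morphism. -/
def ofD {M N : LComod k C} (g : M →ₗ[FunAlg k C] N) : M ⟶ N :=
  mkHom (g.restrictScalars k) fun m => eq_of_contract fun f => by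
    rw [contract_lTensor, ← act_apply, ← act_apply, ← ι_smul, ← ι_smul]
    simp

@[simp] theorem lin_ofD {M N : LComod k C} (g : M →ₗ[FunAlg k C] N) (m : M) :
    lin (ofD g) m = g m := rfl

/-- A stable subspace as a submodule over the free algebra. -/
def stable (M : LComod k C) (U : Submodule k M) (h : ∀ f, ∀ m ∈ U, M.act f m ∈ U) :
    Submodule (FunAlg k C) M where
  carrier := U
  add_mem' := U.add_mem
  zero_mem' := U.zero_mem
  smul_mem' d m hm := by
    induction d using FreeAlgebra.induction generalizing m with
    | grade0 c => simpa [smul_def] using U.smul_mem c hm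
    | grade1 f => rw [ι_smul]; exact h f m hm
    | mul a b ha hb => rw [mul_smul]; exact ha _ (hb _ hm)
    | add a b ha hb => rw [add_smul]; exact U.add_mem (ha _ hm) (hb _ hm)

/-! #### Subcomodules and quotients -/

variable (M : LComod k C)

/-- Stability under functionals is enough to be a subcomodule: membership in `C ⊗ U` is tested by
contraction. -/
theorem coact_mem_range (U : Submodule (FunAlg k C) M) (m : U) :
    M.coact m ∈ LinearMap.range ((U.restrictScalars k).subtype.lTensor C) :=
  mem_range_lTensor_subtype fun f => by
    rw [← act_apply, ← ι_smul]
    exact U.smul_mem _ m.2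

/-- The coaction on a subcomodule. -/
def subCoact (U : Submodule (FunAlg k C) M) :
    U.restrictScalars k →ₗ[k] C ⊗[k] U.restrictScalars k :=
  (LinearEquiv.ofInjective ((U.restrictScalars k).subtype.lTensor C)
    (lTensor_injective_of_injective (Submodule.injective_subtype _))).symm.toLinearMap ∘ₗ
    LinearMap.codRestrict _ (M.coact ∘ₗ (U.restrictScalars k).subtype) (M.coact_mem_range U)

theorem subCoact_spec (U : Submodule (FunAlg k C) M) (m : U.restrictScalars k) :
    M.coact ((U.restrictScalars k).subtype m) =
      (U.restrictScalars k).subtype.lTensor C (M.subCoact U m) := by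
  have := LinearEquiv.apply_symm_apply
    (LinearEquiv.ofInjective ((U.restrictScalars k).subtype.lTensor C)
      (lTensor_injective_of_injective (Submodule.injective_subtype _)))
    (LinearMap.codRestrict _ (M.coact ∘ₗ (U.restrictScalars k).subtype) (M.coact_mem_range U) m)
  exact (congrArg Subtype.val this).symm

/-- The subcomodule with the given underlying submodule. -/
def sub (U : Submodule (FunAlg k C) M) : LComod k C where
  carrier := U.restrictScalars k
  coact := M.subCoact U
  isCoaction := M.isCoaction.of_injective (Submodule.injective_subtype _) (M.subCoact_spec U)

/-- The inclusion of a subcomodule. -/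
def incl (U : Submodule (FunAlg k C) M) : M.sub U ⟶ M :=
  mkHom (U.restrictScalars k).subtype (M.subCoact_spec U)

theorem incl_injective (U : Submodule (FunAlg k C) M) : Function.Injective (lin (M.incl U)) :=
  Subtype.val_injective

theorem incl_mem (U : Submodule (FunAlg k C) M) (m : M.sub U) : lin (M.incl U) m ∈ U := m.2

/-- Restricting the codomain of a linear map to a subcomodule. -/
def codRestrictLin {N : LComod k C} (U : Submodule (FunAlg k C) M) (g : N ⟶ M)
    (h : ∀ n, lin g n ∈ U) : N →ₗ[k] M.sub U :=
  LinearMap.codRestrict (U.restrictScalars k) (lin g) h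

theorem incl_comp_codRestrictLin {N : LComod k C} (U : Submodule (FunAlg k C) M) (g : N ⟶ M)
    (h : ∀ n, lin g n ∈ U) : lin (M.incl U) ∘ₗ M.codRestrictLin U g h = lin g := rfl

/-- Restricting the codomain of a morphism to a subcomodule. -/
def codRestrict {N : LComod k C} (U : Submodule (FunAlg k C) M) (g : N ⟶ M)
    (h : ∀ n, lin g n ∈ U) : N ⟶ M.sub U :=
  mkHom (M.codRestrictLin U g h) fun n => by
    apply lTensor_injective_of_injective (C := C) (M.incl_injective U)
    rw [← lin_colinear, ← LinearMap.lTensor_comp_apply, incl_comp_codRestrictLin, ← lin_colinear]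
    rfl

@[simp] theorem lin_incl_codRestrict {N : LComod k C} (U : Submodule (FunAlg k C) M) (g : N ⟶ M)
    (h : ∀ n, lin g n ∈ U) (n : N) : lin (M.incl U) (lin (M.codRestrict U g h) n) = lin g n := rfl

/-- The coaction on a quotient comodule. -/
def quotCoact (U : Submodule (FunAlg k C) M) :
    (M ⧸ U.restrictScalars k) →ₗ[k] C ⊗[k] (M ⧸ U.restrictScalars k) :=
  (U.restrictScalars k).liftQ ((U.restrictScalars k).mkQ.lTensor C ∘ₗ M.coact) fun m hm =>
    eq_zero_of_contract fun f => by
      rw [LinearMap.comp_apply, contract_lTensor, ← act_apply, ← ι_smul]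
      simpa using U.smul_mem _ hm

/-- The quotient by a subcomodule. -/
def quot (U : Submodule (FunAlg k C) M) : LComod k C where
  carrier := M ⧸ U.restrictScalars k
  coact := M.quotCoact U
  isCoaction := M.isCoaction.of_surjective (Submodule.mkQ_surjective _) fun _ => rfl

/-- The projection onto a quotient comodule. -/
def proj (U : Submodule (FunAlg k C) M) : M ⟶ M.quot U :=
  mkHom (U.restrictScalars k).mkQ fun _ => rfl

theorem proj_surjective (U : Submodule (FunAlg k C) M) : Function.Surjective (lin (M.proj U)) :=
  Submodule.mkQ_surjective _

theorem proj_eq_zero (U : Submodule (FunAlg k C) M) (m : M) : lin (M.proj U) m = 0 ↔ m ∈ U :=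
  Submodule.Quotient.mk_eq_zero _

theorem ker_proj (U : Submodule (FunAlg k C) M) : LinearMap.ker (toD (M.proj U)) = U := by
  ext m; exact M.proj_eq_zero U m

variable {M}

/-! #### Monomorphisms, epimorphisms, isomorphisms -/

theorem mono_of_injective {M N : LComod k C} (f : M ⟶ N) (h : Function.Injective (lin f)) :
    Mono f where
  right_cancellation a b hab := hom_ext' fun m => h (by
    simpa using LinearMap.congr_fun (congrArg lin hab) m)

theorem epi_of_surjective {M N : LComod k C} (f : M ⟶ N) (h : Function.Surjective (lin f)) :
    Epi f where
  left_cancellation a b hab := hom_ext' fun m => by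
    obtain ⟨m, rfl⟩ := h m
    simpa using LinearMap.congr_fun (congrArg lin hab) m

/-- The kernel is a subcomodule, and a monomorphism cannot distinguish its inclusion from zero. -/
theorem mono_iff {M N : LComod k C} (f : M ⟶ N) : Mono f ↔ Function.Injective (lin f) := by
  refine ⟨fun _ => ?_, mono_of_injective f⟩
  have h0 : M.incl (LinearMap.ker (toD f)) ≫ f = 0 ≫ f := hom_ext' fun m => by
    simpa using M.incl_mem _ m
  have h1 := (cancel_mono f).mp h0
  rw [injective_iff_map_eq_zero]
  intro m hm
  exact LinearMap.congr_fun (congrArg lin h1) (⟨m, hm⟩ : M.sub (LinearMap.ker (toD f)))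

/-- The image is a subcomodule, and an epimorphism cannot distinguish the projection modulo its
image from zero. -/
theorem epi_iff {M N : LComod k C} (f : M ⟶ N) : Epi f ↔ Function.Surjective (lin f) := by
  refine ⟨fun _ => ?_, epi_of_surjective f⟩
  have h0 : f ≫ N.proj (LinearMap.range (toD f)) = f ≫ 0 := hom_ext' fun m => by
    simpa using (N.proj_eq_zero (LinearMap.range (toD f)) (lin f m)).mpr ⟨m, rfl⟩
  have h1 := (cancel_epi f).mp h0
  intro n
  exact (N.proj_eq_zero (LinearMap.range (toD f)) n).mp (LinearMap.congr_fun (congrArg lin h1) n)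

/-- A linear equivalence that is colinear is an isomorphism. -/
def isoOfEquiv {M N : LComod k C} (e : M ≃ₗ[k] N)
    (h : ∀ m, N.coact (e m) = e.toLinearMap.lTensor C (M.coact m)) : M ≅ N where
  hom := mkHom e.toLinearMap h
  inv := mkHom e.symm.toLinearMap fun n => by
    apply lTensor_injective_of_injective (C := C) (g := e.toLinearMap) e.injective
    rw [← LinearMap.lTensor_comp_apply]
    have := h (e.symm n)
    simp only [LinearEquiv.apply_symm_apply] at this
    simp [← this]
  hom_inv_id := hom_ext' fun m => by simp
  inv_hom_id := hom_ext' fun m => by simp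

@[simp] theorem lin_isoOfEquiv_hom {M N : LComod k C} (e : M ≃ₗ[k] N) (h) :
    lin (isoOfEquiv e h).hom = e.toLinearMap := rfl

@[simp] theorem lin_isoOfEquiv_inv {M N : LComod k C} (e : M ≃ₗ[k] N) (h) :
    lin (isoOfEquiv e h).inv = e.symm.toLinearMap := rfl

/-- A bijective morphism is an isomorphism. -/
def isoOfBijective {M N : LComod k C} (f : M ⟶ N) (h : Function.Bijective (lin f)) : M ≅ N :=
  isoOfEquiv (LinearEquiv.ofBijective (lin f) h) fun m => lin_colinear f m

@[simp] theorem isoOfBijective_hom {M N : LComod k C} (f : M ⟶ N)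
    (h : Function.Bijective (lin f)) : (isoOfBijective f h).hom = f := rfl

theorem isIso_of_bijective {M N : LComod k C} (f : M ⟶ N) (h : Function.Bijective (lin f)) :
    IsIso f := by
  rw [← isoOfBijective_hom f h]; infer_instance

theorem bijective_of_isIso {M N : LComod k C} (f : M ⟶ N) [IsIso f] :
    Function.Bijective (lin f) :=
  ⟨(mono_iff f).mp inferInstance, (epi_iff f).mp inferInstance⟩

/-! #### Local finiteness -/

/-- By coassociativity, successive functionals act through their convolution product. Hence the
vectors `f · m` already form a subcomodule, without closing up under further operators. -/
theorem coact_act_act (M : LComod k C) (f g : Module.Dual k C) (m : M) :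
    M.act g (M.act f m) = M.act
      ((LinearMap.mul' k k ∘ₗ TensorProduct.map f g) ∘ₗ Coalgebra.comul) m := by
  have h := congrArg (contract (V := M) g ∘ₗ contract (V := C ⊗[k] M) f)
    (M.isCoaction.coassoc m)
  simp only [LinearMap.comp_apply] at h
  rw [contract_lTensor] at h
  rw [act_apply, act_apply, act_apply, ← h]
  generalize M.coact m = x
  induction x with
  | zero => simp
  | add x y hx hy => simp only [map_add, hx, hy]
  | tmul c v =>
    simp only [LinearMap.rTensor_tmul, contract_tmul, LinearMap.comp_apply]
    generalize Coalgebra.comul (R := k) c = d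
    induction d with
    | zero => simp
    | add x y hx hy => simp only [TensorProduct.add_tmul, map_add, hx, hy, add_smul]
    | tmul a b => simp [mul_smul]

/-- The subcomodule generated by an element. -/
def gen (M : LComod k C) (m : M) : Submodule (FunAlg k C) M :=
  M.stable (LinearMap.range ((LinearMap.applyₗ (M.coact m)) ∘ₗ
      ((TensorProduct.lid k M).congrRight.toLinearMap ∘ₗ LinearMap.rTensorHom M) :
        Module.Dual k C →ₗ[k] M)) (by
    rintro f _ ⟨g, rfl⟩
    exact ⟨_, (M.coact_act_act g f m).symm⟩)

theorem mem_gen (M : LComod k C) (m n : M) : n ∈ M.gen m ↔ ∃ f, M.act f m = n := Iff.rfl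

theorem self_mem_gen (M : LComod k C) (m : M) : m ∈ M.gen m :=
  (M.mem_gen m m).mpr ⟨Coalgebra.counit, M.isCoaction.contract_counit m⟩

/-- The underlying vector space is finite-dimensional. -/
def FinDim (M : LComod k C) : Prop := Module.Finite k M

/-- The underlying vector space is nonzero. -/
def NonZero (M : LComod k C) : Prop := Nontrivial M

/-- The local finiteness of comodules: the coaction of `m` is a finite sum of pure tensors, and
every `f · m` lies in the span of their right-hand legs. -/
theorem finDim_gen (M : LComod k C) (m : M) : (M.sub (M.gen m)).FinDim := by
  obtain ⟨s, hs⟩ := TensorProduct.exists_finset (R := k) (M.coact m)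
  have hle : (M.gen m).restrictScalars k ≤ Submodule.span k (Prod.snd '' (s : Set (C × M))) := by
    intro n hn
    obtain ⟨f, rfl⟩ := (M.mem_gen m n).mp hn
    rw [act_apply, hs, map_sum]
    refine Submodule.sum_mem _ fun i hi => ?_
    rw [contract_tmul]
    exact Submodule.smul_mem _ _ (Submodule.subset_span ⟨i, hi, rfl⟩)
  have : Module.Finite k (Submodule.span k (Prod.snd '' (s : Set (C × M)))) :=
    Module.Finite.span_of_finite k (s.finite_toSet.image _)
  exact Submodule.finiteDimensional_of_le hle

end LComod

end

end BraidedCoFrob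

namespace BraidedCoFrob
noncomputable section
namespace LComod

variable {k C : Type u} [Field k] [AddCommGroup C] [Module k C] [Coalgebra k C]

/-! #### Finite-dimensional subcomodules -/

theorem FinDim.sup {M : LComod k C} {U V : Submodule (FunAlg k C) M}
    (hU : (M.sub U).FinDim) (hV : (M.sub V).FinDim) : (M.sub (U ⊔ V)).FinDim := by
  have : Module.Finite k (U.restrictScalars k) := hU
  have : Module.Finite k (V.restrictScalars k) := hV
  have h : (U ⊔ V).restrictScalars k = U.restrictScalars k ⊔ V.restrictScalars k := by
    ext m; simp [Submodule.mem_sup]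
  change Module.Finite k ((U ⊔ V).restrictScalars k)
  rw [h]; infer_instance

theorem exists_finDim_ge {M : LComod k C} (W : Submodule k M) [Module.Finite k W] :
    ∃ U : Submodule (FunAlg k C) M, W ≤ U.restrictScalars k ∧ (M.sub U).FinDim := by
  have hfg : W.FG := (Submodule.fg_top _).mp Module.Finite.fg_top
  induction W, hfg using Submodule.fg_induction with
  | singleton m =>
    exact ⟨M.gen m, by simpa [Submodule.span_le] using M.self_mem_gen m, M.finDim_gen m⟩
  | sup V W hV hW ihV ihW =>
    have : Module.Finite k V := Module.Finite.iff_fg.mpr hV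
    have : Module.Finite k W := Module.Finite.iff_fg.mpr hW
    obtain ⟨U, hU, hU'⟩ := ihV
    obtain ⟨U₂, hU₂, hU₂'⟩ := ihW
    exact ⟨U ⊔ U₂, sup_le (hU.trans (le_sup_left (a := U) (b := U₂)))
      (hU₂.trans (le_sup_right (a := U) (b := U₂))), hU'.sup hU₂'⟩

theorem FinDim.of_injective {M N : LComod k C} (hN : N.FinDim) (f : M →ₗ[k] N)
    (hf : Function.Injective f) : M.FinDim :=
  have : Module.Finite k N := hN
  Module.Finite.of_injective f hf

theorem FinDim.of_surjective {M N : LComod k C} (hM : M.FinDim) (f : M →ₗ[k] N)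
    (hf : Function.Surjective f) : N.FinDim :=
  have : Module.Finite k M := hM
  Module.Finite.of_surjective f hf

theorem FinDim.sub {M : LComod k C} (hM : M.FinDim) (U : Submodule (FunAlg k C) M) :
    (M.sub U).FinDim := hM.of_injective _ (M.incl_injective U)

theorem FinDim.quot {M : LComod k C} (hM : M.FinDim) (U : Submodule (FunAlg k C) M) :
    (M.quot U).FinDim := hM.of_surjective _ (M.proj_surjective U)

theorem FinDim.isArtinian {M : LComod k C} (hM : M.FinDim) : IsArtinian (FunAlg k C) M :=
  have : Module.Finite k M := hM
  isArtinian_of_tower k inferInstance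

/-- A finite-dimensional subspace of the target of a surjective morphism is contained in the image
of a finite-dimensional subcomodule. -/
theorem exists_finDim_map_ge {M N : LComod k C} (p : M ⟶ N) (hp : Function.Surjective (lin p))
    (W : Submodule k N) [Module.Finite k W] :
    ∃ U : Submodule (FunAlg k C) M, (M.sub U).FinDim ∧ ∀ n ∈ W, ∃ m ∈ U, lin p m = n := by
  obtain ⟨σ, hσ⟩ := (lin p).exists_rightInverse_of_surjective (LinearMap.range_eq_top.mpr hp)
  obtain ⟨U, hU, hU'⟩ := exists_finDim_ge (W.map σ)
  exact ⟨U, hU', fun n hn => ⟨σ n, hU ⟨n, hn, rfl⟩, LinearMap.congr_fun hσ n⟩⟩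

/-! #### Cofree comodules -/

section Cofree

variable (C) (V : Type u) [AddCommGroup V] [Module k V]

/-- The coaction `c ⊗ v ↦ c₍₁₎ ⊗ (c₍₂₎ ⊗ v)`. -/
def cofreeCoact : C ⊗[k] V →ₗ[k] C ⊗[k] (C ⊗[k] V) :=
  (TensorProduct.assoc k C C V).toLinearMap ∘ₗ Coalgebra.comul.rTensor V

variable {V}

/-- The slice `c ↦ c ⊗ v` is colinear, so identities for the cofree coaction reduce to the coalgebra
axioms. -/
theorem cofreeCoact_flip_mk (v : V) (c : C) :
    cofreeCoact C V ((TensorProduct.mk k C V).flip v c) =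
      ((TensorProduct.mk k C V).flip v).lTensor C (Coalgebra.comul (R := k) c) := by
  simp only [cofreeCoact, LinearMap.comp_apply, LinearMap.flip_apply, TensorProduct.mk_apply,
    LinearMap.rTensor_tmul]
  generalize Coalgebra.comul (R := k) c = d
  induction d with
  | zero => simp
  | add x y hx hy => simp only [TensorProduct.add_tmul, map_add, hx, hy]
  | tmul a b => simp

theorem isCoaction_cofreeCoact : IsCoaction (cofreeCoact (k := k) C V) where
  coassoc x := by
    induction x with
    | zero => simp
    | add x y hx hy => simp only [map_add, hx, hy]
    | tmul c v =>
      have h := cofreeCoact_flip_mk (k := k) C v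
      have hc := h c
      simp only [LinearMap.flip_apply, TensorProduct.mk_apply] at hc
      rw [hc, assoc_rTensor_comul_lTensor, Coalgebra.coassoc_apply,
        lTensor_lTensor_apply _ _ _ h]
  counit x := by
    induction x with
    | zero => simp
    | add x y hx hy => simp only [map_add, hx, hy]
    | tmul c v =>
      have hc := cofreeCoact_flip_mk (k := k) C v c
      simp only [LinearMap.flip_apply, TensorProduct.mk_apply] at hc
      change contract _ _ = _
      rw [hc, contract_lTensor, contract, LinearMap.comp_apply, Coalgebra.rTensor_counit_comul]
      simp

variable (V) in
/-- The cofree comodule `C ⊗ V`. -/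
def cofree : LComod k C where
  carrier := C ⊗[k] V
  coact := cofreeCoact C V
  isCoaction := isCoaction_cofreeCoact C

variable (V) in
/-- The counit `C ⊗ V → V` of a cofree comodule. -/
def cofreeCounit : cofree (k := k) C V →ₗ[k] V := contract (C := C) (V := V) Coalgebra.counit

variable {C}

theorem cofreeCoact_lTensor_coact {M : LComod k C} (g : M →ₗ[k] V) (m : M) :
    cofreeCoact C V ((g.lTensor C ∘ₗ M.coact) m) =
      (g.lTensor C ∘ₗ M.coact).lTensor C (M.coact m) := by
  rw [LinearMap.comp_apply, LinearMap.lTensor_comp, LinearMap.comp_apply, ← M.isCoaction.coassoc]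
  exact assoc_rTensor_comul_lTensor g _

/-- The morphism to a cofree comodule induced by a linear map. -/
def toCofree {M : LComod k C} (g : M →ₗ[k] V) : M ⟶ cofree C V :=
  mkHom (N := cofree C V) (g.lTensor C ∘ₗ M.coact) (cofreeCoact_lTensor_coact g)

theorem lin_toCofree {M : LComod k C} (g : M →ₗ[k] V) (m : M) :
    lin (toCofree g) m = g.lTensor C (M.coact m) := rfl

theorem lTensor_contract_cofreeCoact (x : C ⊗[k] V) :
    (contract (V := V) Coalgebra.counit).lTensor C (cofreeCoact C V x) = x := by
  induction x with
  | zero => simp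
  | add x y hx hy => simp only [map_add, hx, hy]
  | tmul c v =>
    have hc := cofreeCoact_flip_mk (k := k) C v c
    simp only [LinearMap.flip_apply, TensorProduct.mk_apply] at hc
    rw [hc]
    have h2 : contract Coalgebra.counit ∘ₗ (TensorProduct.mk k C V).flip v =
        (LinearMap.toSpanSingleton k V v) ∘ₗ Coalgebra.counit := by
      ext a; exact contract_tmul _ _ _
    rw [← LinearMap.lTensor_comp_apply, h2, LinearMap.lTensor_comp_apply,
      Coalgebra.lTensor_counit_comul]
    simp

/-- Together with `cofreeCounit_toCofree` this is the universal property: colinear maps into `C ⊗ V`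
correspond to linear maps into `V`. -/
theorem toCofree_counit {M : LComod k C} (h : M ⟶ cofree C V) :
    toCofree (cofreeCounit C V ∘ₗ lin h) = h := hom_ext' fun m => by
  rw [lin_toCofree, LinearMap.lTensor_comp_apply, ← lin_colinear]
  exact lTensor_contract_cofreeCoact _

theorem cofreeCounit_toCofree {M : LComod k C} (g : M →ₗ[k] V) :
    cofreeCounit C V ∘ₗ lin (toCofree g) = g := LinearMap.ext fun m =>
  (contract_lTensor _ _ _).trans (congrArg g (M.isCoaction.contract_counit m))

/-- Extending a colinear map into `C ⊗ V` amounts to extending a linear map into `V`, which is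
possible over a field by a linear left inverse of the monomorphism. -/
instance injective_cofree : Injective (cofree (k := k) C V) where
  factors {X Y} g f _ := by
    obtain ⟨r, hr⟩ := (lin f).exists_leftInverse_of_injective
      (LinearMap.ker_eq_bot.mpr ((mono_iff f).mp inferInstance))
    refine ⟨toCofree (cofreeCounit C V ∘ₗ lin g ∘ₗ r), ?_⟩
    rw [← toCofree_counit g]
    refine hom_ext' fun x => ?_
    rw [lin_comp, LinearMap.comp_apply, lin_toCofree, lin_toCofree, lin_colinear,
      ← LinearMap.lTensor_comp_apply]
    simp only [LinearMap.comp_assoc, hr]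
    rw [toCofree_counit]
    rfl

/-- The embedding of a comodule in a cofree one. -/
def toSelfCofree (M : LComod k C) : M ⟶ cofree C M := toCofree LinearMap.id

theorem toSelfCofree_injective (M : LComod k C) : Function.Injective (lin (toSelfCofree M)) := by
  have h := cofreeCounit_toCofree (M := M) LinearMap.id
  exact fun a b hab => by
    simpa using congrArg (cofreeCounit C M) hab |>.symm.trans (LinearMap.congr_fun h a) |>.symm.trans
      (LinearMap.congr_fun h b)

instance (M : LComod k C) : Mono (toSelfCofree M) := mono_of_injective _ M.toSelfCofree_injective

end Cofree

/-! #### Injective hulls and projective covers -/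

/-- `i : M ⟶ E` is an injective hull: an essential monomorphism into an injective object. -/
structure IsInjectiveHull {M E : LComod k C} (i : M ⟶ E) : Prop where
  injective : Injective E
  mono : Mono i
  essential : ∀ {X : LComod k C} (g : E ⟶ X), Mono (i ≫ g) → Mono g

/-- `p : P ⟶ M` is a projective cover: a superfluous epimorphism from a projective object. -/
structure IsProjectiveCover {P M : LComod k C} (p : P ⟶ M) : Prop where
  projective : Projective P
  epi : Epi p
  superfluous : ∀ {X : LComod k C} (g : X ⟶ P), Epi (g ≫ p) → Epi g

/-- The injective hull of `M` exists and is finite-dimensional. -/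
def HasFinDimInjectiveHull (M : LComod k C) : Prop :=
  ∃ (E : LComod k C) (i : M ⟶ E), IsInjectiveHull i ∧ E.FinDim

/-- `M` has a projective cover. -/
def HasProjectiveCover (M : LComod k C) : Prop :=
  ∃ (P : LComod k C) (p : P ⟶ M), IsProjectiveCover p

/-- `M` has a nonzero finite-dimensional quotient. -/
def HasFinDimQuotient (M : LComod k C) : Prop :=
  ∃ (N : LComod k C) (p : M ⟶ N), Function.Surjective (lin p) ∧ N.NonZero ∧ N.FinDim

end LComod

/-! ### Maximal disjoint submodules and maximal essential extensions -/

section Lattice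

variable {D J : Type*} [Ring D] [AddCommGroup J] [Module D J]

theorem exists_maximal_disjoint_submodule (U : Submodule D J) :
    ∃ K, Maximal (fun K : Submodule D J => Disjoint K U) K := by
  obtain ⟨K, -, hK⟩ := zorn_le_nonempty₀ {K : Submodule D J | Disjoint K U} (fun c hc hch y hy => by
    refine ⟨sSup c, ?_, fun z hz => le_sSup hz⟩
    rw [Set.mem_ofPred_eq, Submodule.disjoint_def]
    intro x hx hxU
    obtain ⟨W, hW, hxW⟩ := (Submodule.mem_sSup_of_directed ⟨y, hy⟩ hch.directedOn).mp hx
    exact Submodule.disjoint_def.mp (hc hW) x hxW hxU) ⊥ disjoint_bot_left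
  exact ⟨K, hK⟩

/-- `U` is an essential extension of `N` inside `J`. -/
def IsEssExt (N U : Submodule D J) : Prop := N ≤ U ∧ ∀ W ≤ U, Disjoint W N → W = ⊥

/-- Zorn: for `W` inside the union of a chain and `x ∈ W`, the cyclic submodule of `x` lies in one
member of the chain, where it is disjoint from `N` and hence zero. -/
theorem exists_maximal_isEssExt (N : Submodule D J) : ∃ U, Maximal (IsEssExt N) U := by
  obtain ⟨K, -, hK⟩ := zorn_le_nonempty₀ {U : Submodule D J | IsEssExt N U}
    (fun c hc hch y hy => by
      refine ⟨sSup c, ⟨(hc hy).1.trans (le_sSup hy), fun W hW hWN => ?_⟩, fun z hz => le_sSup hz⟩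
      rw [eq_bot_iff]
      intro x hx
      obtain ⟨U, hU, hxU⟩ := (Submodule.mem_sSup_of_directed ⟨y, hy⟩ hch.directedOn).mp (hW hx)
      have := (hc hU).2 (D ∙ x) (by simpa using hxU)
        (hWN.mono_left (by simpa using hx))
      simpa using this) N ⟨le_rfl, fun W hW h => by simpa [disjoint_iff, inf_eq_left.mpr hW] using h⟩
  exact ⟨K, hK⟩

end Lattice

namespace LComod

variable {k C : Type u} [Field k] [AddCommGroup C] [Module k C] [Coalgebra k C]

/-- Every subobject of an injective object has an injective hull inside it. -/
theorem exists_injectiveHull {M J : LComod k C} (i : M ⟶ J) (hi : Function.Injective (lin i))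
    [Injective J] : ∃ (U : Submodule (FunAlg k C) J) (i' : M ⟶ J.sub U), IsInjectiveHull i' := by
  set N := LinearMap.range (toD i)
  -- `U` is a maximal essential extension of the image of `M`, and `K` a maximal subobject disjoint
  -- from `U`. The aim is a retraction of `J` onto `U`, which makes `U` injective.
  obtain ⟨U, hU⟩ := exists_maximal_isEssExt N
  obtain ⟨K, hK⟩ := exists_maximal_disjoint_submodule U
  have hKU := Submodule.disjoint_def.mp hK.prop
  let e : J.sub U ⟶ J.quot K := J.incl U ≫ J.proj K
  have he : Mono e := mono_of_injective _ <| by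
    rw [injective_iff_map_eq_zero]
    intro x hx
    apply J.incl_injective U
    rw [map_zero]
    exact hKU _ ((J.proj_eq_zero K _).mp hx) (J.incl_mem U x)
  let g : J.quot K ⟶ J := Injective.factorThru (J.incl U) e
  have hg : ∀ x ∈ U, lin g (lin (J.proj K) x) = x := fun x hx =>
    LinearMap.congr_fun (congrArg lin (Injective.comp_factorThru (J.incl U) e)) (⟨x, hx⟩ : J.sub U)
  let q : J →ₗ[FunAlg k C] J := toD (J.proj K ≫ g)
  have hq : ∀ x ∈ U, q x = x := hg
  have hmax : ∀ W : Submodule (FunAlg k C) J, K ≤ W → Disjoint W U → W = K := fun W h1 h2 =>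
    (hK.le_of_ge h2 h1).antisymm h1
  have hKq : ∀ x ∈ K, q x = 0 := fun x hx => by
    change lin g (lin (J.proj K) x) = 0
    rw [(J.proj_eq_zero K x).mpr hx, map_zero]
  -- The image of `q` contains `U` and is still essential over `N`; maximality of `U` makes the two
  -- equal.
  have hrange : IsEssExt N (LinearMap.range q) := by
    refine ⟨hU.prop.1.trans fun x hx => ⟨x, hq x hx⟩, fun W hW hWN => ?_⟩
    have h1 : W ⊓ U = ⊥ := hU.prop.2 _ inf_le_right (hWN.mono_left inf_le_left)
    -- The preimage of `W` contains `K` and is disjoint from `U`, so it is `K` by maximality;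
    -- therefore `W` is contained in `q(K) = 0`.
    have h2 : W.comap q = K := hmax _ (fun x hx => by simp [hKq x hx]) <| by
      rw [Submodule.disjoint_def]
      intro x hx hxU
      rw [Submodule.mem_comap, hq x hxU] at hx
      exact (Submodule.eq_bot_iff _).mp h1 x ⟨hx, hxU⟩
    rw [eq_bot_iff]
    intro x hx
    obtain ⟨y, rfl⟩ := hW hx
    have hy : y ∈ K := h2 ▸ hx
    simp [hKq y hy]
  have hUq : LinearMap.range q ≤ U :=
    hU.le_of_ge hrange fun x hx => ⟨x, hq x hx⟩
  let r : J ⟶ J.sub U := J.codRestrict U (J.proj K ≫ g) fun x => hUq ⟨x, rfl⟩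
  have hr : J.incl U ≫ r = 𝟙 _ := hom_ext' fun x =>
    J.incl_injective U (hg _ (J.incl_mem U x))
  refine ⟨U, J.codRestrict U i fun m => hU.prop.1 ⟨m, rfl⟩, ?_, ?_, ?_⟩
  · exact Retract.injective (Y := J) ⟨J.incl U, r, hr⟩
  · refine mono_of_injective _ fun a b hab => hi ?_
    exact congrArg (lin (J.incl U)) hab
  · intro X h hmono
    have hinj := (mono_iff _).mp hmono
    refine mono_of_injective _ ?_
    -- The kernel of `h` meets the image of `M` trivially, hence vanishes by essentiality.
    have h0 := hU.prop.2 ((LinearMap.ker (toD h)).map (toD (J.incl U))) (by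
      rintro _ ⟨x, -, rfl⟩; exact J.incl_mem U x) (by
      rw [Submodule.disjoint_def]
      rintro _ ⟨x, hx, rfl⟩ ⟨m, hm⟩
      have hxm : x = lin (J.codRestrict U i fun m => hU.prop.1 ⟨m, rfl⟩) m :=
        J.incl_injective U hm.symm
      rw [hxm] at hx
      have : m = 0 := hinj (by rw [map_zero]; exact hx)
      rw [hxm, this, map_zero, map_zero])
    rw [injective_iff_map_eq_zero]
    intro x hx
    apply J.incl_injective U
    rw [map_zero]
    exact (Submodule.eq_bot_iff _).mp h0 _ ⟨x, hx, rfl⟩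

end LComod

end

end BraidedCoFrob

namespace BraidedCoFrob
noncomputable section

/-! ### Direct sums -/

section

variable {k C V W : Type u} [Field k] [AddCommGroup C] [Module k C] [Coalgebra k C]
  [AddCommGroup V] [Module k V] [AddCommGroup W] [Module k W]

/-- Stated at the points `g v` only, so that the axioms on products and direct sums can be checked
summand by summand. -/
theorem IsCoaction.coassoc_map {ρ : V →ₗ[k] C ⊗[k] V} {σ : W →ₗ[k] C ⊗[k] W}
    (hρ : IsCoaction ρ) (g : V →ₗ[k] W) (h : ∀ v, σ (g v) = g.lTensor C (ρ v)) (v : V) :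
    TensorProduct.assoc k C C W
      ((Coalgebra.comul (R := k) (A := C)).rTensor W (σ (g v))) = σ.lTensor C (σ (g v)) := by
  rw [h, assoc_rTensor_comul_lTensor, hρ.coassoc, lTensor_lTensor_apply g ρ σ h]

theorem IsCoaction.counit_map {ρ : V →ₗ[k] C ⊗[k] V} {σ : W →ₗ[k] C ⊗[k] W}
    (hρ : IsCoaction ρ) (g : V →ₗ[k] W) (h : ∀ v, σ (g v) = g.lTensor C (ρ v)) (v : V) :
    TensorProduct.lid k W ((Coalgebra.counit (R := k) (A := C)).rTensor W (σ (g v))) = g v := by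
  change contract _ _ = _
  rw [h, contract_lTensor, hρ.contract_counit]

end

namespace LComod

variable {k C : Type u} [Field k] [AddCommGroup C] [Module k C] [Coalgebra k C]

section Prod

variable (M N : LComod k C)

/-- The coaction on a direct product. -/
def prodCoact : (M × N) →ₗ[k] C ⊗[k] (M × N) :=
  LinearMap.coprod ((LinearMap.inl k M N).lTensor C ∘ₗ M.coact)
    ((LinearMap.inr k M N).lTensor C ∘ₗ N.coact)

theorem prodCoact_inl (m : M) : prodCoact M N (LinearMap.inl k M N m) =
    (LinearMap.inl k M N).lTensor C (M.coact m) := by simp [prodCoact]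

theorem prodCoact_inr (n : N) : prodCoact M N (LinearMap.inr k M N n) =
    (LinearMap.inr k M N).lTensor C (N.coact n) := by simp [prodCoact]

/-- The direct product of two comodules. -/
def prod : LComod k C where
  carrier := M × N
  coact := prodCoact M N
  isCoaction :=
    { coassoc := fun x => by
        have hx : x = LinearMap.inl k M N x.1 + LinearMap.inr k M N x.2 := by simp
        rw [hx]
        simp only [map_add, M.isCoaction.coassoc_map _ (prodCoact_inl M N),
          N.isCoaction.coassoc_map _ (prodCoact_inr M N)]
      counit := fun x => by
        have hx : x = LinearMap.inl k M N x.1 + LinearMap.inr k M N x.2 := by simp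
        rw [hx]
        simp only [map_add, M.isCoaction.counit_map _ (prodCoact_inl M N),
          N.isCoaction.counit_map _ (prodCoact_inr M N)] }

theorem prodCoact_fst (x : M × N) :
    M.coact x.1 = (LinearMap.fst k M N).lTensor C (prodCoact M N x) := by
  simp [prodCoact, ← LinearMap.lTensor_comp_apply]

theorem prodCoact_snd (x : M × N) :
    N.coact x.2 = (LinearMap.snd k M N).lTensor C (prodCoact M N x) := by
  simp [prodCoact, ← LinearMap.lTensor_comp_apply]

/-- The first projection. -/
def fst : prod M N ⟶ M := mkHom (M := prod M N) (LinearMap.fst k M N) (prodCoact_fst M N)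

/-- The second projection. -/
def snd : prod M N ⟶ N := mkHom (M := prod M N) (LinearMap.snd k M N) (prodCoact_snd M N)

end Prod

section DSum

variable {ι : Type u} [DecidableEq ι] (M : ι → LComod k C)

/-- The inclusion of a summand, as a linear map. -/
def singleLin (i : ι) : M i →ₗ[k] (Π₀ i, (M i).carrier) :=
  DFinsupp.lsingle (R := k) (M := fun i => (M i).carrier) i

theorem singleLin_apply (i : ι) (m : M i) :
    singleLin M i m = DFinsupp.single (β := fun i => (M i).carrier) i m := rfl

@[elab_as_elim]
theorem singleLin_induction {p : (Π₀ i, (M i).carrier) → Prop} (x : Π₀ i, (M i).carrier)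
    (zero : p 0) (add : ∀ i m x, p x → p (singleLin M i m + x)) : p x := by
  induction x using DFinsupp.induction with
  | h0 => exact zero
  | ha i b f _ _ hf => exact add i b f hf

variable {M} in
/-- The linear map out of a direct sum given by a family of linear maps. -/
def descLin {V : Type u} [AddCommGroup V] [Module k V] (f : ∀ i, M i →ₗ[k] V) :
    (Π₀ i, (M i).carrier) →ₗ[k] V := DFinsupp.lsum k f

variable {M} in
theorem descLin_single {V : Type u} [AddCommGroup V] [Module k V] (f : ∀ i, M i →ₗ[k] V)
    (i : ι) (m : M i) : descLin f (singleLin M i m) = f i m := by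
  simp [descLin, singleLin_apply]

/-- The coaction on a direct sum. -/
def dsumCoact : (Π₀ i, (M i).carrier) →ₗ[k] C ⊗[k] (Π₀ i, (M i).carrier) :=
  descLin (V := C ⊗[k] (Π₀ i, (M i).carrier))
    fun i => (singleLin M i).lTensor C ∘ₗ (M i).coact

theorem dsumCoact_single (i : ι) (m : M i) :
    dsumCoact M (singleLin M i m) = (singleLin M i).lTensor C ((M i).coact m) :=
  descLin_single _ i m

/-- The direct sum of a family of comodules. -/
def dsum : LComod k C where
  carrier := Π₀ i, (M i).carrier
  coact := dsumCoact M
  isCoaction :=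
    { coassoc := fun x => by
        induction x using singleLin_induction with
        | zero => simp
        | add i m x hx =>
          simp only [map_add, hx]
          rw [(M i).isCoaction.coassoc_map (singleLin M i) (dsumCoact_single M i) m]
      counit := fun x => by
        induction x using singleLin_induction with
        | zero => simp
        | add i m x hx =>
          simp only [map_add, hx]
          rw [(M i).isCoaction.counit_map (singleLin M i) (dsumCoact_single M i) m] }

/-- The inclusion of a summand. -/
def single (i : ι) : M i ⟶ dsum M :=
  mkHom (N := dsum M) (singleLin M i) (dsumCoact_single M i)

@[elab_as_elim]
theorem dsum_induction {p : dsum M → Prop} (x : dsum M)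
    (zero : p 0) (add : ∀ i m x, p x → p (lin (single M i) m + x)) : p x :=
  singleLin_induction M x zero add

variable {M} {N : LComod k C}

theorem dsum_hom_ext {f g : dsum M ⟶ N} (h : ∀ i, single M i ≫ f = single M i ≫ g) : f = g := by
  refine hom_ext' fun x => ?_
  induction x using dsum_induction with
  | zero => simp
  | add i m x hx =>
    rw [map_add, map_add, hx]
    congr 1
    exact LinearMap.congr_fun (congrArg lin (h i)) m

theorem desc_colinear (f : ∀ i, M i ⟶ N) (x : Π₀ i, (M i).carrier) :
    N.coact (descLin (fun i => lin (f i)) x) =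
      (descLin (fun i => lin (f i))).lTensor C (dsumCoact M x) := by
  induction x using singleLin_induction with
  | zero => simp
  | add i m x hx =>
    simp only [map_add, hx]
    congr 1
    rw [descLin_single, dsumCoact_single, lin_colinear, ← LinearMap.lTensor_comp_apply]
    congr 2
    exact LinearMap.ext fun m => (descLin_single (fun i => lin (f i)) i m).symm

/-- The morphism out of a direct sum given by a family of morphisms. -/
def desc (f : ∀ i, M i ⟶ N) : dsum M ⟶ N :=
  mkHom (M := dsum M) (descLin fun i => lin (f i)) (desc_colinear f)

theorem single_desc (f : ∀ i, M i ⟶ N) (i : ι) : single M i ≫ desc f = f i :=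
  hom_ext' fun m => descLin_single (fun i => lin (f i)) i m

theorem lin_desc_single (f : ∀ i, M i ⟶ N) (i : ι) (m : M i) :
    lin (desc f) (lin (single M i) m) = lin (f i) m :=
  descLin_single (fun i => lin (f i)) i m

theorem projective_dsum (h : ∀ i, Projective (M i)) : Projective (dsum M) where
  factors {E X} f e _ :=
    ⟨desc fun i => Projective.factorThru (single M i ≫ f) e, dsum_hom_ext fun i => by
      rw [← Category.assoc, single_desc, Projective.factorThru_comp]⟩

variable (M) in
/-- The projection to a summand. -/
def component (i : ι) : dsum M ⟶ M i :=
  desc fun j => if h : j = i then eqToHom (by rw [h]) else 0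

theorem single_component (i : ι) : single M i ≫ component M i = 𝟙 _ := by
  rw [component, single_desc]; simp

theorem single_component_ne {i j : ι} (h : i ≠ j) : single M i ≫ component M j = 0 := by
  rw [component, single_desc]; simp [h]

/-- The components of an element of a direct sum. -/
def toDFinsupp (x : dsum M) : Π₀ i, (M i).carrier := x

theorem lin_component (i : ι) (x : dsum M) : lin (component M i) x = toDFinsupp x i := by
  induction x using dsum_induction with
  | zero => rw [map_zero]; rfl
  | add j m x hx =>
    have h1 : toDFinsupp (lin (single M j) m + x) i =
        DFinsupp.single (β := fun i => (M i).carrier) j m i + toDFinsupp x i := rfl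
    rw [map_add, hx, h1]
    congr 1
    by_cases h : j = i
    · subst h
      rw [DFinsupp.single_eq_same]
      exact LinearMap.congr_fun (congrArg lin (single_component (M := M) j)) m
    · rw [DFinsupp.single_eq_of_ne (Ne.symm h)]
      exact LinearMap.congr_fun (congrArg lin (single_component_ne (M := M) h)) m

theorem dsum_eq_zero {x : dsum M} (h : ∀ i, lin (component M i) x = 0) : x = 0 :=
  DFinsupp.ext (f := toDFinsupp x) (g := 0) fun i => (lin_component i x).symm.trans (h i)

theorem mem_of_component_mem (K : Submodule (FunAlg k C) (dsum M)) (x : dsum M)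
    (h : ∀ i, lin (single M i) (lin (component M i) x) ∈ K) : x ∈ K := by
  classical
  have hx : x = ∑ i ∈ (toDFinsupp x).support, lin (single M i) (toDFinsupp x i) :=
    (DFinsupp.sum_single (f := toDFinsupp x)).symm
  rw [hx]
  exact K.sum_mem fun i _ => lin_component i x ▸ h i

end DSum

/-! #### Projectivity and finite-dimensional objects -/

/-- Lifting against an arbitrary epimorphism `E → X` only concerns a finite-dimensional subobject of
`E` that covers the image of `P`. Its fibre product with `P` over `X` is finite-dimensional and maps
onto `P`, so a section of it is a lift. -/
theorem projective_of_split {P : LComod k C} (hP : P.FinDim)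
    (h : ∀ (Y : LComod k C) (p : Y ⟶ P), Y.FinDim → Function.Surjective (lin p) →
      ∃ s : P ⟶ Y, s ≫ p = 𝟙 P) : Projective P where
  factors {E X} f e _ := by
    have : Module.Finite k P := hP
    obtain ⟨U, hU, hUf⟩ := exists_finDim_map_ge e ((epi_iff e).mp inferInstance)
      (LinearMap.range (lin f))
    let a := fst (E.sub U) P ≫ E.incl U
    let b := snd (E.sub U) P
    -- The fibre product of `U` and `P` over `X`.
    let K := LinearMap.ker (toD (a ≫ e) - toD (b ≫ f))
    have hK : ∀ x ∈ K, lin e (lin a x) = lin f (lin b x) := fun x hx => sub_eq_zero.mp hx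
    have hfd : ((prod (E.sub U) P).sub K).FinDim := by
      have : Module.Finite k (E.sub U) := hU
      exact FinDim.sub (inferInstanceAs (Module.Finite k (E.sub U × P))) K
    obtain ⟨s, hs⟩ := h _ ((prod (E.sub U) P).incl K ≫ b) hfd fun y => by
      obtain ⟨x, hx, hxy⟩ := hUf _ ⟨y, rfl⟩
      exact ⟨⟨((⟨x, hx⟩ : E.sub U), y), sub_eq_zero.mpr hxy⟩, rfl⟩
    refine ⟨s ≫ (prod (E.sub U) P).incl K ≫ a, hom_ext' fun y => ?_⟩
    have h1 := hK _ ((prod (E.sub U) P).incl_mem K (lin s y))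
    have h2 : lin b (lin ((prod (E.sub U) P).incl K) (lin s y)) = y :=
      LinearMap.congr_fun (congrArg lin hs) y
    rw [h2] at h1
    exact h1

/-! ### Superfluous epimorphisms and finite-dimensional projective objects -/

/-- The kernel of `q` is superfluous. -/
def Superfluous {L S : LComod k C} (q : L ⟶ S) : Prop :=
  ∀ U : Submodule (FunAlg k C) L, U.map (toD q) = ⊤ → U = ⊤

theorem Superfluous.epi {L S X : LComod k C} {q : L ⟶ S} (h : Superfluous q) (g : X ⟶ L)
    (hg : Epi (g ≫ q)) : Epi g := by
  suffices hr : LinearMap.range (toD g) = ⊤ from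
    epi_of_surjective g (show Function.Surjective (toD g) from LinearMap.range_eq_top.mp hr)
  refine h _ ?_
  rw [eq_top_iff]
  rintro s -
  obtain ⟨x, rfl⟩ := (epi_iff _).mp hg s
  exact ⟨lin g x, ⟨x, rfl⟩, rfl⟩

/-- By the descending chain condition there is a minimal subobject of `Y` that maps onto `S`; its
minimality is exactly superfluousness of the restricted map. -/
theorem exists_superfluous_restrict {Y S : LComod k C} (hY : Y.FinDim) (q : Y ⟶ S)
    (hq : Function.Surjective (lin q)) : ∃ U : Submodule (FunAlg k C) Y,
      Function.Surjective (lin (Y.incl U ≫ q)) ∧ Superfluous (Y.incl U ≫ q) := by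
  have := hY.isArtinian
  obtain ⟨U, hU, hmin⟩ := IsArtinian.set_has_minimal
    {U : Submodule (FunAlg k C) Y | U.map (toD q) = ⊤}
    ⟨⊤, by rw [Set.mem_ofPred_eq, Submodule.map_top]; exact LinearMap.range_eq_top.mpr hq⟩
  refine ⟨U, fun s => ?_, fun V hV => ?_⟩
  · obtain ⟨x, hx, rfl⟩ : s ∈ U.map (toD q) := hU.symm ▸ Submodule.mem_top
    exact ⟨⟨x, hx⟩, rfl⟩
  · have h1 : (V.map (toD (Y.incl U))).map (toD q) = ⊤ := by
      rw [← hV]; ext s; simp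
    have h2 : V.map (toD (Y.incl U)) ≤ U := by
      rintro _ ⟨x, -, rfl⟩; exact Y.incl_mem U x
    have h3 : V.map (toD (Y.incl U)) = U := by
      by_contra hne
      exact hmin _ h1 (lt_of_le_of_ne h2 hne)
    rw [eq_top_iff]
    rintro x -
    obtain ⟨y, hy, hyx⟩ : lin (Y.incl U) x ∈ V.map (toD (Y.incl U)) := h3.symm ▸ Y.incl_mem U x
    exact (Y.incl_injective U hyx) ▸ hy

theorem bijective_of_surjective_endo {L : LComod k C} (hL : L.FinDim) (e : L ⟶ L)
    (he : Function.Surjective (lin e)) : Function.Bijective (lin e) :=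
  have : Module.Finite k L := hL
  ⟨LinearMap.injective_iff_surjective.mpr he, he⟩

/-- Let `U` be minimal mapping onto `S`. Lifting `p` to `T → U` and restricting to `U` gives an
endomorphism of `U` that is surjective by superfluousness, hence bijective by dimension. So `U` is a
retract of `T` and inherits projectivity. -/
theorem exists_finDim_cover {T S : LComod k C} (hT : T.FinDim) [Projective T] (p : T ⟶ S)
    (hp : Function.Surjective (lin p)) : ∃ (L : LComod k C) (q : L ⟶ S), L.FinDim ∧ Projective L ∧
      Function.Surjective (lin q) ∧ Superfluous q := by
  obtain ⟨U, hU, hs⟩ := exists_superfluous_restrict hT p hp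
  have : Epi (T.incl U ≫ p) := epi_of_surjective _ hU
  let t : T ⟶ T.sub U := Projective.factorThru p (T.incl U ≫ p)
  have ht : t ≫ T.incl U ≫ p = p := Projective.factorThru_comp _ _
  have he : Epi (T.incl U ≫ t) := hs.epi _ (by rw [Category.assoc, ht]; infer_instance)
  have hb := bijective_of_surjective_endo (hT.sub U) _ ((epi_iff _).mp he)
  have := isIso_of_bijective _ hb
  refine ⟨T.sub U, T.incl U ≫ p, hT.sub U, ?_, hU, hs⟩
  exact Retract.projective (Y := T) ⟨T.incl U, t ≫ inv (T.incl U ≫ t), by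
    rw [← Category.assoc, IsIso.hom_inv_id]⟩

/-- If one finite-dimensional object maps nontrivially to the simple object `T` through every
epimorphism onto `T`, then `T` is a quotient of a finite-dimensional projective object. -/
theorem exists_finDim_projective {T W : LComod k C} [IsSimpleModule (FunAlg k C) T]
    (hT : T.FinDim) (hW : W.FinDim)
    (h : ∀ (Q : LComod k C) (q : Q ⟶ T), Function.Surjective (lin q) →
      ∃ w : W ⟶ Q, w ≫ q ≠ 0) :
    ∃ (P : LComod k C) (p : P ⟶ T), P.FinDim ∧ Projective P ∧ Function.Surjective (lin p) := by
  have : Module.Finite k W := hW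
  -- The dimensions of finite-dimensional superfluous covers of `T`. They are bounded by `dim W`: a
  -- nonzero map `W → Q → T` is onto because `T` is simple, so `W → Q` is onto because the cover is
  -- superfluous.
  let A : Set ℕ := {n | ∃ (Q : LComod k C) (q : Q ⟶ T), Q.FinDim ∧ Function.Surjective (lin q) ∧
    Superfluous q ∧ Module.finrank k Q = n}
  have hA : BddAbove A := by
    refine ⟨Module.finrank k W, ?_⟩
    rintro _ ⟨Q, q, hQ, hq, hs, rfl⟩
    have : Module.Finite k Q := hQ
    obtain ⟨w, hw⟩ := h Q q hq
    have hwq : Epi (w ≫ q) := epi_of_surjective _ <|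
      LinearMap.surjective_of_ne_zero (f := toD (w ≫ q)) fun h0 => hw <| hom_ext' fun x =>
        LinearMap.congr_fun h0 x
    exact LinearMap.finrank_le_finrank_of_surjective ((epi_iff _).mp (hs.epi w hwq))
  have hne : A.Nonempty := ⟨_, T, 𝟙 T, hT, fun x => ⟨x, rfl⟩, fun U hU => by
    have : toD (𝟙 T) = LinearMap.id := rfl
    simpa [this] using hU, rfl⟩
  -- A cover `Q` of maximal dimension is projective. An epimorphism `Y → Q` restricts to a subobject
  -- of `Y` that is a superfluous cover of `T` and still maps onto `Q`; its dimension cannot exceed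
  -- that of `Q`, so the restriction is an isomorphism and splits `Y → Q`.
  obtain ⟨Q, q, hQ, hq, hs, hn⟩ := Nat.sSup_mem hne hA
  refine ⟨Q, q, hQ, projective_of_split hQ fun Y p hY hp => ?_, hq⟩
  obtain ⟨U, hU, hUs⟩ := exists_superfluous_restrict hY (p ≫ q) (hq.comp hp)
  have h1 : Epi (Y.incl U ≫ p) := hs.epi _ (by rw [Category.assoc]; exact epi_of_surjective _ hU)
  have h2 := (epi_iff _).mp h1
  have : Module.Finite k Q := hQ
  have : Module.Finite k (Y.sub U) := hY.sub U
  have h3 : Module.finrank k (Y.sub U) ≤ Module.finrank k Q := by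
    rw [hn]; exact le_csSup hA ⟨_, _, hY.sub U, hU, hUs, rfl⟩
  have h4 : Function.Injective (lin (Y.incl U ≫ p)) :=
    (LinearMap.injective_iff_surjective_of_finrank_eq_finrank
      (h3.antisymm (LinearMap.finrank_le_finrank_of_surjective h2))).mpr h2
  have := isIso_of_bijective _ ⟨h4, h2⟩
  exact ⟨inv (Y.incl U ≫ p) ≫ Y.incl U, by rw [Category.assoc, IsIso.inv_hom_id]⟩

/-- A nonzero projective object has a nonzero finite-dimensional quotient. -/
theorem exists_finDim_hom_of_projective {P : LComod k C} [Projective P] (hP : P.NonZero) :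
    ∃ (G : LComod k C) (g : P ⟶ G), G.FinDim ∧ g ≠ 0 := by
  classical
  have : Nontrivial P := hP
  -- `P` is a quotient of the direct sum of its cyclic, finite-dimensional subobjects, and
  -- projectivity provides a section. If all maps to finite-dimensional objects were zero, every
  -- component of this section would vanish.
  let f : dsum (fun m : P => P.sub (P.gen m)) ⟶ P := desc fun m => P.incl (P.gen m)
  have hf : Epi f := epi_of_surjective _ fun m =>
    ⟨lin (single (fun m : P => P.sub (P.gen m)) m) ⟨m, P.self_mem_gen m⟩,
      lin_desc_single (fun m => P.incl (P.gen m)) m ⟨m, P.self_mem_gen m⟩⟩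
  let s := Projective.factorThru (𝟙 P) f
  have hs : s ≫ f = 𝟙 P := Projective.factorThru_comp _ _
  by_contra! hcon
  have h0 : ∀ m, s ≫ component _ m = 0 := fun m => hcon _ _ (P.finDim_gen m)
  have hs0 : s = 0 := hom_ext' fun x => by
    exact dsum_eq_zero fun i => LinearMap.congr_fun (congrArg lin (h0 i)) x
  rw [hs0, Limits.zero_comp] at hs
  obtain ⟨x, hx⟩ := exists_ne (0 : P)
  exact hx (LinearMap.congr_fun (congrArg lin hs) x).symm

end LComod

end

end BraidedCoFrob

namespace BraidedCoFrob
noncomputable section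
namespace LComod

variable {k C : Type u} [Field k] [AddCommGroup C] [Module k C] [Coalgebra k C]

/-! #### Existence of projective covers -/

/-- For a proper `W`, the quotient `M/W` has a nonzero finite-dimensional quotient, which has a
maximal proper subobject; its preimage in `M` is maximal and contains `W`. -/
theorem isCoatomic_of_hasFinDimQuotient
    (h : ∀ M : LComod k C, M.NonZero → M.HasFinDimQuotient) (M : LComod k C) :
    IsCoatomic (Submodule (FunAlg k C) M) where
  eq_top_or_exists_le_coatom W := by
    by_cases hW : W = ⊤
    · exact Or.inl hW
    right
    have hne : (M.quot W).NonZero := by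
      obtain ⟨m, -, hm⟩ := SetLike.exists_of_lt (lt_top_iff_ne_top.mpr hW)
      exact ⟨lin (M.proj W) m, 0, fun h0 => hm ((M.proj_eq_zero W m).mp h0)⟩
    obtain ⟨N, p, hp, hN, hfd⟩ := h _ hne
    have : Nontrivial N := hN
    have : Module.Finite k N := hfd
    have : IsNoetherian (FunAlg k C) N := isNoetherian_of_tower k inferInstance
    obtain ⟨K, hK, -⟩ := (eq_top_or_exists_le_coatom (⊥ : Submodule (FunAlg k C) N)).resolve_left
      bot_ne_top
    have hsurj : Function.Surjective (toD (M.proj W ≫ p)) := hp.comp (M.proj_surjective W)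
    refine ⟨K.comap (toD (M.proj W ≫ p)), (Submodule.isCoatom_comap_iff hsurj).mpr hK, ?_⟩
    intro x hx
    have : lin (M.proj W ≫ p) x = 0 := by
      simp [(M.proj_eq_zero W x).mpr hx]
    rw [Submodule.mem_comap, toD_apply, this]
    exact K.zero_mem

/-- Modulo its radical `M` has zero radical, and so have its cyclic subobjects. These are
finite-dimensional, hence Artinian, hence semisimple, and they sum to everything. -/
theorem isSemisimpleModule_quot_jacobson (M : LComod k C) :
    IsSemisimpleModule (FunAlg k C) (M.quot (Module.jacobson (FunAlg k C) M)) := by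
  set J := Module.jacobson (FunAlg k C) M
  set Q := M.quot J
  have hQ : Module.jacobson (FunAlg k C) Q = ⊥ := by
    have h := Module.map_jacobson_of_ker_le (f := toD (M.proj J)) (M.proj_surjective J)
      (M.ker_proj J).le
    rw [← h, ← le_bot_iff, Submodule.map_le_iff_le_comap, Submodule.comap_bot]
    exact (M.ker_proj J).ge
  have hss : ∀ x : Q, IsSemisimpleModule (FunAlg k C) (Q.gen x) := fun x => by
    have : Module.Finite k (Q.gen x) := Q.finDim_gen x
    have : IsArtinian (FunAlg k C) (Q.gen x) := isArtinian_of_tower k inferInstance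
    rw [IsArtinian.isSemisimpleModule_iff_jacobson]
    exact Module.jacobson_eq_bot_of_injective (f := (Q.gen x).subtype)
      (Submodule.injective_subtype _) hQ
  refine isSemisimpleModule_of_isSemisimpleModule_submodule' hss ?_
  rw [eq_top_iff]
  rintro x -
  exact Submodule.mem_iSup_of_mem x (Q.self_mem_gen x)

/-- Decompose `M` modulo its radical into simples, take the direct sum of their finite-dimensional
projective covers, and lift its map onto the quotient to `M`. An infinite direct sum of superfluous
maps need not be superfluous in general; here it is, because every proper subobject lies in a
maximal one. -/
theorem hasProjectiveCover_of_finDim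
    (h : ∀ M : LComod k C, M.NonZero → M.HasFinDimQuotient)
    (hP : ∀ S : LComod k C, S.FinDim → ∃ (T : LComod k C) (p : T ⟶ S), T.FinDim ∧ Projective T ∧
      Function.Surjective (lin p)) (M : LComod k C) : M.HasProjectiveCover := by
  classical
  have hco := isCoatomic_of_hasFinDimQuotient h
  set J := Module.jacobson (FunAlg k C) M
  have hss := M.isSemisimpleModule_quot_jacobson
  set Q := M.quot J
  obtain ⟨s, hind, hsup, hsimple⟩ :=
    IsSemisimpleModule.exists_sSupIndep_sSup_simples_eq_top (FunAlg k C) Q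
  have hfd : ∀ m : s, (Q.sub m.1).FinDim := fun m => by
    have := hsimple m.1 m.2
    have := IsSimpleModule.nontrivial (FunAlg k C) m.1
    obtain ⟨x, hx⟩ := exists_ne (0 : m.1)
    -- A simple subobject is generated by any of its nonzero elements, hence finite-dimensional.
    have hle : Q.gen x ≤ m.1 := by
      rintro _ ⟨f, rfl⟩
      exact (Q.ι_smul f x) ▸ m.1.smul_mem _ x.2
    have heq : Q.gen x = m.1 := ((isSimpleModule_iff_isAtom.mp (hsimple m.1 m.2)).le_iff.mp hle).resolve_left fun h0 => by
      have := Q.self_mem_gen (x : Q)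
      rw [h0] at this
      exact hx (Subtype.ext this)
    exact heq ▸ Q.finDim_gen x
  have hcov : ∀ m : s, ∃ (L : LComod k C) (q : L ⟶ Q.sub m.1), L.FinDim ∧ Projective L ∧
      Function.Surjective (lin q) ∧ Superfluous q := fun m => by
    obtain ⟨T, p, hT, hTP, hp⟩ := hP _ (hfd m)
    exact exists_finDim_cover hT p hp
  choose L q hLfd hLP hLq hLs using hcov
  let P := dsum L
  have hPP : Projective P := projective_dsum hLP
  let ψ : P ⟶ Q := desc fun m => q m ≫ Q.incl m.1
  have hψ : Function.Surjective (lin ψ) := by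
    have : LinearMap.range (toD ψ) = ⊤ := by
      rw [eq_top_iff, ← hsup]
      refine sSup_le fun m hm x hx => ?_
      obtain ⟨y, hy⟩ := hLq ⟨m, hm⟩ ⟨x, hx⟩
      refine ⟨lin (single L ⟨m, hm⟩) y, ?_⟩
      rw [toD_apply, lin_desc_single]
      exact congrArg (lin (Q.incl m)) hy
    exact show Function.Surjective (toD ψ) from LinearMap.range_eq_top.mp this
  -- The chosen simples are independent, so the kernel of `ψ` is the set of elements whose
  -- components lie in the kernels of the `q m`. `Y` applies the `q m` componentwise, and the
  -- summation map after it is injective.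
  have hcomp : ∀ x : P, lin ψ x = 0 → ∀ m, lin (q m) (lin (component L m) x) = 0 := by
    intro x hx
    have hinj := ((sSupIndep_iff s).mp hind).dfinsupp_lsum_injective
    let q' : ∀ m : s, L m →ₗ[k] m.1 := fun m => lin (q m)
    let Y : (Π₀ m, (L m).carrier) →ₗ[k] Π₀ m : s, m.1 :=
      descLin fun m => DFinsupp.lsingle (R := k) (M := fun m : s => m.1) m ∘ₗ q' m
    have hYs : ∀ (m : s) (z : L m), Y (singleLin L m z) =
        DFinsupp.single (β := fun m : s => m.1) m (q' m z) := fun m z => descLin_single _ m z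
    have hY : ∀ x : Π₀ m, (L m).carrier, DFinsupp.lsum ℕ (fun m : s => m.1.subtype) (Y x) =
        lin ψ x := by
      intro x
      induction x using singleLin_induction with
      | zero => rw [map_zero, map_zero]; exact (map_zero (lin ψ)).symm
      | add m z x hx =>
        rw [map_add, map_add, hx, hYs]
        refine Eq.trans ?_ (map_add (lin ψ) (lin (single L m) z) x).symm
        rw [lin_desc_single]
        congr 1
        simp only [DFinsupp.lsum_single]
        rfl
    have hY2 : ∀ (x : P) (m : s), Y (toDFinsupp x) m = q' m (lin (component L m) x) := by
      intro x m
      rw [lin_component]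
      generalize toDFinsupp x = y
      induction y using singleLin_induction with
      | zero => simp
      | add n z y hy =>
        rw [map_add, DFinsupp.add_apply, DFinsupp.add_apply, map_add, hy, hYs, singleLin_apply]
        congr 1
        by_cases hnm : n = m
        · subst hnm; simp
        · rw [DFinsupp.single_eq_of_ne (Ne.symm hnm), DFinsupp.single_eq_of_ne (Ne.symm hnm),
            map_zero]
    have hY0 : Y (toDFinsupp x) = 0 := hinj (by rw [map_zero]; exact (hY x).trans hx)
    intro m
    have := hY2 x m
    rw [hY0] at this
    exact this.symm
  have hψs : Superfluous ψ := by
    intro W hW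
    by_contra hne
    obtain ⟨K, hK, hWK⟩ := ((hco P).eq_top_or_exists_le_coatom W).resolve_left hne
    -- A maximal `K` contains the kernel of each `q m`. Otherwise its trace on `L m` is maximal and
    -- spans `L m` together with that kernel, so it maps onto the simple object, contradicting
    -- superfluousness.
    have hker : ∀ m, ∀ z, lin (q m) z = 0 → lin (single L m) z ∈ K := by
      intro m z hz
      by_contra hzK
      rcases Submodule.isCoatom_comap_or_eq_top (toD (single L m)) hK with hKm | hKm
      · refine hKm.1 (hLs m _ ?_)
        have htop : K.comap (toD (single L m)) ⊔ LinearMap.ker (toD (q m)) = ⊤ := by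
          refine hKm.2 _ (lt_of_le_of_ne le_sup_left fun heq => hzK ?_)
          have : z ∈ K.comap (toD (single L m)) := heq ▸ Submodule.mem_sup_right hz
          exact this
        rw [eq_top_iff]
        rintro y -
        obtain ⟨w, rfl⟩ := hLq m y
        obtain ⟨a, ha, b, hb, rfl⟩ := Submodule.mem_sup.mp (htop.symm ▸ Submodule.mem_top :
          w ∈ K.comap (toD (single L m)) ⊔ LinearMap.ker (toD (q m)))
        refine ⟨a, ha, ?_⟩
        have hb' : lin (q m) b = 0 := hb
        rw [toD_apply, map_add, hb', add_zero]
      · exact hzK (by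
          have : z ∈ K.comap (toD (single L m)) := hKm.symm ▸ Submodule.mem_top
          exact this)
    refine hK.1 ?_
    rw [eq_top_iff]
    rintro x -
    -- Any `x` differs from an element of `W` by an element of the kernel of `ψ`, so `K` is
    -- everything.
    obtain ⟨w, hw, hwx⟩ : toD ψ x ∈ W.map (toD ψ) := hW.symm ▸ Submodule.mem_top
    have h1 : lin ψ (x - w) = 0 := by
      rw [map_sub, sub_eq_zero]; exact hwx.symm
    have h2 : x - w ∈ K := mem_of_component_mem K _ fun m => hker m _ (hcomp _ h1 m)
    simpa using K.add_mem h2 (hWK hw)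
  have : Epi (M.proj J) := epi_of_surjective _ (M.proj_surjective J)
  let t : P ⟶ M := Projective.factorThru ψ (M.proj J)
  have ht : t ≫ M.proj J = ψ := Projective.factorThru_comp _ _
  refine ⟨P, t, hPP, ?_, fun g hg => hψs.epi g ?_⟩
  -- The image of `t` and the radical together span `M`. A maximal subobject containing the image
  -- contains the radical too, which is absurd; so the image is `M`.
  · refine epi_of_surjective t (show Function.Surjective (toD t) from LinearMap.range_eq_top.mp ?_)
    by_contra hne
    obtain ⟨K, hK, hWK⟩ := ((hco M).eq_top_or_exists_le_coatom _).resolve_left hne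
    refine hK.1 ?_
    rw [eq_top_iff]
    rintro x -
    obtain ⟨y, hy⟩ := hψ (lin (M.proj J) x)
    have h1 : x - lin t y ∈ J := by
      rw [← M.proj_eq_zero, map_sub, sub_eq_zero, ← hy, ← ht]; rfl
    have h2 : J ≤ K := sInf_le hK
    simpa using K.add_mem (h2 h1) (hWK ⟨y, rfl⟩)
  · rw [← ht, ← Category.assoc]
    exact epi_comp _ _

end LComod

end

end BraidedCoFrob

namespace BraidedCoFrob
noncomputable section

/-! ### Coactions in terms of the action of functionals -/

section

variable {k C C' V : Type u} [Field k] [AddCommGroup C] [Module k C] [Coalgebra k C]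
  [AddCommGroup C'] [Module k C'] [Coalgebra k C'] [AddCommGroup V] [Module k V]

/-- The convolution product of two functionals. -/
def convMul (f g : Module.Dual k C) : Module.Dual k C :=
  (LinearMap.mul' k k ∘ₗ TensorProduct.map f g) ∘ₗ Coalgebra.comul

theorem contract_contract_assoc (f g : Module.Dual k C) (x : C ⊗[k] V) :
    contract g (contract f (TensorProduct.assoc k C C V (Coalgebra.comul.rTensor V x))) =
      contract (convMul f g) x := by
  induction x with
  | zero => simp
  | add x y hx hy => simp only [map_add, hx, hy]
  | tmul c v =>
    simp only [LinearMap.rTensor_tmul, contract_tmul, convMul, LinearMap.comp_apply]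
    generalize Coalgebra.comul (R := k) c = d
    induction d with
    | zero => simp
    | add x y hx hy => simp only [TensorProduct.add_tmul, map_add, hx, hy, add_smul]
    | tmul a b => simp [mul_smul]

/-- After contraction the axioms say that functionals act through convolution and that the counit
acts as the identity. In this form they are easy to check on a dual space. -/
theorem isCoaction_of_contract {ρ : V →ₗ[k] C ⊗[k] V}
    (hmul : ∀ f g v, contract g (ρ (contract f (ρ v))) = contract (convMul f g) (ρ v))
    (hone : ∀ v, contract Coalgebra.counit (ρ v) = v) : IsCoaction ρ where
  coassoc v := eq_of_contract fun f => eq_of_contract fun g => by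
    rw [contract_contract_assoc, contract_lTensor, hmul]
  counit := hone

/-- A linear map between coalgebras that reverses the comultiplication. -/
structure IsAntiCoalgHom (σ : C →ₗ[k] C') : Prop where
  comul : ∀ c, Coalgebra.comul (R := k) (σ c) =
    TensorProduct.map σ σ (TensorProduct.comm k C C (Coalgebra.comul (R := k) c))
  counit : ∀ c, Coalgebra.counit (R := k) (σ c) = Coalgebra.counit (R := k) c

theorem IsAntiCoalgHom.convMul_comp {σ : C →ₗ[k] C'} (hσ : IsAntiCoalgHom σ)
    (f g : Module.Dual k C') : convMul f g ∘ₗ σ = convMul (g ∘ₗ σ) (f ∘ₗ σ) := by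
  ext c
  simp only [convMul, LinearMap.comp_apply, hσ.comul]
  generalize Coalgebra.comul (R := k) c = d
  induction d with
  | zero => simp
  | add x y hx hy => simp only [map_add, hx, hy]
  | tmul a b => simp [mul_comm]

end

namespace LComod

variable {k C C' : Type u} [Field k] [AddCommGroup C] [Module k C] [Coalgebra k C]
  [AddCommGroup C'] [Module k C'] [Coalgebra k C']

theorem act_act (M : LComod k C) (f g : Module.Dual k C) (m : M) :
    M.act g (M.act f m) = M.act (convMul f g) m := M.coact_act_act f g m

theorem act_counit (M : LComod k C) (m : M) : M.act Coalgebra.counit m = m :=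
  M.isCoaction.contract_counit m

/-- A linear map that commutes with the action of functionals is a morphism. -/
def homOfAct {M N : LComod k C} (g : M →ₗ[k] N) (h : ∀ f m, g (M.act f m) = N.act f (g m)) :
    M ⟶ N :=
  mkHom g fun m => eq_of_contract fun f => by
    rw [contract_lTensor]; exact (h f m).symm

theorem contract_comm_apply {V W : Type u} [AddCommGroup V] [Module k V] [AddCommGroup W]
    [Module k W] (φ : Module.Dual k W) (t : Module.Dual k V ⊗[k] W) (m : V) :
    contract φ (TensorProduct.comm k (Module.Dual k V) W t) m = φ (dualTensorHom k V W t m) := by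
  induction t with
  | zero => simp
  | add x y hx hy => simp only [map_add, LinearMap.add_apply, hx, hy]
  | tmul f c => simp [mul_comm]

/-! #### Duals of finite-dimensional comodules -/

section Dual

variable (M : LComod k C) [Module.Finite k M] (σ : C →ₗ[k] C')

/-- The coaction on the dual space obtained from an anti-morphism of coalgebras. -/
def dualCoact : Module.Dual k M →ₗ[k] C' ⊗[k] Module.Dual k M :=
  (TensorProduct.comm k (Module.Dual k M) C').toLinearMap ∘ₗ
    (dualTensorHomEquiv k M C').symm.toLinearMap ∘ₗ
    (LinearMap.lcomp k C' M.coact) ∘ₗ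
    (LinearMap.llcomp k (C ⊗[k] M) C C' σ) ∘ₗ
    (TensorProduct.rid k C).congrRight.toLinearMap ∘ₗ LinearMap.lTensorHom C

/-- This characterizes the dual coaction: `φ` acts on `M*` as the transpose of `φ ∘ σ`.
Transposition reverses products and so does composition with `σ`, which is why the dual is again a
left comodule. -/
theorem contract_dualCoact (φ : Module.Dual k C') (f : Module.Dual k M) (m : M) :
    contract φ (M.dualCoact σ f) m = f (M.act (φ ∘ₗ σ) m) := by
  have h := contract_comm_apply φ ((dualTensorHomEquiv k M C').symm
    (σ ∘ₗ (TensorProduct.rid k C).toLinearMap ∘ₗ f.lTensor C ∘ₗ M.coact)) m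
  have h2 := (dualTensorHomEquiv k M C').apply_symm_apply
    (σ ∘ₗ (TensorProduct.rid k C).toLinearMap ∘ₗ f.lTensor C ∘ₗ M.coact)
  rw [show dualTensorHom k M C' _ = _ from h2] at h
  refine Eq.trans h ?_
  simp only [LinearMap.comp_apply, act_apply]
  generalize M.coact m = x
  induction x with
  | zero => simp
  | add x y hx hy => simp only [map_add, hx, hy]
  | tmul c v => simp [mul_comm]

/-- The dual of a finite-dimensional comodule, over a second coalgebra. -/
def dual (hσ : IsAntiCoalgHom σ) : LComod k C' where
  carrier := Module.Dual k M
  coact := M.dualCoact σ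
  isCoaction := isCoaction_of_contract
    (fun f g v => LinearMap.ext fun m => by
      rw [contract_dualCoact, contract_dualCoact, contract_dualCoact, act_act, hσ.convMul_comp])
    (fun v => LinearMap.ext fun m => by
      rw [contract_dualCoact]
      have : Coalgebra.counit ∘ₗ σ = Coalgebra.counit := LinearMap.ext hσ.counit
      rw [this, act_counit])

/-- The pairing between the dual and the comodule. -/
def pairing (hσ : IsAntiCoalgHom σ) : M.dual σ hσ →ₗ[k] Module.Dual k M := LinearMap.id

theorem pairing_act (hσ : IsAntiCoalgHom σ) (φ : Module.Dual k C') (f : M.dual σ hσ) (m : M) :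
    M.pairing σ hσ ((M.dual σ hσ).act φ f) m = M.pairing σ hσ f (M.act (φ ∘ₗ σ) m) :=
  M.contract_dualCoact σ φ f m

theorem finDim_dual (hσ : IsAntiCoalgHom σ) : (M.dual σ hσ).FinDim :=
  inferInstanceAs (Module.Finite k (Module.Dual k M))

theorem nonZero_dual (hσ : IsAntiCoalgHom σ) (h : M.NonZero) : (M.dual σ hσ).NonZero :=
  have : Nontrivial M := h
  inferInstanceAs (Nontrivial (Module.Dual k M))

end Dual

/-- The linear dual of a finite-dimensional injective comodule over `C` is projective over the
co-opposite coalgebra. -/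
theorem projective_dual (E : LComod k C) [Module.Finite k E] [Injective E]
    (σ : C →ₗ[k] C') (hσ : IsAntiCoalgHom σ) (τ : C' →ₗ[k] C) (hτ : IsAntiCoalgHom τ)
    (hτσ : τ ∘ₗ σ = LinearMap.id) (hστ : σ ∘ₗ τ = LinearMap.id) :
    Projective (E.dual σ hσ) := by
  refine projective_of_split (E.finDim_dual σ hσ) fun Y p hY hp => ?_
  have : Module.Finite k Y := hY
  -- The transpose of `p` embeds `E` in `Y*`; it is colinear because `τ ∘ σ = id`. A retraction `r`
  -- exists as `E` is injective, and the transpose of `r`, read through `Y = Y**`, is the required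
  -- section.
  let i : E ⟶ Y.dual τ hτ := homOfAct (N := Y.dual τ hτ)
    ((E.pairing σ hσ ∘ₗ lin p).flip) fun f e => LinearMap.ext fun y => by
      have h1 := Y.pairing_act τ hτ f ((E.pairing σ hσ ∘ₗ lin p).flip e) y
      refine Eq.trans ?_ h1.symm
      change _ = E.pairing σ hσ (lin p _) e
      rw [act_lin, pairing_act, LinearMap.comp_assoc, hτσ, LinearMap.comp_id]
      rfl
  have hi : Mono i := mono_of_injective _ <| by
    rw [injective_iff_map_eq_zero]
    intro e he
    rw [← Module.forall_dual_apply_eq_zero_iff k]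
    intro f
    obtain ⟨y, rfl⟩ := hp f
    exact LinearMap.congr_fun he y
  let r : Y.dual τ hτ ⟶ E := Injective.factorThru (𝟙 E) i
  have hr : ∀ e, lin r (lin i e) = e := fun e =>
    LinearMap.congr_fun (congrArg lin (Injective.comp_factorThru (𝟙 E) i)) e
  let r' : Module.Dual k Y →ₗ[k] E := lin r
  let s' : Module.Dual k E →ₗ[k] Y := (Module.evalEquiv k Y).symm.toLinearMap ∘ₗ
    Module.Dual.transpose r'
  have hs' : ∀ (f : Module.Dual k E) (g : Module.Dual k Y), g (s' f) = f (r' g) := fun f g => by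
    have := (Module.evalEquiv k Y).apply_symm_apply (Module.Dual.transpose r' f)
    exact LinearMap.congr_fun this g
  refine ⟨homOfAct (M := E.dual σ hσ) s' fun f m => ?_, hom_ext' fun f => ?_⟩
  · apply (Module.evalEquiv k Y).injective
    ext g
    change g (s' _) = g (Y.act f (s' m))
    have h1 := Y.pairing_act τ hτ (f ∘ₗ σ) g (s' m)
    rw [LinearMap.comp_assoc, hστ, LinearMap.comp_id] at h1
    refine Eq.trans ?_ h1
    refine (hs' _ _).trans ?_
    refine Eq.trans ?_ (hs' m ((Y.dual τ hτ).act (f ∘ₗ σ) g)).symm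
    refine Eq.trans (E.pairing_act σ hσ f m (r' g)) ?_
    exact congrArg (E.pairing σ hσ m) (act_lin r (f ∘ₗ σ) g).symm
  · refine LinearMap.ext fun e => ?_
    refine (hs' f (lin i e)).trans ?_
    exact congrArg (E.pairing σ hσ f) (hr e)

end LComod

end

end BraidedCoFrob

namespace BraidedCoFrob
noncomputable section
open scoped RingTheory.LinearMap
open Coalgebra HopfAlgebra WithConv

variable {k A : Type u} [Field k] [Ring A] [HopfAlgebra k A]

/-- Regroups the fourfold coproduct so that the two middle legs come from one comultiplication and
the antipode can cancel them first. -/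
theorem assoc_map_comul_comul (a : A) :
    TensorProduct.assoc k A A (A ⊗[k] A) (TensorProduct.map comul comul (comul (R := k) a)) =
    ((TensorProduct.assoc k A A A).toLinearMap ∘ₗ comul.rTensor A ∘ₗ comul).lTensor A
      (comul (R := k) a) := by
  rw [Coalgebra.coassoc, LinearMap.lTensor_comp_apply, ← Coalgebra.coassoc_apply]
  generalize comul (R := k) a = x
  induction x with
  | zero => simp
  | add x y hx hy => simp only [map_add, hx, hy]
  | tmul x y =>
    simp only [TensorProduct.map_tmul, LinearMap.rTensor_tmul]
    generalize comul (R := k) x = x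
    induction x with
    | zero => simp
    | add x y hx hy => simp only [TensorProduct.add_tmul, map_add, hx, hy]
    | tmul p q => simp

/-- The map `p ⊗ (q ⊗ (r ⊗ s)) ↦ S(q) r ⊗ S(p) s`. -/
def antipodeQuad : A ⊗[k] (A ⊗[k] (A ⊗[k] A)) →ₗ[k] A ⊗[k] A :=
  LinearMap.mul' k (A ⊗[k] A) ∘ₗ
    (TensorProduct.map (antipode k) (antipode k) ∘ₗ
      (TensorProduct.comm k A A).toLinearMap).rTensor _ ∘ₗ
    (TensorProduct.assoc k A A (A ⊗[k] A)).symm.toLinearMap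

theorem antipodeQuad_tmul (p q r s : A) : antipodeQuad (k := k) (p ⊗ₜ (q ⊗ₜ (r ⊗ₜ s))) =
    (antipode k q * r) ⊗ₜ (antipode k p * s) := by
  simp [antipodeQuad]

/-- Both `Δ ∘ S` and `(S ⊗ S) ∘ flip ∘ Δ` are convolution inverses of `Δ` in the linear maps `A → A
⊗ A`. For the second, `S(a₂) a₃ ⊗ S(a₁) a₄` collapses from the inside. -/
theorem isAntiCoalgHom_antipode : IsAntiCoalgHom (antipode k (A := A)) where
  counit := counit_antipode
  comul := by
    have h : toConv (comul ∘ₗ antipode k (A := A)) = toConv (TensorProduct.map (antipode k) (antipode k) ∘ₗ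
        (TensorProduct.comm k A A).toLinearMap ∘ₗ comul) := by
      symm
      apply left_inv_eq_right_inv (a := toConv (comul (R := k) (A := A))) _ LinearMap.comul_right_inv
      apply WithConv.ext
      ext a
      simp only [LinearMap.convMul_def, LinearMap.convOne_def, ofConv_toConv]
      have h1 : ∀ x : A ⊗[k] A, LinearMap.mul' k (A ⊗[k] A) (TensorProduct.map
          (TensorProduct.map (antipode k) (antipode k) ∘ₗ
          (TensorProduct.comm k A A).toLinearMap ∘ₗ comul) comul x) =
          antipodeQuad (TensorProduct.assoc k A A (A ⊗[k] A) (TensorProduct.map comul comul x)) := by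
        intro x
        induction x with
        | zero => simp
        | add x y hx hy => simp only [map_add, hx, hy]
        | tmul x y => simp [antipodeQuad]
      have h2 : ∀ y : A ⊗[k] A, ∀ p : A, antipodeQuad (k := k) (p ⊗ₜ (TensorProduct.assoc k A A A
          (comul.rTensor A y))) = 1 ⊗ₜ (antipode k p * contract counit y) := by
        intro y p
        induction y with
        | zero => simp
        | add x y hx hy => simp only [map_add, mul_add, TensorProduct.tmul_add, hx, hy]
        | tmul x y =>
          have h3 : ∀ d : A ⊗[k] A, antipodeQuad (k := k) (p ⊗ₜ (TensorProduct.assoc k A A A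
              (d ⊗ₜ y))) = LinearMap.mul' k A ((antipode k).rTensor A d) ⊗ₜ (antipode k p * y) := by
            intro d
            induction d with
            | zero => simp
            | add x y hx hy => simp only [map_add, TensorProduct.add_tmul, TensorProduct.tmul_add, hx, hy]
            | tmul a b => simp [antipodeQuad_tmul]
          rw [LinearMap.rTensor_tmul, h3, mul_antipode_rTensor_comul_apply, contract_tmul,
            Algebra.algebraMap_eq_smul_one, TensorProduct.smul_tmul, mul_smul_comm]
      have h4 : ∀ x : A ⊗[k] A, antipodeQuad (((TensorProduct.assoc k A A A).toLinearMap ∘ₗ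
          comul.rTensor A ∘ₗ comul).lTensor A x) =
          1 ⊗ₜ LinearMap.mul' k A ((antipode k).rTensor A x) := by
        intro x
        induction x with
        | zero => simp
        | add x y hx hy => simp only [map_add, TensorProduct.tmul_add, hx, hy]
        | tmul x y =>
          simp only [LinearMap.lTensor_tmul, LinearMap.comp_apply, LinearEquiv.coe_coe]
          rw [h2, contract, LinearMap.comp_apply, rTensor_counit_comul]
          simp
      simp only [LinearMap.comp_apply]
      rw [h1, assoc_map_comul_comul, h4, mul_antipode_rTensor_comul_apply]
      simp [Algebra.algebraMap_eq_smul_one, Algebra.TensorProduct.one_def]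
    exact fun c => LinearMap.congr_fun (congrArg ofConv h) c

/-! ### Tensor products of comodules -/

section Tensor

variable (V W V' W' : Type u) [AddCommGroup V] [Module k V] [AddCommGroup W] [Module k W]
  [AddCommGroup V'] [Module k V'] [AddCommGroup W'] [Module k W']

variable (k A) in
/-- The map `(a ⊗ v) ⊗ (b ⊗ w) ↦ a b ⊗ (v ⊗ w)`. -/
def mulTensor : (A ⊗[k] V) ⊗[k] (A ⊗[k] W) →ₗ[k] A ⊗[k] (V ⊗[k] W) :=
  (LinearMap.mul' k A).rTensor (V ⊗[k] W) ∘ₗ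
    (TensorProduct.tensorTensorTensorComm k A V A W).toLinearMap

variable {V W V' W'}

theorem mulTensor_tmul (a b : A) (v : V) (w : W) :
    mulTensor k A V W ((a ⊗ₜ v) ⊗ₜ (b ⊗ₜ w)) = (a * b) ⊗ₜ (v ⊗ₜ w) := by
  simp [mulTensor]

theorem tensorCoact_eq (ρ : V →ₗ[k] A ⊗[k] V) (σ : W →ₗ[k] A ⊗[k] W) (v : V) (w : W) :
    tensorCoact ρ σ (v ⊗ₜ w) = mulTensor k A V W (ρ v ⊗ₜ σ w) := rfl

theorem mulTensor_lTensor (f : V →ₗ[k] V') (g : W →ₗ[k] W') (x : A ⊗[k] V) (y : A ⊗[k] W) :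
    mulTensor k A V' W' (f.lTensor A x ⊗ₜ g.lTensor A y) =
      (TensorProduct.map f g).lTensor A (mulTensor k A V W (x ⊗ₜ y)) := by
  induction x with
  | zero => simp
  | add x x' hx hx' => simp only [map_add, TensorProduct.add_tmul, hx, hx']
  | tmul a v =>
    induction y with
    | zero => simp
    | add y y' hy hy' => simp only [map_add, TensorProduct.tmul_add, hy, hy']
    | tmul b w => simp [mulTensor_tmul]

theorem assoc_comul_mulTensor (x : A ⊗[k] V) (y : A ⊗[k] W) :
    TensorProduct.assoc k A A _ (comul.rTensor _ (mulTensor k A V W (x ⊗ₜ y))) =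
      (mulTensor k A V W).lTensor A (mulTensor k A _ _
        (TensorProduct.assoc k A A V (comul.rTensor V x) ⊗ₜ
          TensorProduct.assoc k A A W (comul.rTensor W y))) := by
  induction x with
  | zero => simp
  | add x x' hx hx' => simp only [map_add, TensorProduct.add_tmul, hx, hx']
  | tmul a v =>
    induction y with
    | zero => simp
    | add y y' hy hy' => simp only [map_add, TensorProduct.tmul_add, hy, hy']
    | tmul b w =>
      simp only [mulTensor_tmul, LinearMap.rTensor_tmul, Bialgebra.comul_mul]
      generalize comul (R := k) a = d
      generalize comul (R := k) b = e
      induction d with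
      | zero => simp
      | add x x' hx hx' => simp only [map_add, TensorProduct.add_tmul, add_mul, hx, hx']
      | tmul a a' =>
        induction e with
        | zero => simp
        | add x x' hx hx' =>
          simp only [map_add, TensorProduct.add_tmul, TensorProduct.tmul_add, mul_add, hx, hx']
        | tmul b b' => simp [mulTensor_tmul]

/-- Both axioms come from multiplicativity of `Δ` and of `ε` on `A`. -/
theorem IsCoaction.tensor {ρ : V →ₗ[k] A ⊗[k] V} {σ : W →ₗ[k] A ⊗[k] W}
    (hρ : IsCoaction ρ) (hσ : IsCoaction σ) : IsCoaction (tensorCoact ρ σ) where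
  coassoc x := by
    induction x with
    | zero => simp
    | add x y hx hy => simp only [map_add, hx, hy]
    | tmul v w =>
      rw [tensorCoact_eq, assoc_comul_mulTensor, hρ.coassoc, hσ.coassoc, mulTensor_lTensor,
        ← LinearMap.lTensor_comp_apply]
      rfl
  counit x := by
    induction x with
    | zero => simp
    | add x y hx hy => simp only [map_add, hx, hy]
    | tmul v w =>
      have key : ∀ (x : A ⊗[k] V) (y : A ⊗[k] W), contract Coalgebra.counit (mulTensor k A V W (x ⊗ₜ y)) =
          contract Coalgebra.counit x ⊗ₜ contract Coalgebra.counit y := by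
        intro x y
        induction x with
        | zero => simp
        | add x x' hx hx' => simp only [map_add, TensorProduct.add_tmul, hx, hx']
        | tmul a v =>
          induction y with
          | zero => simp
          | add y y' hy hy' => simp only [map_add, TensorProduct.tmul_add, hy, hy']
          | tmul b w =>
            rw [mulTensor_tmul, contract_tmul, contract_tmul, contract_tmul, Bialgebra.counit_mul,
              TensorProduct.smul_tmul_smul]
      change contract Coalgebra.counit _ = _
      rw [tensorCoact_eq, key, hρ.contract_counit, hσ.contract_counit]

end Tensor

namespace LComod

/-- The tensor product of comodules. -/
def tensorObj (M N : LComod k A) : LComod k A where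
  carrier := M ⊗[k] N
  coact := tensorCoact M.coact N.coact
  isCoaction := M.isCoaction.tensor N.isCoaction

variable (k A) in
/-- The trivial comodule `k`. -/
def unit : LComod k A where
  carrier := k
  coact := TensorProduct.mk k A k 1
  isCoaction := ⟨fun m => by simp [Algebra.TensorProduct.one_def], fun m => by simp⟩

theorem map_colinear {M M' N N' : LComod k A} (f : M ⟶ M') (g : N ⟶ N') (x : M ⊗[k] N) :
    tensorCoact M'.coact N'.coact (TensorProduct.map (lin f) (lin g) x) =
      (TensorProduct.map (lin f) (lin g)).lTensor A (tensorCoact M.coact N.coact x) := by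
  refine TensorProduct.induction_on x (by simp) (fun m n => ?_)
    (fun x y hx hy => by simp only [map_add, hx, hy])
  rw [TensorProduct.map_tmul, tensorCoact_eq, tensorCoact_eq, lin_colinear, lin_colinear,
    mulTensor_lTensor]

/-- The tensor product of morphisms. -/
def tensorHom {M M' N N' : LComod k A} (f : M ⟶ M') (g : N ⟶ N') :
    tensorObj M N ⟶ tensorObj M' N' :=
  mkHom (M := tensorObj M N) (N := tensorObj M' N') (TensorProduct.map (lin f) (lin g))
    (map_colinear f g)

theorem assoc_colinear (M N P : LComod k A) (x : (M ⊗[k] N) ⊗[k] P) :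
    tensorCoact M.coact (tensorCoact N.coact P.coact) (TensorProduct.assoc k M N P x) =
      (TensorProduct.assoc k M N P).toLinearMap.lTensor A
        (tensorCoact (tensorCoact M.coact N.coact) P.coact x) := by
  refine TensorProduct.induction_on x (by simp) (fun y p => ?_)
    (fun x y hx hy => by simp only [map_add, hx, hy])
  refine TensorProduct.induction_on y (by simp) (fun m n => ?_)
    (fun x y hx hy => by simp only [map_add, TensorProduct.add_tmul, hx, hy])
  rw [TensorProduct.assoc_tmul, tensorCoact_eq, tensorCoact_eq, tensorCoact_eq, tensorCoact_eq]
  generalize M.coact m = x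
  generalize N.coact n = y
  generalize P.coact p = z
  induction x with
  | zero => simp
  | add x x' hx hx' => simp only [map_add, TensorProduct.add_tmul, hx, hx']
  | tmul a v =>
    induction y with
    | zero => simp
    | add y y' hy hy' => simp only [map_add, TensorProduct.tmul_add, TensorProduct.add_tmul, hy, hy']
    | tmul b w =>
      induction z with
      | zero => simp
      | add y y' hy hy' => simp only [map_add, TensorProduct.tmul_add, hy, hy']
      | tmul c u => simp [mulTensor_tmul, mul_assoc]

theorem lid_colinear (M : LComod k A) (x : k ⊗[k] M) :
    M.coact (TensorProduct.lid k M x) = (TensorProduct.lid k M).toLinearMap.lTensor A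
        (tensorCoact (TensorProduct.mk k A k 1) M.coact x) := by
  refine TensorProduct.induction_on x (by simp) (fun c m => ?_)
    (fun x y hx hy => by simp only [map_add, hx, hy])
  rw [TensorProduct.lid_tmul, map_smul]
  change _ = (TensorProduct.lid k M).toLinearMap.lTensor A
    (mulTensor k A k M (((1 : A) ⊗ₜ[k] c) ⊗ₜ M.coact m))
  generalize M.coact m = x
  induction x with
  | zero => simp
  | add x x' hx hx' => simp only [map_add, smul_add, TensorProduct.tmul_add, hx, hx']
  | tmul a v => simp [mulTensor_tmul]

theorem rid_colinear (M : LComod k A) (x : M ⊗[k] k) :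
    M.coact (TensorProduct.rid k M x) = (TensorProduct.rid k M).toLinearMap.lTensor A
        (tensorCoact M.coact (TensorProduct.mk k A k 1) x) := by
  refine TensorProduct.induction_on x (by simp) (fun m c => ?_)
    (fun x y hx hy => by simp only [map_add, hx, hy])
  rw [TensorProduct.rid_tmul, map_smul]
  change _ = (TensorProduct.rid k M).toLinearMap.lTensor A
    (mulTensor k A M k (M.coact m ⊗ₜ ((1 : A) ⊗ₜ[k] c)))
  generalize M.coact m = x
  induction x with
  | zero => simp
  | add x x' hx hx' => simp only [map_add, smul_add, TensorProduct.add_tmul, hx, hx']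
  | tmul a v => simp [mulTensor_tmul]

instance : MonoidalCategoryStruct (LComod k A) where
  tensorObj := tensorObj
  tensorUnit := unit k A
  tensorHom := tensorHom
  whiskerLeft M _ _ f := tensorHom (𝟙 M) f
  whiskerRight f N := tensorHom f (𝟙 N)
  associator M N P := isoOfEquiv (M := tensorObj (tensorObj M N) P)
    (N := tensorObj M (tensorObj N P)) (TensorProduct.assoc k M N P) (assoc_colinear M N P)
  leftUnitor M := isoOfEquiv (M := tensorObj (unit k A) M) (TensorProduct.lid k M) (lid_colinear M)
  rightUnitor M := isoOfEquiv (M := tensorObj M (unit k A)) (TensorProduct.rid k M) (rid_colinear M)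

theorem tensor_ext {M N P : LComod k A} {f g : tensorObj M N ⟶ P}
    (h : ∀ (m : M) (n : N), lin f (m ⊗ₜ[k] n : M ⊗[k] N) = lin g (m ⊗ₜ[k] n : M ⊗[k] N)) :
    f = g :=
  hom_ext (TensorProduct.ext' h)

instance : MonoidalCategory (LComod k A) := MonoidalCategory.ofTensorHom
  (id_tensorHom_id := fun _ _ => tensor_ext fun _ _ => rfl)
  (id_tensorHom := fun _ _ _ _ => rfl)
  (tensorHom_id := fun _ _ => rfl)
  (tensorHom_comp_tensorHom := fun _ _ _ _ => tensor_ext fun _ _ => rfl)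
  (associator_naturality := fun _ _ _ => hom_ext (TensorProduct.ext_threefold fun _ _ _ => rfl))
  (leftUnitor_naturality := fun f => tensor_ext (M := unit k A) fun (c : k) m =>
    (map_smul (lin f) c m).symm)
  (rightUnitor_naturality := fun f => tensor_ext (N := unit k A) fun m (c : k) =>
    (map_smul (lin f) c m).symm)
  (pentagon := fun _ _ _ _ => hom_ext (TensorProduct.ext_fourfold fun _ _ _ _ => rfl))
  (triangle := fun M N => hom_ext (TensorProduct.ext_threefold fun (m : M) (c : k) (n : N) =>
    (TensorProduct.smul_tmul c m n).symm))

end LComod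

end

end BraidedCoFrob

namespace BraidedCoFrob
noncomputable section
open MonoidalCategory HopfAlgebra

variable {k A : Type u} [Field k] [Ring A] [HopfAlgebra k A]

namespace LComod

/-! #### Exactness of the tensor product -/

section Whisker

variable {M N : LComod k A} (P : LComod k A) (f : M ⟶ N)

theorem lin_whiskerLeft : lin (P ◁ f) = (lin f).lTensor P := rfl

theorem lin_whiskerRight : lin (f ▷ P) = (lin f).rTensor P := rfl

theorem whiskerLeft_injective (h : Function.Injective (lin f)) :
    Function.Injective (lin (P ◁ f)) :=
  Module.Flat.lTensor_preserves_injective_linearMap (M := P) (lin f) h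

theorem whiskerRight_injective (h : Function.Injective (lin f)) :
    Function.Injective (lin (f ▷ P)) :=
  Module.Flat.rTensor_preserves_injective_linearMap (M := P) (lin f) h

theorem whiskerLeft_surjective (h : Function.Surjective (lin f)) :
    Function.Surjective (lin (P ◁ f)) :=
  LinearMap.lTensor_surjective P h

theorem whiskerRight_surjective (h : Function.Surjective (lin f)) :
    Function.Surjective (lin (f ▷ P)) :=
  LinearMap.rTensor_surjective P h

instance : (tensorLeft P).PreservesMonomorphisms where
  preserves f _ := mono_of_injective _ (whiskerLeft_injective P f ((mono_iff f).mp inferInstance))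

instance : (tensorLeft P).PreservesEpimorphisms where
  preserves f _ := epi_of_surjective _ (whiskerLeft_surjective P f ((epi_iff f).mp inferInstance))

instance : (tensorRight P).PreservesEpimorphisms where
  preserves f _ := epi_of_surjective _ (whiskerRight_surjective P f ((epi_iff f).mp inferInstance))

end Whisker

/-! #### Evaluation and coevaluation -/

section Pairing

variable (M : LComod k A) [Module.Finite k M]

/-- The dual of a finite-dimensional comodule. -/
abbrev star : LComod k A := M.dual (antipode k) isAntiCoalgHom_antipode

variable {V : Type u} [AddCommGroup V] [Module k V]

/-- The map `a ⊗ f ↦ f(v) a`. -/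
def evalAt (v : V) : A ⊗[k] Module.Dual k V →ₗ[k] A :=
  (TensorProduct.rid k A).toLinearMap ∘ₗ (Module.Dual.eval k V v).lTensor A

@[simp] theorem evalAt_tmul (v : V) (a : A) (f : Module.Dual k V) :
    evalAt v (a ⊗ₜ[k] f) = f v • a := by simp [evalAt]

theorem apply_evalAt (v : V) (φ : Module.Dual k A) (x : A ⊗[k] Module.Dual k V) :
    φ (evalAt v x) = contract φ x v := by
  induction x with
  | zero => simp
  | add x y hx hy => simp only [map_add, LinearMap.add_apply, hx, hy]
  | tmul a f => simp [mul_comm]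

theorem evalAt_dualCoact (m : M) (f : Module.Dual k M) :
    evalAt m (M.dualCoact (antipode k) f) =
      antipode k (TensorProduct.rid k A (f.lTensor A (M.coact m))) := by
  rw [← sub_eq_zero, ← Module.forall_dual_apply_eq_zero_iff k]
  intro φ
  rw [map_sub, sub_eq_zero, apply_evalAt, contract_dualCoact, act_apply]
  generalize M.coact m = x
  induction x with
  | zero => simp
  | add x y hx hy => simp only [map_add, hx, hy]
  | tmul c v => simp [mul_comm]

/-- The map `a ⊗ (b ⊗ v) ↦ a S(b) ⊗ v`. -/
def mulAntipodeRight (V : Type u) [AddCommGroup V] [Module k V] :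
    A ⊗[k] (A ⊗[k] V) →ₗ[k] A ⊗[k] V :=
  (LinearMap.mul' k A ∘ₗ (antipode k).lTensor A).rTensor V ∘ₗ
    (TensorProduct.assoc k A A V).symm.toLinearMap

/-- The map `a ⊗ (b ⊗ v) ↦ S(a) b ⊗ v`. -/
def mulAntipodeLeft (V : Type u) [AddCommGroup V] [Module k V] :
    A ⊗[k] (A ⊗[k] V) →ₗ[k] A ⊗[k] V :=
  (LinearMap.mul' k A ∘ₗ (antipode k).rTensor A).rTensor V ∘ₗ
    (TensorProduct.assoc k A A V).symm.toLinearMap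

@[simp] theorem mulAntipodeRight_tmul (a b : A) (v : V) :
    mulAntipodeRight (k := k) V (a ⊗ₜ (b ⊗ₜ v)) = (a * antipode k b) ⊗ₜ v := by
  simp [mulAntipodeRight]

@[simp] theorem mulAntipodeLeft_tmul (a b : A) (v : V) :
    mulAntipodeLeft (k := k) V (a ⊗ₜ (b ⊗ₜ v)) = (antipode k a * b) ⊗ₜ v := by
  simp [mulAntipodeLeft]

theorem mulAntipodeRight_comul (x : A ⊗[k] V) :
    mulAntipodeRight V (TensorProduct.assoc k A A V (Coalgebra.comul.rTensor V x)) =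
      1 ⊗ₜ contract Coalgebra.counit x := by
  induction x with
  | zero => simp
  | add x y hx hy => simp only [map_add, TensorProduct.tmul_add, hx, hy]
  | tmul c v =>
    simp [mulAntipodeRight, Algebra.algebraMap_eq_smul_one, TensorProduct.smul_tmul]

theorem mulAntipodeLeft_comul (x : A ⊗[k] V) :
    mulAntipodeLeft V (TensorProduct.assoc k A A V (Coalgebra.comul.rTensor V x)) =
      1 ⊗ₜ contract Coalgebra.counit x := by
  induction x with
  | zero => simp
  | add x y hx hy => simp only [map_add, TensorProduct.tmul_add, hx, hy]
  | tmul c v =>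
    simp [mulAntipodeLeft, Algebra.algebraMap_eq_smul_one, TensorProduct.smul_tmul]

theorem mulAntipodeRight_coact (M : LComod k A) (m : M) :
    mulAntipodeRight M (M.coact.lTensor A (M.coact m)) = 1 ⊗ₜ m := by
  rw [← M.isCoaction.coassoc, mulAntipodeRight_comul, M.isCoaction.contract_counit]

theorem mulAntipodeLeft_coact (M : LComod k A) (m : M) :
    mulAntipodeLeft M (M.coact.lTensor A (M.coact m)) = 1 ⊗ₜ m := by
  rw [← M.isCoaction.coassoc, mulAntipodeLeft_comul, M.isCoaction.contract_counit]

/-- The evaluation `v ⊗ f ↦ f(v)`. -/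
def evalLin (V : Type u) [AddCommGroup V] [Module k V] : V ⊗[k] Module.Dual k V →ₗ[k] k :=
  TensorProduct.lift (Module.Dual.eval k V)

/-- The codiagonal coaction paired with evaluation gives `m₍₋₂₎ S(m₍₋₁₎) f(m₍₀₎)`, where the
antipode cancels. For the order `M ⊗ M*` no inverse of the antipode is needed. -/
theorem evalLin_colinear (x : M ⊗[k] Module.Dual k M) :
    (1 : A) ⊗ₜ[k] evalLin M x =
      (evalLin M).lTensor A (tensorCoact M.coact (M.dualCoact (antipode k)) x) := by
  refine TensorProduct.induction_on x (by simp) (fun m f => ?_)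
    (fun x y hx hy => by simp only [map_add, TensorProduct.tmul_add, hx, hy])
  apply (TensorProduct.rid k A).injective
  have key : ∀ y : A ⊗[k] M, TensorProduct.rid k A ((evalLin M).lTensor A (mulTensor k A _ _
      (y ⊗ₜ M.dualCoact (antipode k) f))) = TensorProduct.rid k A (f.lTensor A
        (mulAntipodeRight M (M.coact.lTensor A y))) := by
    intro y
    induction y with
    | zero => simp
    | add x y hx hy => simp only [map_add, TensorProduct.add_tmul, hx, hy]
    | tmul a n =>
      have h1 : ∀ z : A ⊗[k] Module.Dual k M, TensorProduct.rid k A ((evalLin M).lTensor A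
          (mulTensor k A _ _ ((a ⊗ₜ n) ⊗ₜ z))) = a * evalAt n z := by
        intro z
        induction z with
        | zero => simp
        | add x y hx hy => simp only [map_add, TensorProduct.tmul_add, mul_add, hx, hy]
        | tmul b g => simp [mulTensor_tmul, evalLin]
      rw [h1, evalAt_dualCoact, LinearMap.lTensor_tmul]
      generalize M.coact n = z
      induction z with
      | zero => simp
      | add x y hx hy => simp only [map_add, TensorProduct.tmul_add, mul_add, hx, hy]
      | tmul b g => simp
  rw [tensorCoact_eq, key, mulAntipodeRight_coact]
  simp [evalLin]

/-- The canonical element of `V* ⊗ V`. -/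
def canonElt (V : Type u) [AddCommGroup V] [Module k V] [Module.Finite k V] :
    Module.Dual k V ⊗[k] V := (dualTensorHomEquiv k V V).symm LinearMap.id

theorem dualTensorHom_canonElt (v : V) [Module.Finite k V] :
    dualTensorHom k V V (canonElt V) v = v :=
  LinearMap.congr_fun ((dualTensorHomEquiv k V V).apply_symm_apply LinearMap.id) v

theorem lTensor_apply_mulTensor (v : V) (z : A ⊗[k] Module.Dual k V) (y : A ⊗[k] V) :
    ((LinearMap.applyₗ v) ∘ₗ dualTensorHom k V V).lTensor A (mulTensor k A _ _ (z ⊗ₜ y)) =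
      (LinearMap.mul k A (evalAt v z)).rTensor V y := by
  induction z with
  | zero => simp
  | add x y hx hy => simp only [map_add, TensorProduct.add_tmul, LinearMap.rTensor_add,
      LinearMap.add_apply, hx, hy]
  | tmul b g =>
    induction y with
    | zero => simp
    | add x y hx hy => simp only [map_add, TensorProduct.tmul_add, hx, hy]
    | tmul c n => simp [mulTensor_tmul]

theorem lTensor_apply_tensorCoact (x : Module.Dual k M ⊗[k] M) (m : M) :
    ((LinearMap.applyₗ m) ∘ₗ dualTensorHom k M M).lTensor A
      (tensorCoact (M.dualCoact (antipode k)) M.coact x) =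
    mulAntipodeLeft M ((M.coact ∘ₗ dualTensorHom k M M x).lTensor A (M.coact m)) := by
  refine TensorProduct.induction_on x (by simp) (fun f n => ?_)
    (fun x y hx hy => by
      simp only [map_add, LinearMap.comp_add, LinearMap.lTensor_add, LinearMap.add_apply, hx, hy])
  rw [tensorCoact_eq, lTensor_apply_mulTensor, evalAt_dualCoact]
  generalize M.coact m = z
  induction z with
  | zero => simp
  | add x y hx hy => simp only [map_add, LinearMap.rTensor_add, LinearMap.add_apply, hx, hy]
  | tmul b p =>
    simp only [LinearMap.lTensor_tmul, LinearMap.comp_apply, dualTensorHom_apply, map_smul,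
      TensorProduct.rid_tmul, TensorProduct.tmul_smul, LinearMap.rTensor_smul,
      LinearMap.smul_apply]
    congr 1
    generalize M.coact n = y
    induction y with
    | zero => simp
    | add x y hx hy => simp only [map_add, TensorProduct.tmul_add, hx, hy]
    | tmul c n => simp

/-- For finite-dimensional `V` the space `V* ⊗ V` consists of the endomorphisms of `V`, so it
suffices to evaluate at every vector. -/
theorem eq_one_tmul_canonElt [Module.Finite k V] {x : A ⊗[k] (Module.Dual k V ⊗[k] V)}
    (h : ∀ v, ((LinearMap.applyₗ v) ∘ₗ dualTensorHom k V V).lTensor A x = 1 ⊗ₜ v) :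
    x = 1 ⊗ₜ canonElt V := by
  refine eq_of_contract (k := k) (C := A) (V := Module.Dual k V ⊗[k] V) fun φ => ?_
  have hinj : Function.Injective (dualTensorHom k V V) := (dualTensorHomEquiv k V V).injective
  apply hinj
  refine LinearMap.ext fun v => ?_
  have h1 : dualTensorHom k V V (contract φ x) v = φ 1 • v := by
    have := contract_lTensor (V := Module.Dual k V ⊗[k] V) φ
      ((LinearMap.applyₗ v) ∘ₗ dualTensorHom k V V) x
    exact this.symm.trans ((congrArg (contract φ) (h v)).trans (contract_tmul φ 1 v))
  rw [h1]
  have h2 := contract_tmul (V := Module.Dual k V ⊗[k] V) φ 1 (canonElt V)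
  rw [h2, map_smul, LinearMap.smul_apply, dualTensorHom_canonElt]

/-- Evaluated at `m`, the coaction of the canonical element becomes `S(m₍₋₂₎) m₍₋₁₎ ⊗ m₍₀₎ = 1 ⊗ m`;
hence coevaluation is colinear. -/
theorem tensorCoact_canonElt :
    tensorCoact (M.dualCoact (antipode k)) M.coact (canonElt M) = 1 ⊗ₜ canonElt M := by
  refine eq_one_tmul_canonElt fun m => ?_
  have h2 : M.coact ∘ₗ dualTensorHom k M M (canonElt M) = M.coact :=
    LinearMap.ext fun m => by rw [LinearMap.comp_apply, dualTensorHom_canonElt]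
  rw [lTensor_apply_tensorCoact, h2, mulAntipodeLeft_coact]

/-- The evaluation morphism. -/
def ev : M ⊗ M.star ⟶ 𝟙_ (LComod k A) :=
  mkHom (M := tensorObj M M.star) (N := unit k A) (evalLin M) (evalLin_colinear M)

theorem coev_colinear (c : k) :
    tensorCoact (M.dualCoact (antipode k)) M.coact (LinearMap.toSpanSingleton k _ (canonElt M) c) =
      (LinearMap.toSpanSingleton k _ (canonElt M)).lTensor A ((1 : A) ⊗ₜ[k] c) := by
  simp [tensorCoact_canonElt]

/-- The coevaluation morphism. -/
def coev : 𝟙_ (LComod k A) ⟶ M.star ⊗ M :=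
  mkHom (M := unit k A) (N := tensorObj M.star M) (LinearMap.toSpanSingleton k _ (canonElt M))
    (coev_colinear M)

theorem evalLin_rTensor_assoc_symm (v : V) (x : Module.Dual k V ⊗[k] V) :
    (evalLin V).rTensor V ((TensorProduct.assoc k V (Module.Dual k V) V).symm (v ⊗ₜ x)) =
      1 ⊗ₜ dualTensorHom k V V x v := by
  induction x with
  | zero => simp
  | add x y hx hy => simp only [map_add, TensorProduct.tmul_add, LinearMap.add_apply, hx, hy]
  | tmul f w => simp [evalLin, TensorProduct.smul_tmul']

theorem evalLin_lTensor_assoc (f : Module.Dual k V) (x : Module.Dual k V ⊗[k] V) :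
    (evalLin V).lTensor (Module.Dual k V) (TensorProduct.assoc k (Module.Dual k V) V
      (Module.Dual k V) (x ⊗ₜ f)) = (f ∘ₗ dualTensorHom k V V x) ⊗ₜ 1 := by
  induction x with
  | zero => simp
  | add x y hx hy => simp only [map_add, TensorProduct.add_tmul, LinearMap.comp_add, hx, hy]
  | tmul g w =>
    have : f ∘ₗ dualTensorHom k V V (g ⊗ₜ w) = f w • g := by ext; simp [mul_comm]
    rw [this]
    simp [evalLin, TensorProduct.smul_tmul]

instance : ExactPairing M.star M where
  coevaluation' := coev M
  evaluation' := ev M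
  coevaluation_evaluation' := tensor_ext (N := unit k A) fun (m : M) (c : k) => by
    have h : (evalLin M).rTensor M ((TensorProduct.assoc k M (Module.Dual k M) M).symm
        (m ⊗ₜ (c • canonElt M))) = 1 ⊗ₜ (c • m) := by
      rw [evalLin_rTensor_assoc_symm, map_smul, LinearMap.smul_apply, dualTensorHom_canonElt]
    exact h
  evaluation_coevaluation' := tensor_ext (M := unit k A) (N := M.star)
    fun (c : k) (f : Module.Dual k M) => by
    have h : (evalLin M).lTensor (Module.Dual k M) (TensorProduct.assoc k (Module.Dual k M) M
        (Module.Dual k M) ((c • canonElt M) ⊗ₜ f)) = (c • f) ⊗ₜ 1 := by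
      rw [evalLin_lTensor_assoc]
      congr 1
      ext m
      simp [dualTensorHom_canonElt]
    exact h

instance : Module.Finite k M.star := M.finDim_dual _ _

/-- `M* ⊗ -` is right adjoint to `M ⊗ -`, which preserves monomorphisms. -/
theorem injective_star_tensor (I : LComod k A) [Injective I] : Injective (M.star ⊗ I) :=
  (tensorLeftAdjunction M.star M).map_injective I ‹_›

/-- `M ⊗ -` is left adjoint to `M* ⊗ -`, which preserves epimorphisms. -/
theorem projective_tensor (P : LComod k A) [Projective P] : Projective (M ⊗ P) :=
  (tensorLeftAdjunction M.star M).map_projective P ‹_›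

/-- On the right the roles are exchanged: `- ⊗ M*` is left adjoint to `- ⊗ M`. -/
theorem projective_tensor_star (P : LComod k A) [Projective P] : Projective (P ⊗ M.star) :=
  (tensorRightAdjunction M.star M).map_projective P ‹_›

end Pairing

end LComod

end

end BraidedCoFrob

namespace BraidedCoFrob
noncomputable section
open MonoidalCategory HopfAlgebra

namespace LComod

/-! #### Splittings -/

section Split

variable {k C : Type u} [Field k] [AddCommGroup C] [Module k C] [Coalgebra k C]

theorem exists_section_of_injective {X Y Z : LComod k C} (j : X ⟶ Y) (p : Y ⟶ Z)
    (hj : Function.Injective (lin j)) (hp : Function.Surjective (lin p))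
    (hjp : Function.Exact (lin j) (lin p)) [Injective X] : ∃ s : Z ⟶ Y, s ≫ p = 𝟙 Z := by
  have : Mono j := mono_of_injective _ hj
  let r : Y ⟶ X := Injective.factorThru (𝟙 _) j
  have hr : ∀ x, lin r (lin j x) = x := fun x =>
    LinearMap.congr_fun (congrArg lin (Injective.comp_factorThru (𝟙 _) j)) x
  -- `id - j r` kills the kernel of `p`, so it descends to `Z`; the induced map is a section because
  -- `p j = 0`.
  let t : Y →ₗ[FunAlg k C] Y := LinearMap.id - toD j ∘ₗ toD r
  have ht : LinearMap.ker (toD p) ≤ LinearMap.ker t := fun y hy => by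
    obtain ⟨x, rfl⟩ := (hjp y).mp hy
    simp [t, hr]
  let e := (toD p).quotKerEquivOfSurjective hp
  refine ⟨ofD ((LinearMap.ker (toD p)).liftQ t ht ∘ₗ e.symm.toLinearMap), hom_ext' fun z => ?_⟩
  obtain ⟨y, rfl⟩ := hp z
  have hy : e.symm (lin p y) = Submodule.Quotient.mk y := by
    rw [LinearEquiv.symm_apply_eq]; rfl
  have h2 : lin p (lin j (lin r y)) = 0 := (hjp _).mpr ⟨_, rfl⟩
  simp [hy, t, h2]

theorem exists_retraction_of_projective {X Y Z : LComod k C} (j : X ⟶ Y) (p : Y ⟶ Z)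
    (hj : Function.Injective (lin j)) (hp : Function.Surjective (lin p))
    (hjp : Function.Exact (lin j) (lin p)) [Projective Z] : ∃ r : Y ⟶ X, j ≫ r = 𝟙 X := by
  have : Epi p := epi_of_surjective _ hp
  let s : Z ⟶ Y := Projective.factorThru (𝟙 _) p
  have hs : ∀ z, lin p (lin s z) = z := fun z =>
    LinearMap.congr_fun (congrArg lin (Projective.factorThru_comp (𝟙 _) p)) z
  -- `id - s p` takes values in the kernel of `p`, that is in the image of `j`, and is the identity
  -- there.
  let t : Y →ₗ[FunAlg k C] Y := LinearMap.id - toD s ∘ₗ toD p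
  have ht : ∀ y, t y ∈ LinearMap.range (toD j) := fun y => by
    refine (hjp _).mp ?_
    simp [t, hs]
  let e := LinearEquiv.ofInjective (toD j) hj
  refine ⟨ofD (e.symm.toLinearMap ∘ₗ t.codRestrict _ ht), hom_ext' fun x => ?_⟩
  have hx : t.codRestrict _ ht (lin j x) = e x := by
    apply Subtype.ext
    have : lin p (lin j x) = 0 := (hjp _).mpr ⟨x, rfl⟩
    simp only [LinearMap.codRestrict_apply, t, LinearMap.sub_apply, LinearMap.comp_apply, toD_apply,
      this, map_zero, sub_zero]
    rfl
  change e.symm (t.codRestrict _ ht (lin j x)) = x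
  rw [hx, LinearEquiv.symm_apply_apply]

theorem exact_incl_ker {Y Z : LComod k C} (p : Y ⟶ Z) :
    Function.Exact (lin (Y.incl (LinearMap.ker (toD p)))) (lin p) := fun y =>
  ⟨fun h => ⟨⟨y, h⟩, rfl⟩, fun ⟨x, hx⟩ => hx ▸ Y.incl_mem _ x⟩

theorem exact_proj_range {X Y : LComod k C} (j : X ⟶ Y) :
    Function.Exact (lin j) (lin (Y.proj (LinearMap.range (toD j)))) := fun y =>
  Y.proj_eq_zero _ y

theorem hasFinDimQuotient_of_ne_zero {M N : LComod k C} (hN : N.FinDim) {f : M ⟶ N} (hf : f ≠ 0) :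
    M.HasFinDimQuotient := by
  refine ⟨N.sub (LinearMap.range (toD f)), N.codRestrict _ f fun m => ⟨m, rfl⟩, ?_, ?_, hN.sub _⟩
  · rintro ⟨_, m, rfl⟩
    exact ⟨m, rfl⟩
  · have : ∃ m, lin f m ≠ 0 := by
      by_contra! h
      exact hf (hom_ext' h)
    obtain ⟨m, hm⟩ := this
    exact ⟨⟨lin f m, m, rfl⟩, 0, fun h => hm (congrArg Subtype.val h)⟩

theorem exists_ne_zero {M N : LComod k C} {f : M ⟶ N} (hf : f ≠ 0) : ∃ m, lin f m ≠ 0 := by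
  by_contra! h
  exact hf (hom_ext' h)

end Split

variable {k A : Type u} [Field k] [Ring A] [HopfAlgebra k A]

/-! #### Tensoring an injective comodule with an arbitrary comodule -/

section CofreeTensor

variable (V : Type u) [AddCommGroup V] [Module k V] (M : LComod k A)

/-- The map `(a ⊗ v) ⊗ m ↦ a m₍₋₁₎ ⊗ (v ⊗ m₍₀₎)`. -/
def cofreeTensorLin : (A ⊗[k] V) ⊗[k] M →ₗ[k] A ⊗[k] (V ⊗[k] M) :=
  mulTensor k A V M ∘ₗ M.coact.lTensor (A ⊗[k] V)

/-- The map `(a ⊗ v) ⊗ (b ⊗ m) ↦ (a S(b) ⊗ v) ⊗ m`. -/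
def cofreeTensorAux : (A ⊗[k] V) ⊗[k] (A ⊗[k] M) →ₗ[k] (A ⊗[k] V) ⊗[k] M :=
  (TensorProduct.assoc k A V M).symm.toLinearMap ∘ₗ
    (LinearMap.mul' k A ∘ₗ (antipode k).lTensor A).rTensor (V ⊗[k] M) ∘ₗ
    (TensorProduct.tensorTensorTensorComm k A V A M).toLinearMap

/-- The map `a ⊗ (v ⊗ m) ↦ (a S(m₍₋₁₎) ⊗ v) ⊗ m₍₀₎`. -/
def cofreeTensorInv : A ⊗[k] (V ⊗[k] M) →ₗ[k] (A ⊗[k] V) ⊗[k] M :=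
  cofreeTensorAux V M ∘ₗ M.coact.lTensor (A ⊗[k] V) ∘ₗ
    (TensorProduct.assoc k A V M).symm.toLinearMap

/-- The cancellation behind this is `m₍₋₂₎ S(m₍₋₁₎) ⊗ m₍₀₎ = 1 ⊗ m`; the opposite composite uses
`S(m₍₋₂₎) m₍₋₁₎ ⊗ m₍₀₎ = 1 ⊗ m`. -/
theorem cofreeTensorInv_lin (x : (A ⊗[k] V) ⊗[k] M) :
    cofreeTensorInv V M (cofreeTensorLin V M x) = x := by
  refine TensorProduct.induction_on x (by simp) (fun y m => ?_)
    (fun x y hx hy => by simp only [map_add, hx, hy])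
  refine TensorProduct.induction_on y (by simp) (fun a v => ?_)
    (fun x y hx hy => by simp only [map_add, TensorProduct.add_tmul, hx, hy])
  have key : ∀ z : A ⊗[k] M, cofreeTensorInv V M (mulTensor k A V M ((a ⊗ₜ v) ⊗ₜ z)) =
      (TensorProduct.assoc k A V M).symm (mulTensor k A V M ((a ⊗ₜ v) ⊗ₜ
        mulAntipodeRight M (M.coact.lTensor A z))) := by
    intro z
    induction z with
    | zero => simp
    | add x y hx hy => simp only [map_add, TensorProduct.tmul_add, hx, hy]
    | tmul b m =>
      rw [mulTensor_tmul]
      simp only [cofreeTensorInv, LinearMap.comp_apply, LinearEquiv.coe_coe,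
        TensorProduct.assoc_symm_tmul, LinearMap.lTensor_tmul]
      generalize M.coact m = y
      induction y with
      | zero => simp
      | add x y hx hy => simp only [map_add, TensorProduct.tmul_add, hx, hy]
      | tmul c m => simp [cofreeTensorAux, mulTensor_tmul, mul_assoc]
  rw [cofreeTensorLin, LinearMap.comp_apply, LinearMap.lTensor_tmul, key, mulAntipodeRight_coact,
    mulTensor_tmul]
  simp

theorem cofreeTensorLin_inv (x : A ⊗[k] (V ⊗[k] M)) :
    cofreeTensorLin V M (cofreeTensorInv V M x) = x := by
  refine TensorProduct.induction_on x (by simp) (fun a y => ?_)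
    (fun x y hx hy => by simp only [map_add, hx, hy])
  refine TensorProduct.induction_on y (by simp) (fun v m => ?_)
    (fun x y hx hy => by simp only [map_add, TensorProduct.tmul_add, hx, hy])
  have key : ∀ z : A ⊗[k] M, cofreeTensorLin V M (cofreeTensorAux V M ((a ⊗ₜ v) ⊗ₜ z)) =
      mulTensor k A V M ((a ⊗ₜ v) ⊗ₜ mulAntipodeLeft M (M.coact.lTensor A z)) := by
    intro z
    induction z with
    | zero => simp
    | add x y hx hy => simp only [map_add, TensorProduct.tmul_add, hx, hy]
    | tmul b m =>
      simp only [cofreeTensorLin, cofreeTensorAux, LinearMap.comp_apply, LinearEquiv.coe_coe,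
        TensorProduct.assoc_symm_tmul, LinearMap.lTensor_tmul, LinearMap.rTensor_tmul,
        TensorProduct.tensorTensorTensorComm_tmul, LinearMap.mul'_apply]
      generalize M.coact m = y
      induction y with
      | zero => simp
      | add x y hx hy => simp only [map_add, TensorProduct.tmul_add, hx, hy]
      | tmul c m => simp [mulTensor_tmul, mul_assoc]
  rw [cofreeTensorInv, LinearMap.comp_apply, LinearMap.comp_apply, LinearEquiv.coe_coe,
    TensorProduct.assoc_symm_tmul, LinearMap.lTensor_tmul, key, mulAntipodeLeft_coact,
    mulTensor_tmul]
  simp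

/-- Identifies the map given by the universal property, colinear by construction, with the explicit
formula, which is visibly invertible. -/
theorem cofreeTensorLin_eq (x : (A ⊗[k] V) ⊗[k] M) :
    (TensorProduct.map (contract (C := A) (V := V) Coalgebra.counit) LinearMap.id).lTensor A
      (tensorCoact (cofreeCoact A V) M.coact x) = cofreeTensorLin V M x := by
  refine TensorProduct.induction_on x (by simp) (fun y m => ?_)
    (fun x y hx hy => by simp only [map_add, hx, hy])
  rw [tensorCoact_eq, ← mulTensor_lTensor, lTensor_contract_cofreeCoact, LinearMap.lTensor_id]
  rfl

/-- A cofree comodule tensored with any comodule is cofree. -/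
def cofreeTensor : cofree A V ⊗ M ⟶ cofree A (V ⊗[k] M) :=
  toCofree (M := tensorObj (cofree A V) M)
    (TensorProduct.map (contract (C := A) (V := V) Coalgebra.counit) LinearMap.id)

theorem cofreeTensor_bijective : Function.Bijective (lin (cofreeTensor V M)) := by
  have h : ∀ x : (A ⊗[k] V) ⊗[k] M, lin (cofreeTensor V M) x = cofreeTensorLin V M x :=
    cofreeTensorLin_eq V M
  refine Function.bijective_iff_has_inverse.mpr ⟨cofreeTensorInv V M, fun x => ?_, fun x => ?_⟩
  · exact (congrArg (cofreeTensorInv V M) (h x)).trans (cofreeTensorInv_lin V M x)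
  · exact (h _).trans (cofreeTensorLin_inv V M x)

end CofreeTensor

/-- `I` is a retract of a cofree comodule, and a cofree comodule tensored with `M` is again cofree.
No finiteness of `M` is required. -/
theorem injective_tensor (I M : LComod k A) [Injective I] : Injective (I ⊗ M) := by
  have h1 : Injective (cofree A I ⊗ M) :=
    Injective.of_iso (isoOfBijective _ (cofreeTensor_bijective I M)).symm inferInstance
  let ret : Retract I (cofree A I) :=
    ⟨toSelfCofree I, Injective.factorThru (𝟙 I) (toSelfCofree I), Injective.comp_factorThru _ _⟩
  exact @Retract.injective _ _ _ _ (ret.map (tensorRight M)) h1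

/-! #### The unit object -/

theorem finDim_unit : (𝟙_ (LComod k A)).FinDim := inferInstanceAs (Module.Finite k k)

theorem nonZero_unit : (𝟙_ (LComod k A)).NonZero := inferInstanceAs (Nontrivial k)

theorem injective_of_unit_hom {M : LComod k A} {f : 𝟙_ (LComod k A) ⟶ M} (hf : f ≠ 0) :
    Function.Injective (lin f) := by
  have h1 : ∀ c : k, lin f c = c • lin f (1 : k) := fun c => by
    have := map_smul (lin f) c (1 : k)
    refine Eq.trans ?_ this
    exact congrArg (lin f) (mul_one c).symm
  have h0 : lin f (1 : k) ≠ 0 := fun h => hf (hom_ext' fun (c : k) =>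
    (h1 c).trans ((congrArg (c • ·) h).trans (smul_zero c)))
  rw [injective_iff_map_eq_zero]
  intro c hc
  rw [h1 c] at hc
  exact (smul_eq_zero.mp hc).resolve_right h0

instance isSimpleModule_unit : IsSimpleModule (FunAlg k A) (𝟙_ (LComod k A)) := by
  have : Nontrivial (𝟙_ (LComod k A)) := nonZero_unit
  have h : ∀ U : Submodule (FunAlg k A) (𝟙_ (LComod k A)), U = ⊥ ∨ U = ⊤ := fun U => by
    by_cases hU : U = ⊥
    · exact Or.inl hU
    right
    obtain ⟨x, hx, hx0⟩ := (Submodule.ne_bot_iff _).mp hU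
    rw [eq_top_iff]
    rintro (y : k) -
    have : y = (y / (show k from x)) • (show k from x) := (div_mul_cancel₀ y hx0).symm
    rw [this]
    exact (U.restrictScalars k).smul_mem _ hx
  exact { eq_bot_or_eq_top := h }

/-! #### Transposition -/

section

variable (P : LComod k A)

instance : (tensorLeft P).PreservesZeroMorphisms where
  map_zero _ _ := hom_ext (LinearMap.lTensor_zero P)

instance : (tensorRight P).PreservesZeroMorphisms where
  map_zero _ _ := hom_ext (LinearMap.rTensor_zero P)

end

/-- Used to carry nonvanishing across duality: transposition is a bijection, and its inverse sends
zero to zero. -/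
theorem homEquiv_ne_zero {F G : LComod k A ⥤ LComod k A} (adj : F ⊣ G)
    [F.PreservesZeroMorphisms] {X Y : LComod k A} {f : F.obj X ⟶ Y} (hf : f ≠ 0) :
    adj.homEquiv X Y f ≠ 0 := fun h => hf <| by
  rw [← (adj.homEquiv X Y).symm_apply_apply f, h, Adjunction.homEquiv_counit, Functor.map_zero,
    Limits.zero_comp]

theorem homEquiv_symm_ne_zero {F G : LComod k A ⥤ LComod k A} (adj : F ⊣ G)
    [G.PreservesZeroMorphisms] {X Y : LComod k A} {f : X ⟶ G.obj Y} (hf : f ≠ 0) :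
    (adj.homEquiv X Y).symm f ≠ 0 := fun h => hf <| by
  rw [← (adj.homEquiv X Y).apply_symm_apply f, h, Adjunction.homEquiv_unit, Functor.map_zero,
    Limits.comp_zero]

theorem FinDim.tensor {M N : LComod k A} (hM : M.FinDim) (hN : N.FinDim) : (M ⊗ N).FinDim :=
  have : Module.Finite k M := hM
  have : Module.Finite k N := hN
  inferInstanceAs (Module.Finite k (M ⊗[k] N))

theorem NonZero.tensor {M N : LComod k A} (hM : M.NonZero) (hN : N.NonZero) : (M ⊗ N).NonZero := by
  have : Nontrivial M := hM
  have : Nontrivial N := hN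
  exact inferInstanceAs (Nontrivial (M ⊗[k] N))

/-- A dual object is a retract of `M* ⊗ (M ⊗ M*)`. -/
def starRetract (M : LComod k A) [Module.Finite k M] : Retract M.star (M.star ⊗ (M ⊗ M.star)) where
  i := (λ_ _).inv ≫ η_ M.star M ▷ M.star ≫ (α_ _ _ _).hom
  r := M.star ◁ ε_ M.star M ≫ (ρ_ _).hom
  retract := by
    have h := ExactPairing.evaluation_coevaluation M.star M
    simp only [Category.assoc]
    rw [reassoc_of% h]
    simp

theorem ev_surjective {M : LComod k A} [Module.Finite k M] (hM : M.NonZero) :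
    Function.Surjective (lin (ev M)) := by
  have : Nontrivial M := hM
  obtain ⟨m, hm⟩ := exists_ne (0 : M)
  obtain ⟨f, hf⟩ := (Module.forall_dual_apply_eq_zero_iff k m).not.mpr hm |> not_forall.mp
  intro (c : k)
  refine ⟨(m ⊗ₜ[k] ((c / f m) • f) : M ⊗[k] Module.Dual k M), ?_⟩
  have : evalLin M (m ⊗ₜ[k] ((c / f m) • f)) = c := by
    simp [evalLin, hf]
  exact this

end LComod

end

end BraidedCoFrob

namespace BraidedCoFrob
noncomputable section
open MonoidalCategory HopfAlgebra

namespace LComod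

variable {k A : Type u} [Field k] [Ring A] [HopfAlgebra k A]

/-! ### Co-Frobenius Hopf algebras: the homological conditions -/

/-- A simple object is generated by any nonzero element, and cyclic subcomodules are
finite-dimensional. -/
theorem finDim_of_simple {S : LComod k A} (hS : Simple S) : S.FinDim := by
  have h0 : 𝟙 S ≠ 0 := id_nonzero S
  obtain ⟨s, hs⟩ := exists_ne_zero h0
  have : Mono (S.incl (S.gen s)) := mono_of_injective _ (S.incl_injective _)
  have h1 : S.incl (S.gen s) ≠ 0 := fun h => hs <|
    LinearMap.congr_fun (congrArg lin h) (⟨s, S.self_mem_gen s⟩ : S.sub (S.gen s))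
  have := (Simple.mono_isIso_iff_nonzero (S.incl (S.gen s))).mpr h1
  exact (S.finDim_gen s).of_surjective _ (bijective_of_isIso (S.incl (S.gen s))).2

theorem simple_unit : Simple (𝟙_ (LComod k A)) where
  mono_isIso_iff_nonzero {Y} f _ := by
    constructor
    · rintro _ rfl
      obtain ⟨y, hy⟩ := (bijective_of_isIso (0 : Y ⟶ 𝟙_ (LComod k A))).2 (1 : k)
      exact zero_ne_one (α := k) hy
    · intro hf
      refine isIso_of_bijective f ⟨(mono_iff f).mp inferInstance, ?_⟩
      have h : LinearMap.range (toD f) = ⊤ := (eq_bot_or_eq_top _).resolve_left fun h => hf <|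
        hom_ext' fun y => LinearMap.congr_fun (LinearMap.range_eq_bot.mp h) y
      exact show Function.Surjective (toD f) from LinearMap.range_eq_top.mp h

/-- Choose a finite-dimensional `F ⊆ M` on which `p` is nonzero. The inclusion of `F = F ⊗ k`
extends along `F ⊗ i` to `F ⊗ E → M`, since `M` is injective. Composing with `p` and transposing
gives `t : E → F* ⊗ N`, whose restriction to `k` is the transpose of `F → M → N`. This is nonzero,
hence injective on the one-dimensional `k`, so `t` is injective by essentiality and `E` embeds in a
finite-dimensional space. -/
theorem hull_unit_finDim_of_hom {M N : LComod k A} [Injective M] (hN : N.FinDim) {p : M ⟶ N}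
    (hp : p ≠ 0) {E : LComod k A} {i : 𝟙_ (LComod k A) ⟶ E} (hi : IsInjectiveHull i) :
    E.FinDim := by
  obtain ⟨m, hm⟩ := exists_ne_zero hp
  let F := M.sub (M.gen m)
  have : Module.Finite k F := M.finDim_gen m
  have := hi.mono
  have : Mono (F ◁ i) :=
    mono_of_injective _ (whiskerLeft_injective F i ((mono_iff i).mp inferInstance))
  let g : F ⊗ E ⟶ M := Injective.factorThru ((ρ_ F).hom ≫ M.incl (M.gen m)) (F ◁ i)
  have hg : F ◁ i ≫ g = (ρ_ F).hom ≫ M.incl (M.gen m) := Injective.comp_factorThru _ _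
  let adj := tensorLeftAdjunction F.star F
  let t : E ⟶ F.star ⊗ N := adj.homEquiv E N (g ≫ p)
  have hne : F ◁ i ≫ g ≫ p ≠ 0 := fun h => hm <| by
    rw [← Category.assoc, hg] at h
    have h1 := LinearMap.congr_fun (congrArg lin h)
      ((⟨m, M.self_mem_gen m⟩ : F) ⊗ₜ[k] (1 : k) : F ⊗[k] k)
    refine Eq.trans ?_ h1
    refine congrArg (lin p) ?_
    change m = lin (M.incl (M.gen m)) ((1 : k) • (⟨m, M.self_mem_gen m⟩ : F))
    rw [one_smul]
    rfl
  have hit : i ≫ t ≠ 0 := by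
    have h1 : adj.homEquiv _ N (F ◁ i ≫ g ≫ p) = i ≫ t :=
      adj.homEquiv_naturality_left i (g ≫ p)
    rw [← h1]
    exact homEquiv_ne_zero adj hne
  have hmono := hi.essential t (mono_of_injective _ (injective_of_unit_hom hit))
  have hF : F.FinDim := M.finDim_gen m
  exact (FinDim.tensor (F.finDim_dual _ _) hN).of_injective _ ((mono_iff t).mp hmono)

theorem hull_unit_of_hom {M N : LComod k A} [Injective M] (hN : N.FinDim) {p : M ⟶ N}
    (hp : p ≠ 0) : (𝟙_ (LComod k A)).HasFinDimInjectiveHull := by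
  obtain ⟨U, i, hi⟩ := exists_injectiveHull (toSelfCofree (𝟙_ (LComod k A)))
    (toSelfCofree_injective _)
  exact ⟨_, i, hi, hull_unit_finDim_of_hom hN hp hi⟩

theorem hull_unit_of_quotient {M : LComod k A} [Injective M] (h : M.HasFinDimQuotient) :
    (𝟙_ (LComod k A)).HasFinDimInjectiveHull := by
  obtain ⟨N, p, hp, hN, hfd⟩ := h
  refine hull_unit_of_hom hfd (p := p) ?_
  rintro rfl
  have : Nontrivial N := hN
  obtain ⟨n, hn⟩ := exists_ne (0 : N)
  obtain ⟨m, rfl⟩ := hp n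
  exact hn rfl

/-- `S = k ⊗ S` embeds in `E ⊗ S`, which is injective and finite-dimensional; the hull is found
inside it. -/
theorem hull_of_hull_unit (h : (𝟙_ (LComod k A)).HasFinDimInjectiveHull) {S : LComod k A}
    (hS : S.FinDim) : S.HasFinDimInjectiveHull := by
  obtain ⟨E, i, hi, hE⟩ := h
  have := hi.injective
  have := hi.mono
  have := injective_tensor E S
  have hinj : Function.Injective (lin ((λ_ S).inv ≫ i ▷ S)) :=
    (whiskerRight_injective S i ((mono_iff i).mp inferInstance)).comp
      ((mono_iff (λ_ S).inv).mp inferInstance)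
  obtain ⟨U, i', hi'⟩ := exists_injectiveHull _ hinj
  exact ⟨_, i', hi', (hE.tensor hS).sub U⟩

theorem nonZero_of_injective {M N : LComod k A} (hM : M.NonZero) (f : M ⟶ N)
    (hf : Function.Injective (lin f)) : N.NonZero :=
  have : Nontrivial M := hM
  hf.nontrivial

theorem nonZero_of_surjective {M N : LComod k A} (hN : N.NonZero) (f : M ⟶ N)
    (hf : Function.Surjective (lin f)) : M.NonZero :=
  have : Nontrivial N := hN
  hf.nontrivial

theorem id_ne_zero_of_nonZero {M : LComod k A} (hM : M.NonZero) : 𝟙 M ≠ 0 := fun h => by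
  have : Nontrivial M := hM
  obtain ⟨m, hm⟩ := exists_ne (0 : M)
  exact hm (LinearMap.congr_fun (congrArg lin h) m)

/-! ### Consequences of a nonzero finite-dimensional injective comodule -/

section FinDimInjective

variable {E : LComod k A} [Module.Finite k E] [Injective E]

/-- For a nonzero finite-dimensional `F ⊆ M`, the object `E ⊗ F` is injective, so `E ⊗ M` retracts
onto it. The transpose `M → E* ⊗ (E ⊗ F)` of the retraction is nonzero with finite-dimensional
target. -/
theorem hasFinDimQuotient_of_injective (hE : E.NonZero) {M : LComod k A} (hM : M.NonZero) :
    M.HasFinDimQuotient := by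
  have : Nontrivial M := hM
  obtain ⟨m, hm⟩ := exists_ne (0 : M)
  let F := M.sub (M.gen m)
  have hF : F.FinDim := M.finDim_gen m
  have hF0 : F.NonZero := ⟨⟨m, M.self_mem_gen m⟩, 0, fun h => hm (congrArg Subtype.val h)⟩
  have := injective_tensor E F
  have : Mono (E ◁ M.incl (M.gen m)) :=
    mono_of_injective _ (whiskerLeft_injective E _ (M.incl_injective _))
  let r : E ⊗ M ⟶ E ⊗ F := Injective.factorThru (𝟙 _) (E ◁ M.incl (M.gen m))
  have hr : E ◁ M.incl (M.gen m) ≫ r = 𝟙 _ := Injective.comp_factorThru _ _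
  have hr0 : r ≠ 0 := fun h => id_ne_zero_of_nonZero (hE.tensor hF0) <| by
    rw [← hr, h, Limits.comp_zero]
  have hEf : E.FinDim := ‹Module.Finite k E›
  exact hasFinDimQuotient_of_ne_zero ((E.finDim_dual _ _).tensor (hEf.tensor hF))
    (homEquiv_ne_zero (tensorLeftAdjunction E.star E) hr0)

variable (E) in
-- `E*` is a retract of `E* ⊗ (E ⊗ E*)`; here `E ⊗ E*` is injective, and `E* ⊗ -` preserves
-- injectives.
theorem injective_star : Injective E.star :=
  have := injective_tensor E E.star
  have := injective_star_tensor E (E ⊗ E.star)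
  (starRetract E).injective

variable (E) in
-- Maps `E ⊗ X → Y` are maps `X → E* ⊗ Y`. For an epimorphism `e` with kernel `K`, the object `E* ⊗
-- K` is injective because `E*` is, so `E* ⊗ e` splits and every transposed map lifts.
theorem projective_injective_tensor (X : LComod k A) : Projective (E ⊗ X) where
  factors {Y Z} f e _ := by
    have := injective_star E
    let i := Y.incl (LinearMap.ker (toD e))
    have := injective_tensor E.star (Y.sub (LinearMap.ker (toD e)))
    have he := (epi_iff e).mp inferInstance
    obtain ⟨s, hs⟩ := exists_section_of_injective (E.star ◁ i) (E.star ◁ e)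
      (whiskerLeft_injective _ _ (Y.incl_injective _)) (whiskerLeft_surjective _ _ he)
      (lTensor_exact E.star (exact_incl_ker e) he)
    let adj := tensorLeftAdjunction E.star E
    refine ⟨(adj.homEquiv X Y).symm (adj.homEquiv X Z f ≫ s), ?_⟩
    have h1 := adj.homEquiv_naturality_right_symm (adj.homEquiv X Z f ≫ s) e
    refine h1.symm.trans ?_
    have h2 : (adj.homEquiv X Z f ≫ s) ≫ (tensorLeft E.star).map e = adj.homEquiv X Z f := by
      rw [Category.assoc]
      exact (congrArg _ hs).trans (Category.comp_id _)
    rw [h2, Equiv.symm_apply_apply]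

/-- `S` is a quotient of `E ⊗ (E* ⊗ S)` through evaluation, which is onto because `E` is nonzero. -/
theorem exists_finDim_projective_epi (hE : E.NonZero) (S : LComod k A) (hS : S.FinDim) :
    ∃ (T : LComod k A) (p : T ⟶ S), T.FinDim ∧ Projective T ∧ Function.Surjective (lin p) := by
  have hEf : E.FinDim := ‹Module.Finite k E›
  refine ⟨E ⊗ (E.star ⊗ S), (α_ _ _ _).inv ≫ ev E ▷ S ≫ (λ_ S).hom,
    hEf.tensor ((E.finDim_dual _ _).tensor hS), projective_injective_tensor E _, ?_⟩
  have h1 := (epi_iff (α_ E E.star S).inv).mp inferInstance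
  have h2 := (epi_iff (λ_ S).hom).mp inferInstance
  exact (h2.comp (whiskerRight_surjective S _ (ev_surjective hE))).comp h1

theorem hasProjectiveCover_of_injective (hE : E.NonZero) (M : LComod k A) :
    M.HasProjectiveCover :=
  hasProjectiveCover_of_finDim (fun _ hM => hasFinDimQuotient_of_injective hE hM)
    (exists_finDim_projective_epi hE) M

end FinDimInjective

/-- `I = k ⊗ I` embeds in `E ⊗ I`, which is projective; injectivity of `I` splits the embedding. -/
theorem projective_of_injective (h : (𝟙_ (LComod k A)).HasFinDimInjectiveHull) (I : LComod k A)
    [Injective I] : Projective I := by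
  obtain ⟨E, i, hi, hE⟩ := h
  have := hi.injective
  have := hi.mono
  have : Module.Finite k E := hE
  have := projective_injective_tensor E I
  have : Mono ((λ_ I).inv ≫ i ▷ I) := mono_of_injective _ <|
    (whiskerRight_injective I i ((mono_iff i).mp inferInstance)).comp
      ((mono_iff (λ_ I).inv).mp inferInstance)
  exact Retract.projective (Y := E ⊗ I)
    ⟨(λ_ I).inv ≫ i ▷ I, Injective.factorThru (𝟙 I) _, Injective.comp_factorThru _ _⟩

/-! #### A nonzero projective object yields a finite-dimensional injective one -/

/-- Take `g : P → G` nonzero with `G` finite-dimensional and a finite-dimensional `F ⊆ P` not killed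
by `g`. For any epimorphism `q : Q → k`, the map `g` lifts along `q ⊗ G` to `P → Q ⊗ G`; restricting
to `F` and transposing gives a map `F ⊗ G* → Q` that is nonzero after `q`. Thus `F ⊗ G*` is the
uniform bound asked for by `exists_finDim_projective`. -/
theorem exists_finDim_projective_of_projective {P : LComod k A} [Projective P] (hP : P.NonZero) :
    ∃ (P' : LComod k A), P'.FinDim ∧ Projective P' ∧ P'.NonZero := by
  obtain ⟨G, g, hG, hg⟩ := exists_finDim_hom_of_projective hP
  have : Module.Finite k G := hG
  obtain ⟨x, hx⟩ := exists_ne_zero hg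
  let F := P.sub (P.gen x)
  have hF : F.FinDim := P.finDim_gen x
  let adj := tensorRightAdjunction G.star G
  obtain ⟨P', p, h1, h2, h3⟩ := exists_finDim_projective (T := 𝟙_ (LComod k A))
    (W := F ⊗ G.star) finDim_unit (hF.tensor (G.finDim_dual _ _)) fun Q q hq => by
      have : Epi (q ▷ G) := epi_of_surjective _ (whiskerRight_surjective G q hq)
      let h : P ⟶ Q ⊗ G := Projective.factorThru (g ≫ (λ_ G).inv) (q ▷ G)
      have hh : h ≫ q ▷ G = g ≫ (λ_ G).inv := Projective.factorThru_comp _ _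
      refine ⟨(adj.homEquiv F Q).symm (P.incl (P.gen x) ≫ h), ?_⟩
      have h1 := adj.homEquiv_naturality_right_symm (P.incl (P.gen x) ≫ h) q
      rw [← h1]
      refine homEquiv_symm_ne_zero adj fun h0 => hx ?_
      have h2 : P.incl (P.gen x) ≫ g ≫ (λ_ G).inv = 0 := by
        rw [← hh]; exact (Category.assoc _ _ _).symm.trans h0
      have h3 : P.incl (P.gen x) ≫ g = 0 := by
        rw [← Category.comp_id g, ← (λ_ G).inv_hom_id, ← Category.assoc, ← Category.assoc,
          Category.assoc _ g, h2, Limits.zero_comp]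
      exact LinearMap.congr_fun (congrArg lin h3) (⟨x, P.self_mem_gen x⟩ : F)
  exact ⟨P', h1, h2, nonZero_of_surjective nonZero_unit p h3⟩

/-! ### Finite-dimensional projective comodules are injective -/

section FinDimProjective

variable (P : LComod k A) [Module.Finite k P] [Projective P]

/-- `P*` is a retract of `P* ⊗ P ⊗ P*`, and tensoring `P` with `P*` on the left and then on the
right preserves projectivity. -/
theorem projective_star : Projective P.star :=
  have := projective_tensor P.star P
  have := projective_tensor_star P (P.star ⊗ P)
  have : Projective (P.star ⊗ (P ⊗ P.star)) := Projective.of_iso (α_ _ _ _) this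
  (starRetract P).projective

/-- Tensor `0 → P → X → Q → 0` with `P*` on the right. Since `P*` is projective and `Q`
finite-dimensional, `Q ⊗ P*` is projective and the sequence splits. The retraction followed by
evaluation is a map `X ⊗ P* → k`; its transpose `X → P` restricts to the identity by a triangle
identity. -/
theorem exists_retraction_of_finDim {X : LComod k A} (hX : X.FinDim) (j : P ⟶ X)
    (hj : Function.Injective (lin j)) : ∃ r : X ⟶ P, j ≫ r = 𝟙 P := by
  let q := X.proj (LinearMap.range (toD j))
  have : Module.Finite k (X.quot (LinearMap.range (toD j))) := hX.quot _
  have := projective_star P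
  have := projective_tensor (X.quot (LinearMap.range (toD j))) P.star
  obtain ⟨r, hr⟩ := exists_retraction_of_projective (j ▷ P.star) (q ▷ P.star)
    (whiskerRight_injective _ _ hj) (whiskerRight_surjective _ _ (X.proj_surjective _))
    (rTensor_exact P.star (exact_proj_range j) (X.proj_surjective _))
  let adj := tensorRightAdjunction P.star P
  let t : X ⟶ 𝟙_ _ ⊗ P := adj.homEquiv X (𝟙_ _) (r ≫ ev P)
  refine ⟨t ≫ (λ_ P).hom, ?_⟩
  have h1 : adj.homEquiv P (𝟙_ _) (j ▷ P.star ≫ r ≫ ev P) = j ≫ t :=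
    adj.homEquiv_naturality_left j (r ≫ ev P)
  have h0 : j ▷ P.star ≫ r ≫ ev P = ev P := by
    rw [← Category.assoc, hr]
    exact Category.id_comp _
  rw [h0] at h1
  rw [← Category.assoc, ← h1, Adjunction.homEquiv_unit]
  have h2 := ExactPairing.coevaluation_evaluation P.star P
  have h3 : adj.unit.app P ≫ (tensorRight P).map (ev P) = (λ_ P).inv := by
    have h4 : adj.unit.app P ≫ (tensorRight P).map (ev P) =
        (ρ_ P).inv ≫ P ◁ η_ P.star P ≫ (α_ _ _ _).inv ≫ ε_ P.star P ▷ P := by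
      rw [show adj.unit.app P = (ρ_ P).inv ≫ P ◁ η_ P.star P ≫ (α_ _ _ _).inv from ?_]
      · simp only [Category.assoc]; rfl
      · simp [adj, tensorRightAdjunction, tensorRightHomEquiv, Adjunction.mkOfHomEquiv]
    rw [h4, h2]; simp
  rw [h3, Iso.inv_hom_id]

variable {P} in
-- For `x ∈ E`, the subobject `X` spanned by `P` and `x` is finite-dimensional, so `P` has a
-- complement `W` in `X`. As `W` meets `P` trivially, `E → E/W` is injective by essentiality; so `W
-- = 0` and `x` lies in `P`.
theorem IsInjectiveHull.surjective {E : LComod k A} {i : P ⟶ E} (hi : IsInjectiveHull i) :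
    Function.Surjective (lin i) := by
  have := hi.mono
  have hinj := (mono_iff i).mp inferInstance
  intro x
  let R := LinearMap.range (toD i)
  let X := R ⊔ E.gen x
  have hR : (E.sub R).FinDim := (show P.FinDim from ‹_›).of_surjective
    (lin (E.codRestrict R i fun m => ⟨m, rfl⟩)) (by rintro ⟨_, m, rfl⟩; exact ⟨m, rfl⟩)
  have hX : (E.sub X).FinDim := hR.sup (E.finDim_gen x)
  let j : P ⟶ E.sub X := E.codRestrict X i fun m => Submodule.mem_sup_left ⟨m, rfl⟩
  obtain ⟨r, hr⟩ := exists_retraction_of_finDim P hX j fun a b h =>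
    hinj (congrArg (lin (E.incl X)) h)
  have hr' : ∀ m, lin r (lin j m) = m := fun m => LinearMap.congr_fun (congrArg lin hr) m
  have hXinj : Mono (E.incl X) := mono_of_injective _ (E.incl_injective X)
  let K := LinearMap.ker (toD r)
  let W := K.map (toD (E.incl X))
  have hW : Mono (i ≫ E.proj W) := mono_of_injective _ <| by
    rw [injective_iff_map_eq_zero]
    intro m hm
    obtain ⟨y, hy, hy'⟩ := (E.proj_eq_zero W _).mp hm
    have : y = lin j m := E.incl_injective X hy'
    rw [← hr' m, ← this]
    exact hy
  have h1 := (mono_iff _).mp (hi.essential (E.proj W) hW)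
  let y : E.sub X := ⟨x, Submodule.mem_sup_right (E.self_mem_gen x)⟩
  have h2 : lin (E.incl X) (y - lin j (lin r y)) = 0 := h1 <| by
    rw [map_zero]
    refine (E.proj_eq_zero W _).mpr ⟨y - lin j (lin r y), ?_, rfl⟩
    change lin r (y - lin j (lin r y)) = 0
    rw [map_sub, hr', sub_self]
  refine ⟨lin r y, ?_⟩
  rw [map_sub, sub_eq_zero] at h2
  exact h2.symm

theorem injective_of_finDim_projective : Injective P := by
  obtain ⟨U, i, hi⟩ := exists_injectiveHull (toSelfCofree P) (toSelfCofree_injective _)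
  have := hi.mono
  exact Injective.of_iso (isoOfBijective i ⟨(mono_iff i).mp inferInstance, hi.surjective⟩).symm
    hi.injective

end FinDimProjective

/-! #### Left integrals -/

theorem isLeftIntegral_iff (l : Module.Dual k A) :
    IsLeftIntegral l ↔ ∀ a : A, l.lTensor A (Coalgebra.comul (R := k) a) = 1 ⊗ₜ l a := by
  refine forall_congr' fun a => ?_
  rw [← (TensorProduct.rid k A).injective.eq_iff (b := 1 ⊗ₜ l a), TensorProduct.rid_tmul]

/-- A functional on `A` as a linear map on the cofree comodule `A ⊗ k`. -/
theorem integral_colinear {l : Module.Dual k A} (hl : IsLeftIntegral l) (x : A ⊗[k] k) :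
    (1 : A) ⊗ₜ[k] (l ∘ₗ (TensorProduct.rid k A).toLinearMap) x =
      (l ∘ₗ (TensorProduct.rid k A).toLinearMap).lTensor A (cofreeCoact A k x) := by
  induction x with
  | zero => simp
  | add x y hx hy => simp only [map_add, TensorProduct.tmul_add, hx, hy]
  | tmul a c =>
    have h1 := cofreeCoact_flip_mk (k := k) A c a
    simp only [LinearMap.flip_apply, TensorProduct.mk_apply] at h1
    rw [h1, ← LinearMap.lTensor_comp_apply]
    have h2 : (l ∘ₗ (TensorProduct.rid k A).toLinearMap) ∘ₗ (TensorProduct.mk k A k).flip c =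
        c • l := by ext; simp
    rw [h2, LinearMap.lTensor_smul, LinearMap.smul_apply, (isLeftIntegral_iff l).mp hl,
      ← TensorProduct.tmul_smul]
    simp

/-- A left integral is a nonzero colinear map to `k` from the injective comodule `A`. -/
theorem hull_unit_of_isLeftCoFrobenius (h : IsLeftCoFrobenius k A) :
    (𝟙_ (LComod k A)).HasFinDimInjectiveHull := by
  obtain ⟨l, hl0, hl⟩ := h
  refine hull_unit_of_hom (M := cofree A k) (N := 𝟙_ (LComod k A)) finDim_unit
    (p := mkHom (M := cofree A k) (N := unit k A) (l ∘ₗ (TensorProduct.rid k A).toLinearMap)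
      (integral_colinear hl)) fun h => hl0 ?_
  ext a
  have h1 : (l ∘ₗ (TensorProduct.rid k A).toLinearMap) (a ⊗ₜ[k] (1 : k)) = 0 :=
    LinearMap.congr_fun (congrArg lin h) (a ⊗ₜ[k] (1 : k) : A ⊗[k] k)
  simpa using h1

theorem isLeftIntegral_of_cofree_hom {V : Type u} [AddCommGroup V] [Module k V]
    (φ : A ⊗[k] V →ₗ[k] k) (hφ : ∀ x, (1 : A) ⊗ₜ[k] φ x = φ.lTensor A (cofreeCoact A V x)) (v : V) :
    IsLeftIntegral (φ ∘ₗ (TensorProduct.mk k A V).flip v) := by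
  rw [isLeftIntegral_iff]
  intro a
  rw [LinearMap.lTensor_comp_apply, ← cofreeCoact_flip_mk, ← hφ]
  rfl

/-- `J = E ⊗ E*` is injective, so evaluation `J → k` extends to the cofree comodule `A ⊗ J`. The
extension is nonzero on some slice `A ⊗ v`, and its restriction there is a left integral. -/
theorem isLeftCoFrobenius_of_injective {E : LComod k A} [Module.Finite k E] [Injective E]
    (hE : E.NonZero) : IsLeftCoFrobenius k A := by
  have := injective_tensor E E.star
  set J := E ⊗ E.star
  let φ : cofree A J ⟶ 𝟙_ (LComod k A) := Injective.factorThru (𝟙 J) (toSelfCofree J) ≫ ev E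
  have hφ : toSelfCofree J ≫ φ = ev E := by
    simp only [φ]
    rw [← Category.assoc, Injective.comp_factorThru, Category.id_comp]
  obtain ⟨x, hx⟩ := ev_surjective hE (1 : k)
  let φ' : A ⊗[k] J →ₗ[k] k := lin φ
  have h1 : φ' ≠ 0 := fun h => zero_ne_one (α := k) <| by
    refine Eq.trans ?_ hx
    rw [← hφ]
    exact (LinearMap.congr_fun h (lin (toSelfCofree J) x)).symm
  have h2 : ∃ v, φ' ∘ₗ (TensorProduct.mk k A J).flip v ≠ 0 := by
    by_contra! h
    exact h1 (TensorProduct.ext' fun a v => LinearMap.congr_fun (h v) a)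
  obtain ⟨v, hv⟩ := h2
  exact ⟨_, hv, isLeftIntegral_of_cofree_hom φ' (fun x => lin_colinear φ x) v⟩

/-! #### The equivalences -/

theorem exists_injective_of_hull_unit (h : (𝟙_ (LComod k A)).HasFinDimInjectiveHull) :
    ∃ M : LComod k A, M.NonZero ∧ Injective M ∧ M.FinDim := by
  obtain ⟨E, i, hi, hE⟩ := h
  have := hi.mono
  exact ⟨E, nonZero_of_injective nonZero_unit i ((mono_iff i).mp inferInstance), hi.injective, hE⟩

theorem exists_injective_of_projective {P : LComod k A} (hP : P.NonZero) (h : Projective P) :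
    ∃ M : LComod k A, M.NonZero ∧ Injective M ∧ M.FinDim := by
  obtain ⟨P', h1, h2, h3⟩ := exists_finDim_projective_of_projective hP
  have : Module.Finite k P' := h1
  exact ⟨P', h3, injective_of_finDim_projective P', h1⟩

theorem nonZero_cofree : (cofree (k := k) A k).NonZero :=
  nonZero_of_injective nonZero_unit (toSelfCofree (𝟙_ (LComod k A))) (toSelfCofree_injective _)

-- A nonzero finite-dimensional injective object is the hub of the equivalences: it gives the
-- integral, the quotients and the projective covers. The return from projectivity goes through the
-- fact that finite-dimensional projectives are injective.
variable (k A) in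
theorem tfae_isLeftCoFrobenius : List.TFAE [
    IsLeftCoFrobenius k A,
    ∀ S : LComod k A, Simple S → S.HasFinDimInjectiveHull,
    (𝟙_ (LComod k A)).HasFinDimInjectiveHull,
    ∃ M : LComod k A, M.NonZero ∧ Injective M ∧ M.FinDim,
    ∀ M : LComod k A, M.NonZero → M.HasFinDimQuotient,
    ∀ M : LComod k A, M.NonZero → Injective M → M.HasFinDimQuotient,
    ∃ M : LComod k A, M.NonZero ∧ Injective M ∧ M.HasFinDimQuotient,
    ∃ P : LComod k A, P.NonZero ∧ Projective P,
    ∀ M : LComod k A, M.HasProjectiveCover,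
    ∀ M : LComod k A, Injective M → Projective M] := by
  tfae_have 1 → 3 := hull_unit_of_isLeftCoFrobenius
  tfae_have 4 → 1 := fun ⟨M, h1, h2, h3⟩ =>
    have : Module.Finite k M := h3
    isLeftCoFrobenius_of_injective h1
  tfae_have 3 → 2 := fun h S hS => hull_of_hull_unit h (finDim_of_simple hS)
  tfae_have 2 → 3 := fun h => h _ simple_unit
  tfae_have 3 → 4 := exists_injective_of_hull_unit
  tfae_have 4 → 5 := fun ⟨E, h1, h2, h3⟩ M hM =>
    have : Module.Finite k E := h3
    hasFinDimQuotient_of_injective h1 hM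
  tfae_have 5 → 6 := fun h M hM _ => h M hM
  tfae_have 6 → 7 := fun h => ⟨_, nonZero_cofree, inferInstance, h _ nonZero_cofree inferInstance⟩
  tfae_have 7 → 3 := fun ⟨M, _, h2, h3⟩ => hull_unit_of_quotient h3
  tfae_have 4 → 9 := fun ⟨E, h1, h2, h3⟩ M =>
    have : Module.Finite k E := h3
    hasProjectiveCover_of_injective h1 M
  tfae_have 9 → 8 := fun h => by
    obtain ⟨P, p, hp⟩ := h (𝟙_ (LComod k A))
    have := hp.epi
    exact ⟨P, nonZero_of_surjective nonZero_unit p ((epi_iff p).mp inferInstance), hp.projective⟩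
  tfae_have 3 → 10 := fun h M _ => projective_of_injective h M
  tfae_have 10 → 8 := fun h => ⟨_, nonZero_cofree, h _ inferInstance⟩
  tfae_have 8 → 4 := fun ⟨_, h1, h2⟩ => exists_injective_of_projective h1 h2
  tfae_finish

end LComod

end

end BraidedCoFrob

namespace BraidedCoFrob
noncomputable section
open MonoidalCategory HopfAlgebra

/-! ### The opposite co-opposite Hopf algebra -/

/-- The Hopf algebra `A` with opposite multiplication and comultiplication. -/
def OpCop (A : Type u) : Type u := Aᵐᵒᵖ

namespace OpCop

variable {k A : Type u} [Field k] [Ring A]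

instance : Ring (OpCop A) := inferInstanceAs (Ring Aᵐᵒᵖ)

section

variable [Algebra k A]

instance : Algebra k (OpCop A) := inferInstanceAs (Algebra k Aᵐᵒᵖ)

variable (k A) in
/-- The identity map as an anti-isomorphism. -/
def op : A ≃ₗ[k] OpCop A := MulOpposite.opLinearEquiv k

theorem op_mul (a b : A) : op k A (a * b) = op k A b * op k A a := rfl

theorem op_one : op k A 1 = 1 := rfl

end

variable [HopfAlgebra k A]

instance : CoalgebraStruct k (OpCop A) where
  comul := TensorProduct.map (op k A).toLinearMap (op k A).toLinearMap ∘ₗ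
    (TensorProduct.comm k A A).toLinearMap ∘ₗ Coalgebra.comul ∘ₗ (op k A).symm.toLinearMap
  counit := Coalgebra.counit ∘ₗ (op k A).symm.toLinearMap

theorem comul_op (a : A) : CoalgebraStruct.comul (R := k) (op k A a) =
    TensorProduct.map (op k A).toLinearMap (op k A).toLinearMap
      (TensorProduct.comm k A A (Coalgebra.comul (R := k) a)) := by
  simp [CoalgebraStruct.comul]

theorem counit_op (a : A) : CoalgebraStruct.counit (R := k) (op k A a) =
    Coalgebra.counit (R := k) a := by
  simp [CoalgebraStruct.counit]

/-- The map `x ⊗ (y ⊗ z) ↦ z ⊗ (y ⊗ x)`. -/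
def rev : A ⊗[k] (A ⊗[k] A) →ₗ[k] OpCop A ⊗[k] (OpCop A ⊗[k] OpCop A) :=
  (TensorProduct.assoc k _ _ _).toLinearMap ∘ₗ
    TensorProduct.map (TensorProduct.map (op k A).toLinearMap (op k A).toLinearMap ∘ₗ
      (TensorProduct.comm k A A).toLinearMap) (op k A).toLinearMap ∘ₗ
    (TensorProduct.comm k A (A ⊗[k] A)).toLinearMap

theorem assoc_comul_op (d : A ⊗[k] A) :
    TensorProduct.assoc k _ _ _ (CoalgebraStruct.comul.rTensor (OpCop A)
      (TensorProduct.map (op k A).toLinearMap (op k A).toLinearMap (TensorProduct.comm k A A d))) =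
      rev (Coalgebra.comul.lTensor A d) := by
  induction d with
  | zero => simp
  | add x y hx hy => simp only [map_add, hx, hy]
  | tmul p q =>
    simp only [TensorProduct.comm_tmul, TensorProduct.map_tmul, LinearEquiv.coe_coe,
      LinearMap.rTensor_tmul, LinearMap.lTensor_tmul, comul_op]
    generalize Coalgebra.comul (R := k) q = e
    induction e with
    | zero => simp
    | add x y hx hy => simp only [map_add, TensorProduct.add_tmul, TensorProduct.tmul_add, hx, hy]
    | tmul x y => simp [rev]

theorem lTensor_comul_op (d : A ⊗[k] A) :
    CoalgebraStruct.comul.lTensor (OpCop A)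
      (TensorProduct.map (op k A).toLinearMap (op k A).toLinearMap (TensorProduct.comm k A A d)) =
      rev (TensorProduct.assoc k A A A (Coalgebra.comul.rTensor A d)) := by
  induction d with
  | zero => simp
  | add x y hx hy => simp only [map_add, hx, hy]
  | tmul p q =>
    simp only [TensorProduct.comm_tmul, TensorProduct.map_tmul, LinearEquiv.coe_coe,
      LinearMap.rTensor_tmul, LinearMap.lTensor_tmul, comul_op]
    generalize Coalgebra.comul (R := k) p = e
    induction e with
    | zero => simp
    | add x y hx hy => simp only [map_add, TensorProduct.add_tmul, TensorProduct.tmul_add, hx, hy]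
    | tmul x y => simp [rev]

theorem rTensor_counit_op (d : A ⊗[k] A) :
    CoalgebraStruct.counit.rTensor (OpCop A)
      (TensorProduct.map (op k A).toLinearMap (op k A).toLinearMap (TensorProduct.comm k A A d)) =
      TensorProduct.map LinearMap.id (op k A).toLinearMap
        (TensorProduct.comm k A k (Coalgebra.counit.lTensor A d)) := by
  induction d with
  | zero => simp
  | add x y hx hy => simp only [map_add, hx, hy]
  | tmul p q => simp [counit_op]

theorem lTensor_counit_op (d : A ⊗[k] A) :
    CoalgebraStruct.counit.lTensor (OpCop A)
      (TensorProduct.map (op k A).toLinearMap (op k A).toLinearMap (TensorProduct.comm k A A d)) =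
      TensorProduct.map (op k A).toLinearMap LinearMap.id
        (TensorProduct.comm k k A (Coalgebra.counit.rTensor A d)) := by
  induction d with
  | zero => simp
  | add x y hx hy => simp only [map_add, hx, hy]
  | tmul p q => simp [counit_op]

instance : Coalgebra k (OpCop A) where
  coassoc := by
    ext x
    obtain ⟨a, rfl⟩ := (op k A).surjective x
    simp only [LinearMap.comp_apply, LinearEquiv.coe_coe, comul_op]
    rw [assoc_comul_op, lTensor_comul_op, Coalgebra.coassoc_apply]
  rTensor_counit_comp_comul := by
    ext x
    obtain ⟨a, rfl⟩ := (op k A).surjective x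
    simp only [LinearMap.comp_apply, comul_op]
    rw [rTensor_counit_op, Coalgebra.lTensor_counit_comul]
    simp
  lTensor_counit_comp_comul := by
    ext x
    obtain ⟨a, rfl⟩ := (op k A).surjective x
    simp only [LinearMap.comp_apply, comul_op]
    rw [lTensor_counit_op, Coalgebra.rTensor_counit_comul]
    simp

theorem map_op_comm_mul (d e : A ⊗[k] A) :
    TensorProduct.map (op k A).toLinearMap (op k A).toLinearMap (TensorProduct.comm k A A (d * e)) =
      TensorProduct.map (op k A).toLinearMap (op k A).toLinearMap (TensorProduct.comm k A A e) *
      TensorProduct.map (op k A).toLinearMap (op k A).toLinearMap (TensorProduct.comm k A A d) := by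
  induction d with
  | zero => simp
  | add x y hx hy => simp only [map_add, add_mul, mul_add, hx, hy]
  | tmul p q =>
    induction e with
    | zero => simp
    | add x y hx hy => simp only [map_add, add_mul, mul_add, hx, hy]
    | tmul x y => simp [op_mul]

instance : Bialgebra k (OpCop A) := Bialgebra.mk' k (OpCop A)
  (by rw [← op_one (k := k), counit_op, Bialgebra.counit_one])
  (fun {x y} => by
    obtain ⟨a, rfl⟩ := (op k A).surjective x
    obtain ⟨b, rfl⟩ := (op k A).surjective y
    rw [← op_mul, counit_op, counit_op, counit_op, Bialgebra.counit_mul, mul_comm])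
  (by
    rw [← op_one (k := k), comul_op, Bialgebra.comul_one, Algebra.TensorProduct.one_def]
    rfl)
  (fun {x y} => by
    obtain ⟨a, rfl⟩ := (op k A).surjective x
    obtain ⟨b, rfl⟩ := (op k A).surjective y
    rw [← op_mul, comul_op, comul_op, comul_op, Bialgebra.comul_mul, map_op_comm_mul])

/-- The antipode. -/
def antipodeLin : OpCop A →ₗ[k] OpCop A :=
  (op k A).toLinearMap ∘ₗ antipode k ∘ₗ (op k A).symm.toLinearMap

instance : HopfAlgebra k (OpCop A) where
  antipode := antipodeLin
  mul_antipode_rTensor_comul := by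
    ext x
    obtain ⟨a, rfl⟩ := (op k A).surjective x
    have h : ∀ d : A ⊗[k] A, LinearMap.mul' k (OpCop A) (antipodeLin.rTensor (OpCop A)
        (TensorProduct.map (op k A).toLinearMap (op k A).toLinearMap
          (TensorProduct.comm k A A d))) =
        op k A (LinearMap.mul' k A ((antipode k).lTensor A d)) := by
      intro d
      induction d with
      | zero => simp
      | add x y hx hy => simp only [map_add, hx, hy]
      | tmul p q => simp [antipodeLin, op_mul]
    change LinearMap.mul' k (OpCop A) (antipodeLin.rTensor (OpCop A)
      (CoalgebraStruct.comul (R := k) (op k A a))) =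
      algebraMap k (OpCop A) (CoalgebraStruct.counit (R := k) (op k A a))
    rw [comul_op, counit_op, h, mul_antipode_lTensor_comul_apply]
    rfl
  mul_antipode_lTensor_comul := by
    ext x
    obtain ⟨a, rfl⟩ := (op k A).surjective x
    have h : ∀ d : A ⊗[k] A, LinearMap.mul' k (OpCop A) (antipodeLin.lTensor (OpCop A)
        (TensorProduct.map (op k A).toLinearMap (op k A).toLinearMap
          (TensorProduct.comm k A A d))) =
        op k A (LinearMap.mul' k A ((antipode k).rTensor A d)) := by
      intro d
      induction d with
      | zero => simp
      | add x y hx hy => simp only [map_add, hx, hy]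
      | tmul p q => simp [antipodeLin, op_mul]
    change LinearMap.mul' k (OpCop A) (antipodeLin.lTensor (OpCop A)
      (CoalgebraStruct.comul (R := k) (op k A a))) =
      algebraMap k (OpCop A) (CoalgebraStruct.counit (R := k) (op k A a))
    rw [comul_op, counit_op, h, mul_antipode_rTensor_comul_apply]
    rfl

theorem isAntiCoalgHom_op : IsAntiCoalgHom (op k A).toLinearMap where
  comul := comul_op
  counit := counit_op

theorem isAntiCoalgHom_op_symm : IsAntiCoalgHom (op k A).symm.toLinearMap where
  comul x := by
    obtain ⟨a, rfl⟩ := (op k A).surjective x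
    have h : ∀ d : A ⊗[k] A, TensorProduct.map (op k A).symm.toLinearMap (op k A).symm.toLinearMap
        (TensorProduct.comm k _ _ (TensorProduct.map (op k A).toLinearMap (op k A).toLinearMap
          (TensorProduct.comm k A A d))) = d := by
      intro d
      induction d with
      | zero => simp
      | add x y hx hy => simp only [map_add, hx, hy]
      | tmul p q => simp
    rw [comul_op, h]
    simp
  counit x := by
    obtain ⟨a, rfl⟩ := (op k A).surjective x
    rw [counit_op]
    simp

/-- Reversing the comultiplication exchanges the two kinds of integral; this is the reason for
introducing `OpCop`. -/
theorem isLeftIntegral_comp_symm_iff (l : Module.Dual k A) :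
    IsLeftIntegral (l ∘ₗ (op k A).symm.toLinearMap) ↔ IsRightIntegral l := by
  have h : ∀ d : A ⊗[k] A, TensorProduct.rid k (OpCop A) ((l ∘ₗ (op k A).symm.toLinearMap).lTensor
      (OpCop A) (TensorProduct.map (op k A).toLinearMap (op k A).toLinearMap
          (TensorProduct.comm k A A d))) = op k A (TensorProduct.lid k A (l.rTensor A d)) := by
    intro d
    induction d with
    | zero => simp
    | add x y hx hy => simp only [map_add, hx, hy]
    | tmul p q => simp
  refine (op k A).surjective.forall.trans (forall_congr' fun a => ?_)
  have h1 := h (Coalgebra.comul (R := k) a)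
  rw [← comul_op] at h1
  rw [show Coalgebra.comul (R := k) (op k A a) = CoalgebraStruct.comul (R := k) (op k A a) from rfl,
    h1, ← op_one (k := k), ← map_smul, (op k A).injective.eq_iff]
  simp

variable (k A) in
theorem isLeftCoFrobenius_iff : IsLeftCoFrobenius k (OpCop A) ↔ IsRightCoFrobenius k A := by
  constructor
  · rintro ⟨l, h0, hl⟩
    refine ⟨l ∘ₗ (op k A).toLinearMap, fun h => h0 ?_, ?_⟩
    · ext x
      obtain ⟨a, rfl⟩ := (op k A).surjective x
      exact LinearMap.congr_fun h a
    · rw [← isLeftIntegral_comp_symm_iff]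
      convert hl
      ext; simp
  · rintro ⟨l, h0, hl⟩
    refine ⟨_, fun h => h0 ?_, (isLeftIntegral_comp_symm_iff l).mpr hl⟩
    ext a
    simpa using LinearMap.congr_fun h (op k A a)

end OpCop

variable (k A : Type u) [Field k] [Ring A] [HopfAlgebra k A]

/-- The dual of a nonzero finite-dimensional injective `A`-comodule is a nonzero projective `OpCop
A`-comodule, and the equivalences for `OpCop A` turn this into a left integral there, that is a
right integral on `A`. The converse is symmetric. -/
theorem isLeftCoFrobenius_iff_isRightCoFrobenius :
    IsLeftCoFrobenius k A ↔ IsRightCoFrobenius k A := by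
  rw [← OpCop.isLeftCoFrobenius_iff]
  constructor
  · intro h
    obtain ⟨E, h1, h2, h3⟩ := ((LComod.tfae_isLeftCoFrobenius k A).out 0 3).mp h
    have : Module.Finite k E := h3
    have hP : ∃ P : LComod k (OpCop A), P.NonZero ∧ Projective P :=
      ⟨_, E.nonZero_dual _ OpCop.isAntiCoalgHom_op h1,
        E.projective_dual _ OpCop.isAntiCoalgHom_op _ OpCop.isAntiCoalgHom_op_symm
          (by ext; simp) (by ext; simp)⟩
    exact ((LComod.tfae_isLeftCoFrobenius k (OpCop A)).out 0 7).mpr hP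
  · intro h
    obtain ⟨E, h1, h2, h3⟩ := ((LComod.tfae_isLeftCoFrobenius k (OpCop A)).out 0 3).mp h
    have : Module.Finite k E := h3
    have hP : ∃ P : LComod k A, P.NonZero ∧ Projective P :=
      ⟨_, E.nonZero_dual _ OpCop.isAntiCoalgHom_op_symm h1,
        E.projective_dual _ OpCop.isAntiCoalgHom_op_symm _ OpCop.isAntiCoalgHom_op
          (by ext; simp) (by ext; simp)⟩
    exact ((LComod.tfae_isLeftCoFrobenius k A).out 0 7).mpr hP

end

end BraidedCoFrob

namespace BraidedCoFrob
noncomputable section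
open HopfAlgebra

/-! ### Convolution of linear maps -/

section Conv

variable {k C T T' : Type u} [Field k] [AddCommGroup C] [Module k C] [Coalgebra k C]
  [Ring T] [Algebra k T] [Ring T'] [Algebra k T']

/-- The convolution `c ↦ f(c₍₁₎) g(c₍₂₎)`. -/
def conv (f g : C →ₗ[k] T) : C →ₗ[k] T :=
  LinearMap.mul' k T ∘ₗ TensorProduct.map f g ∘ₗ Coalgebra.comul

theorem conv_apply (f g : C →ₗ[k] T) (c : C) :
    conv f g c = LinearMap.mul' k T (TensorProduct.map f g (Coalgebra.comul (R := k) c)) := rfl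

theorem conv_assoc (f g h : C →ₗ[k] T) : conv (conv f g) h = conv f (conv g h) := by
  open scoped RingTheory.LinearMap in
  exact congrArg WithConv.ofConv (mul_assoc (WithConv.toConv f) (WithConv.toConv g)
    (WithConv.toConv h))

theorem mulRight_comp_conv (f g : C →ₗ[k] T) (t : T) :
    LinearMap.mulRight k t ∘ₗ conv f g = conv f (LinearMap.mulRight k t ∘ₗ g) := by
  ext c
  simp only [conv_apply, LinearMap.comp_apply]
  generalize Coalgebra.comul (R := k) c = d
  induction d with
  | zero => simp
  | add x y hx hy => simp only [map_add, hx, hy]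
  | tmul a b => simp [mul_assoc]

/-- A constant between two convolution factors may be attached to either one. Such rules serve as a
Sweedler calculus for maps into an algebra. -/
theorem conv_mulLeft (f g : C →ₗ[k] T) (t : T) :
    conv f (LinearMap.mulLeft k t ∘ₗ g) = conv (LinearMap.mulRight k t ∘ₗ f) g := by
  ext c
  simp only [conv_apply]
  generalize Coalgebra.comul (R := k) c = d
  induction d with
  | zero => simp
  | add x y hx hy => simp only [map_add, hx, hy]
  | tmul a b => simp [mul_assoc]

theorem algHom_conv (F : T →ₐ[k] T') (f g : C →ₗ[k] T) :
    F.toLinearMap ∘ₗ conv f g = conv (F.toLinearMap ∘ₗ f) (F.toLinearMap ∘ₗ g) := by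
  ext c
  simp only [conv_apply, LinearMap.comp_apply]
  generalize Coalgebra.comul (R := k) c = d
  induction d with
  | zero => simp
  | add x y hx hy => simp only [map_add, hx, hy]
  | tmul a b => simp

theorem conv_of_counit_left (g : C →ₗ[k] T) :
    conv (Algebra.linearMap k T ∘ₗ Coalgebra.counit) g = g := by
  open scoped RingTheory.LinearMap in
  exact congrArg WithConv.ofConv (one_mul (WithConv.toConv g))

theorem conv_of_counit_right (g : C →ₗ[k] T) :
    conv g (Algebra.linearMap k T ∘ₗ Coalgebra.counit) = g := by
  open scoped RingTheory.LinearMap in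
  exact congrArg WithConv.ofConv (mul_one (WithConv.toConv g))

end Conv

/-! ### The smash product -/

section Smash

variable {k H R T : Type u} [Field k] [Ring H] [HopfAlgebra k H]
  [Ring R] [Algebra k R] [Coalgebra k R] [Ring T] [Algebra k T]

namespace BraidedHopfAlgebra

variable (B : BraidedHopfAlgebra k H R)

/-- The map `h ↦ h · s`. -/
def actOn (s : R) : H →ₗ[k] R := B.act.toLinearMap.flip s

@[simp] theorem actOn_apply (s : R) (h : H) : B.actOn s h = B.act h s := rfl

/-- `ψ(h) φ(s) = φ(h₍₁₎ · s) ψ(h₍₂₎)`. -/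
def Compat (φ : R →ₗ[k] T) (ψ : H →ₗ[k] T) : Prop :=
  ∀ s, LinearMap.mulRight k (φ s) ∘ₗ ψ = conv (φ ∘ₗ B.actOn s) ψ

theorem endTensorEndAlgHom_tmul {V W : Type u} [AddCommGroup V] [Module k V] [AddCommGroup W]
    [Module k W] (f : Module.End k V) (g : Module.End k W) (v : V) (w : W) :
    Module.endTensorEndAlgHom (R := k) (S := k) (A := k) (f ⊗ₜ[k] g) (v ⊗ₜ w) = f v ⊗ₜ g w := rfl

/-- Left multiplication on the first factor of `R ⊗ H`. -/
def leftMul : R →ₐ[k] Module.End k (R ⊗[k] H) :=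
  ((Module.endTensorEndAlgHom (R := k) (S := k) (A := k) (M := R) (N := H)).comp
    Algebra.TensorProduct.includeLeft).comp (Algebra.lmul k R)

theorem leftMul_apply (r s : R) (h : H) :
    leftMul (k := k) (H := H) r (s ⊗ₜ h) = (r * s) ⊗ₜ h := by
  simp [leftMul, endTensorEndAlgHom_tmul]

/-- The action of `H` on the first factor of `R ⊗ H`. -/
def firstAct : H →ₗ[k] Module.End k (R ⊗[k] H) :=
  LinearMap.rTensorHom H ∘ₗ B.act.toLinearMap

/-- Left multiplication on the second factor of `R ⊗ H`. -/
def secondMul : H →ₗ[k] Module.End k (R ⊗[k] H) :=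
  LinearMap.lTensorHom R ∘ₗ LinearMap.mul k H

/-- The diagonal action of `H` on `R ⊗ H`. -/
def diagAct : H →ₐ[k] Module.End k (R ⊗[k] H) :=
  ((Module.endTensorEndAlgHom (R := k) (S := k) (A := k) (M := R) (N := H)).comp
    (Algebra.TensorProduct.map B.act (Algebra.lmul k H))).comp (Bialgebra.comulAlgHom k H)

theorem diagAct_eq : B.diagAct.toLinearMap = conv B.firstAct secondMul := by
  ext h : 1
  change Module.endTensorEndAlgHom (Algebra.TensorProduct.map B.act (Algebra.lmul k H)
    (Coalgebra.comul (R := k) h)) = conv B.firstAct secondMul h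
  rw [conv_apply]
  generalize Coalgebra.comul (R := k) h = d
  induction d with
  | zero => simp
  | add x y hx hy => simp only [map_add, hx, hy]
  | tmul a b => ext; simp [firstAct, secondMul, endTensorEndAlgHom_tmul]

theorem diagAct_tmul (h : H) (s : R) (g : H) : B.diagAct h (s ⊗ₜ g) =
    TensorProduct.map (B.actOn s) (LinearMap.mulRight k g) (Coalgebra.comul (R := k) h) := by
  change Module.endTensorEndAlgHom (Algebra.TensorProduct.map B.act (Algebra.lmul k H)
    (Coalgebra.comul (R := k) h)) (s ⊗ₜ g) = _
  generalize Coalgebra.comul (R := k) h = d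
  induction d with
  | zero => simp
  | add x y hx hy => simp only [map_add, LinearMap.add_apply, hx, hy]
  | tmul a b => simp [endTensorEndAlgHom_tmul]

theorem act_mul_apply (h : H) (s r : R) : B.act h (s * r) =
    LinearMap.mul' k R (TensorProduct.map (B.actOn s) (B.actOn r) (Coalgebra.comul (R := k) h)) := by
  have := B.act_mul h (s ⊗ₜ r)
  rw [LinearMap.mul'_apply] at this
  rw [this]
  congr 1
  simp only [tensorAct, LinearMap.comp_apply]
  generalize Coalgebra.comul (R := k) h = d
  induction d with
  | zero => simp
  | add x y hx hy => simp only [map_add, LinearMap.add_apply, hx, hy]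
  | tmul a b => simp

/-- The diagonal action is the convolution of the action on `R` with multiplication on `H`. The
latter commutes with left multiplication by `R`; the former satisfies the commutation rule because
`R` is a module algebra. -/
theorem compat_diagAct : B.Compat leftMul.toLinearMap B.diagAct.toLinearMap := by
  intro s
  have h1 : LinearMap.mulRight k (leftMul (k := k) (H := H) s) ∘ₗ B.firstAct =
      conv (leftMul.toLinearMap ∘ₗ B.actOn s) B.firstAct := by
    ext h r g
    simp only [LinearMap.comp_apply, conv_apply, LinearMap.mulRight_apply, Module.End.mul_apply,
      TensorProduct.AlgebraTensorModule.curry_apply, TensorProduct.curry_apply,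
      LinearMap.restrictScalars_self, leftMul_apply]
    simp only [firstAct, LinearMap.comp_apply, LinearMap.coe_rTensorHom, LinearMap.rTensor_tmul,
      AlgHom.toLinearMap_apply, act_mul_apply]
    generalize Coalgebra.comul (R := k) h = d
    induction d with
    | zero => simp
    | add x y hx hy => simp only [map_add, TensorProduct.add_tmul, LinearMap.add_apply, hx, hy]
    | tmul a b => simp [leftMul_apply]
  have h2 : LinearMap.mulRight k (leftMul (k := k) (H := H) s) ∘ₗ secondMul =
      LinearMap.mulLeft k (leftMul (k := k) (H := H) s) ∘ₗ secondMul := by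
    ext h r g
    simp [secondMul, leftMul_apply]
  rw [diagAct_eq, AlgHom.toLinearMap_apply, mulRight_comp_conv, h2, conv_mulLeft, h1, conv_assoc]

/-- The underlying space of the bosonization `R # H`. -/
def Bos (_ : BraidedHopfAlgebra k H R) : Type u := R ⊗[k] H

namespace Bos

instance : AddCommGroup B.Bos := inferInstanceAs (AddCommGroup (R ⊗[k] H))

instance : Module k B.Bos := inferInstanceAs (Module k (R ⊗[k] H))

/-- The identity map `R ⊗ H → R # H`. -/
def of : R ⊗[k] H ≃ₗ[k] B.Bos := LinearEquiv.refl k _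

/-- The regular representation of `R # H` on `R ⊗ H`. -/
def reg : B.Bos →ₗ[k] Module.End k (R ⊗[k] H) :=
  LinearMap.mul' k _ ∘ₗ TensorProduct.map leftMul.toLinearMap B.diagAct.toLinearMap ∘ₗ
    (of B).symm.toLinearMap

theorem reg_of (r : R) (h : H) : reg B (of B (r ⊗ₜ h)) = leftMul r * B.diagAct h := by
  simp [reg]

/-- The linear map `r # h ↦ φ(r) ψ(h)`. -/
def liftLin (φ : R →ₗ[k] T) (ψ : H →ₗ[k] T) : B.Bos →ₗ[k] T :=
  LinearMap.mul' k T ∘ₗ TensorProduct.map φ ψ ∘ₗ (of B).symm.toLinearMap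

theorem liftLin_of (φ : R →ₗ[k] T) (ψ : H →ₗ[k] T) (r : R) (h : H) :
    liftLin B φ ψ (of B (r ⊗ₜ h)) = φ r * ψ h := by
  simp [liftLin]

-- The smash product is built from this single statement: the linear extension of a compatible pair
-- intertwines the regular representation. Applied to the pair acting on `R ⊗ H` it yields
-- associativity; for general targets it yields the universal property.
variable {B} in
theorem liftLin_reg {φ : R →ₐ[k] T} {ψ : H →ₐ[k] T} (hc : B.Compat φ.toLinearMap ψ.toLinearMap)
    (a : B.Bos) (x : R ⊗[k] H) :
    liftLin B φ.toLinearMap ψ.toLinearMap (of B (reg B a x)) =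
      liftLin B φ.toLinearMap ψ.toLinearMap a *
        liftLin B φ.toLinearMap ψ.toLinearMap (of B x) := by
  obtain ⟨a, rfl⟩ := (of B).surjective a
  induction a with
  | zero => simp
  | add x y hx hy => simp only [map_add, LinearMap.add_apply, add_mul, hx, hy]
  | tmul r h =>
    have h1 : ∀ y, liftLin B φ.toLinearMap ψ.toLinearMap (of B (leftMul r y)) =
        φ r * liftLin B φ.toLinearMap ψ.toLinearMap (of B y) := by
      intro y
      induction y with
      | zero => simp
      | add x y hx hy => simp only [map_add, mul_add, hx, hy]
      | tmul s g => simp [leftMul_apply, liftLin_of, mul_assoc]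
    rw [reg_of, Module.End.mul_apply, h1, liftLin_of, AlgHom.toLinearMap_apply, mul_assoc]
    congr 1
    induction x with
    | zero => simp
    | add x y hx hy => simp only [map_add, mul_add, hx, hy]
    | tmul s g =>
      have h2 := LinearMap.congr_fun (hc s) h
      simp only [LinearMap.comp_apply, LinearMap.mulRight_apply, AlgHom.toLinearMap_apply] at h2
      rw [diagAct_tmul, liftLin_of, AlgHom.toLinearMap_apply, AlgHom.toLinearMap_apply,
        ← mul_assoc, h2, conv_apply]
      generalize Coalgebra.comul (R := k) h = d
      induction d with
      | zero => simp
      | add x y hx hy => simp only [map_add, add_mul, hx, hy]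
      | tmul a b => simp [liftLin_of, mul_assoc]

theorem reg_reg (a : B.Bos) (x : R ⊗[k] H) :
    reg B (of B (reg B a x)) = reg B a * reg B (of B x) :=
  liftLin_reg B.compat_diagAct a x

theorem reg_one : reg B (of B (1 ⊗ₜ 1)) = 1 := by
  rw [reg_of, map_one, map_one, one_mul]

/-- Evaluation at `1 ⊗ 1` recovers an element from its regular representation. The product of the
bosonization is defined through this representation, and this gives the right unit law. -/
theorem reg_apply_one (a : B.Bos) : of B (reg B a (1 ⊗ₜ 1)) = a := by
  obtain ⟨a, rfl⟩ := (of B).surjective a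
  induction a with
  | zero => simp
  | add x y hx hy => simp only [map_add, LinearMap.add_apply, hx, hy]
  | tmul r h =>
    congr 1
    rw [reg_of, Module.End.mul_apply, diagAct_tmul]
    have h1 : B.actOn 1 = Algebra.linearMap k R ∘ₗ Coalgebra.counit := by
      ext h; simp [B.act_one, Algebra.algebraMap_eq_smul_one]
    have h2 : LinearMap.mulRight k (1 : H) = LinearMap.id := by ext; simp
    have h3 : TensorProduct.map (Algebra.linearMap k R ∘ₗ Coalgebra.counit) LinearMap.id
        (Coalgebra.comul (R := k) h) = (Algebra.linearMap k R).rTensor H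
          (Coalgebra.counit.rTensor H (Coalgebra.comul (R := k) h)) := by
      rw [← LinearMap.rTensor_comp_apply]; rfl
    rw [h1, h2, h3, Coalgebra.rTensor_counit_comul]
    simp [leftMul_apply]

instance : Mul B.Bos := ⟨fun a b => of B (reg B a ((of B).symm b))⟩

theorem mul_def (a b : B.Bos) : a * b = of B (reg B a ((of B).symm b)) := rfl

instance : One B.Bos := ⟨of B (1 ⊗ₜ 1)⟩

theorem one_def : (1 : B.Bos) = of B (1 ⊗ₜ 1) := rfl

theorem bos_one_mul (a : B.Bos) : 1 * a = a := by
  rw [mul_def, one_def, reg_one]; simp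

theorem bos_mul_one (a : B.Bos) : a * 1 = a := by
  rw [mul_def, one_def, LinearEquiv.symm_apply_apply, reg_apply_one]

theorem bos_mul_assoc (a b c : B.Bos) : a * b * c = a * (b * c) := by
  simp only [mul_def, LinearEquiv.symm_apply_apply]
  rw [reg_reg, LinearEquiv.apply_symm_apply, Module.End.mul_apply]

instance : Ring B.Bos where
  __ := (inferInstance : AddCommGroup B.Bos)
  one := 1
  mul := (· * ·)
  left_distrib a b c := by simp only [mul_def, map_add]
  right_distrib a b c := by simp only [mul_def, map_add, LinearMap.add_apply]
  zero_mul a := by simp only [mul_def, map_zero, LinearMap.zero_apply]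
  mul_zero a := by simp only [mul_def, map_zero]
  one_mul := bos_one_mul B
  mul_one := bos_mul_one B
  mul_assoc := bos_mul_assoc B

instance : Algebra k B.Bos := Algebra.ofModule
  (fun c a b => by simp only [mul_def, map_smul, LinearMap.smul_apply])
  (fun c a b => by simp only [mul_def, map_smul])

/-- The inclusion of `R`. -/
def inR : R →ₐ[k] B.Bos := AlgHom.ofLinearMap
  ((of B).toLinearMap ∘ₗ (TensorProduct.mk k R H).flip 1) rfl
  (fun r s => by simp [mul_def, reg_of, leftMul_apply])

/-- The inclusion of `H`. -/
def inH : H →ₐ[k] B.Bos := AlgHom.ofLinearMap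
  ((of B).toLinearMap ∘ₗ TensorProduct.mk k R H 1) rfl
  (fun h g => by
    have h1 := congrArg (fun f : Module.End k (R ⊗[k] H) => of B (f (1 ⊗ₜ 1)))
      (map_mul B.diagAct h g)
    have h2 : ∀ h, B.diagAct h = reg B (of B (1 ⊗ₜ h)) := fun h => by
      rw [reg_of, map_one, one_mul]
    simp only [Module.End.mul_apply] at h1
    rw [h2, h2, h2, reg_apply_one] at h1
    simp only [LinearMap.comp_apply, TensorProduct.mk_apply, LinearEquiv.coe_coe]
    rw [h1, mul_def]
    congr 2
    rw [LinearEquiv.eq_symm_apply, reg_apply_one])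

theorem inR_mul_inH (r : R) (h : H) : inR B r * inH B h = of B (r ⊗ₜ h) := by
  change of B (reg B (of B (r ⊗ₜ 1)) (1 ⊗ₜ h)) = _
  rw [reg_of, map_one, mul_one, leftMul_apply, mul_one]

theorem compat_in : B.Compat (inR B).toLinearMap (inH B).toLinearMap := by
  intro s
  ext h
  simp only [LinearMap.comp_apply, LinearMap.mulRight_apply, AlgHom.toLinearMap_apply, conv_apply]
  have h1 : inH B h * inR B s = of B (B.diagAct h (s ⊗ₜ 1)) := by
    change of B (reg B (of B (1 ⊗ₜ h)) (s ⊗ₜ 1)) = _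
    rw [reg_of, map_one, one_mul]
  rw [h1, diagAct_tmul]
  generalize Coalgebra.comul (R := k) h = d
  induction d with
  | zero => simp
  | add x y hx hy => simp only [map_add, hx, hy]
  | tmul a b => simp [inR_mul_inH]

@[elab_as_elim]
theorem induction {p : B.Bos → Prop} (a : B.Bos) (zero : p 0)
    (mul : ∀ r h, p (inR B r * inH B h)) (add : ∀ a b, p a → p b → p (a + b)) : p a := by
  obtain ⟨a, rfl⟩ := (of B).surjective a
  induction a with
  | zero => rw [map_zero]; exact zero
  | add x y hx hy => rw [map_add]; exact add _ _ hx hy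
  | tmul r h => rw [← inR_mul_inH]; exact mul r h

variable {B} in
/-- The universal property of the smash product. -/
def lift (φ : R →ₐ[k] T) (ψ : H →ₐ[k] T) (hc : B.Compat φ.toLinearMap ψ.toLinearMap) :
    B.Bos →ₐ[k] T :=
  AlgHom.ofLinearMap (liftLin B φ.toLinearMap ψ.toLinearMap)
    (by rw [one_def, liftLin_of]; simp)
    (fun a b => by rw [mul_def, liftLin_reg hc, LinearEquiv.apply_symm_apply])

variable {B} in
theorem lift_inR (φ : R →ₐ[k] T) (ψ : H →ₐ[k] T) (hc) (r : R) :
    lift φ ψ hc (inR B r) = φ r := by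
  change liftLin B φ.toLinearMap ψ.toLinearMap (of B (r ⊗ₜ 1)) = _
  rw [liftLin_of]; simp

variable {B} in
theorem lift_inH (φ : R →ₐ[k] T) (ψ : H →ₐ[k] T) (hc) (h : H) :
    lift φ ψ hc (inH B h) = ψ h := by
  change liftLin B φ.toLinearMap ψ.toLinearMap (of B (1 ⊗ₜ h)) = _
  rw [liftLin_of]; simp

variable {B} in
theorem algHom_ext {f g : B.Bos →ₐ[k] T}
    (hR : f.toLinearMap ∘ₗ (inR B).toLinearMap = g.toLinearMap ∘ₗ (inR B).toLinearMap)
    (hH : f.toLinearMap ∘ₗ (inH B).toLinearMap = g.toLinearMap ∘ₗ (inH B).toLinearMap) : f = g := by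
  ext a
  induction a using Bos.induction with
  | zero => simp
  | add a b ha hb => rw [map_add, map_add, ha, hb]
  | mul r h =>
    have h1 := LinearMap.congr_fun hR r
    have h2 := LinearMap.congr_fun hH h
    simp only [LinearMap.comp_apply, AlgHom.toLinearMap_apply] at h1 h2
    rw [map_mul, map_mul, h1, h2]

end Bos

end BraidedHopfAlgebra

end Smash

end

end BraidedCoFrob

namespace BraidedCoFrob
noncomputable section
open HopfAlgebra

namespace BraidedHopfAlgebra

variable {k H R T T' : Type u} [Field k] [Ring H] [HopfAlgebra k H]
  [Ring R] [Algebra k R] [Coalgebra k R] [Ring T] [Algebra k T] [Ring T'] [Algebra k T']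
  (B : BraidedHopfAlgebra k H R)

/-! ### Compatible pairs -/

theorem tensorAct_tmul {V W : Type u} [AddCommGroup V] [Module k V] [AddCommGroup W] [Module k W]
    (a : H →ₗ[k] Module.End k V) (b : H →ₗ[k] Module.End k W) (h : H) (v : V) (w : W) :
    tensorAct a b h (v ⊗ₜ w) =
      TensorProduct.map (a.flip v) (b.flip w) (Coalgebra.comul (R := k) h) := by
  simp only [tensorAct, LinearMap.comp_apply]
  generalize Coalgebra.comul (R := k) h = d
  induction d with
  | zero => simp
  | add x y hx hy => simp only [map_add, LinearMap.add_apply, hx, hy]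
  | tmul a b => simp

theorem mulRight_add_eq (s t : T) :
    LinearMap.mulRight k (s + t) = LinearMap.mulRight k s + LinearMap.mulRight k t := by
  ext; simp [mul_add]

variable {B} in
theorem Compat.map {φ : R →ₗ[k] T} {ψ : H →ₗ[k] T} (hc : B.Compat φ ψ) (F : T →ₐ[k] T') :
    B.Compat (F.toLinearMap ∘ₗ φ) (F.toLinearMap ∘ₗ ψ) := by
  intro s
  rw [LinearMap.comp_assoc, ← algHom_conv, ← hc s]
  ext h
  simp

variable {B} in
theorem Compat.conv {α β : R →ₗ[k] T} {ψ : H →ₗ[k] T} (hα : B.Compat α ψ) (hβ : B.Compat β ψ) :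
    B.Compat (conv α β) ψ := by
  -- Proved for an arbitrary tensor under the diagonal action, then used at `d = Δ(s)`, where
  -- `H`-linearity of `Δ` identifies the result with `Δ(h · s)`.
  have key : ∀ d : R ⊗[k] R,
      LinearMap.mulRight k (LinearMap.mul' k T (TensorProduct.map α β d)) ∘ₗ ψ =
      BraidedCoFrob.conv (LinearMap.mul' k T ∘ₗ TensorProduct.map α β ∘ₗ
        (tensorAct B.act.toLinearMap B.act.toLinearMap).flip d) ψ := by
    intro d
    induction d with
    | zero =>
      ext h
      simp [conv_apply]
    | add x y hx hy =>
      rw [map_add, map_add, map_add, mulRight_add_eq, LinearMap.add_comp, hx, hy]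
      ext h
      simp only [conv_apply, LinearMap.comp_add, TensorProduct.map_add_left, LinearMap.add_apply,
        map_add]
    | tmul s t =>
      have h1 : LinearMap.mul' k T ∘ₗ TensorProduct.map α β ∘ₗ
          (tensorAct B.act.toLinearMap B.act.toLinearMap).flip (s ⊗ₜ t) =
          BraidedCoFrob.conv (α ∘ₗ B.actOn s) (β ∘ₗ B.actOn t) := by
        ext h
        rw [conv_apply, LinearMap.comp_apply, LinearMap.comp_apply, LinearMap.flip_apply,
          tensorAct_tmul, TensorProduct.map_comp]
        rfl
      rw [h1, conv_assoc, ← hβ t, ← mulRight_comp_conv, ← hα s]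
      ext h
      simp [mul_assoc]
  intro s
  rw [conv_apply, key]
  congr 1
  ext h
  simp only [LinearMap.comp_apply, LinearMap.flip_apply, conv_apply, actOn_apply, B.comul_act]

/-! ### The comultiplication of the bosonization -/

theorem lTensor_mul_mulTensor (x y : H ⊗[k] R) :
    (LinearMap.mul' k R).lTensor H (mulTensor k H R R (x ⊗ₜ y)) = x * y := by
  induction x with
  | zero => simp
  | add x x' hx hx' => simp only [map_add, TensorProduct.add_tmul, add_mul, hx, hx']
  | tmul a v =>
    induction y with
    | zero => simp
    | add y y' hy hy' => simp only [map_add, TensorProduct.tmul_add, mul_add, hy, hy']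
    | tmul b w => simp [mulTensor_tmul]

/-- The coaction as a morphism of algebras. -/
def coactAlg : R →ₐ[k] H ⊗[k] R :=
  AlgHom.ofLinearMap B.coact (by rw [B.coact_one]; rfl) fun r s => by
    have := B.coact_mul (r ⊗ₜ s)
    rw [LinearMap.mul'_apply] at this
    rw [this, tensorCoact_eq, lTensor_mul_mulTensor]

/-- The map `h ↦ h ⊗ 1`. -/
def inLeft : H →ₐ[k] H ⊗[k] R := Algebra.TensorProduct.includeLeft

/-- The compatibility of action and coaction in the form
`(h₍₁₎ · v)₍₋₁₎ h₍₂₎ ⊗ (h₍₁₎ · v)₍₀₎ = h₍₁₎ v₍₋₁₎ ⊗ h₍₂₎ · v₍₀₎`. -/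
theorem conv_coact_actOn (v : R) :
    conv (B.coact ∘ₗ B.actOn v) (inLeft (k := k) (H := H) (R := R)).toLinearMap =
      (tensorAct (LinearMap.mul k H) B.act.toLinearMap).flip (B.coact v) := by
  have key : ∀ y : H ⊗[k] R, conv ((LinearMap.applyₗ y) ∘ₗ ydOperator B.act.toLinearMap ∘ₗ
      (Coalgebra.comul (R := k) (A := H)).lTensor H ∘ₗ Coalgebra.comul)
        (inLeft (k := k) (H := H) (R := R)).toLinearMap =
      (tensorAct (LinearMap.mul k H) B.act.toLinearMap).flip y := by
    intro y
    induction y with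
    | zero => ext h; simp [conv_apply]
    | add x y hx hy =>
      rw [map_add, map_add, ← hx, ← hy]
      ext h
      simp only [conv_apply, LinearMap.add_comp, TensorProduct.map_add_left, LinearMap.add_apply,
        map_add]
    | tmul x w =>
      let p : H →ₗ[k] H ⊗[k] R := inLeft.toLinearMap ∘ₗ LinearMap.mulRight k x
      let q : H →ₗ[k] H ⊗[k] R := TensorProduct.mk k H R 1 ∘ₗ B.actOn w
      let s : H →ₗ[k] H ⊗[k] R := inLeft.toLinearMap ∘ₗ HopfAlgebra.antipode k
      have h1 : (LinearMap.applyₗ (x ⊗ₜ w)) ∘ₗ ydOperator B.act.toLinearMap ∘ₗ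
          (Coalgebra.comul (R := k) (A := H)).lTensor H ∘ₗ Coalgebra.comul =
          conv p (conv q s) := by
        ext h
        simp only [conv_apply, LinearMap.comp_apply]
        generalize Coalgebra.comul (R := k) h = d
        induction d with
        | zero => simp
        | add x y hx hy => simp only [map_add, hx, hy]
        | tmul a b =>
          simp only [LinearMap.lTensor_tmul, TensorProduct.map_tmul, conv_apply,
            LinearMap.mul'_apply]
          generalize Coalgebra.comul (R := k) b = e
          induction e with
          | zero => simp
          | add x y hx hy => simp only [map_add, TensorProduct.tmul_add, mul_add, hx, hy]
          | tmul b c => simp [ydOperator_tmul, p, q, s, inLeft, mul_assoc]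
      -- Convolving the Yetter–Drinfeld formula with `h ↦ h ⊗ 1` cancels its factor `S(h₍₃₎)`.
      have h2 : conv s (inLeft (k := k) (H := H) (R := R)).toLinearMap =
          Algebra.linearMap k _ ∘ₗ Coalgebra.counit := by
        have h3 : (inLeft (k := k) (H := H) (R := R)).toLinearMap =
          inLeft.toLinearMap ∘ₗ LinearMap.id := rfl
        rw [h3, ← algHom_conv]
        ext h
        rw [LinearMap.comp_apply, conv_apply]
        change inLeft (LinearMap.mul' k H ((HopfAlgebra.antipode k).rTensor H _)) = _
        rw [mul_antipode_rTensor_comul_apply]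
        simp
      rw [h1, conv_assoc, conv_assoc, h2, conv_of_counit_right]
      ext h
      rw [LinearMap.flip_apply, tensorAct_tmul, conv_apply]
      generalize Coalgebra.comul (R := k) h = d
      induction d with
      | zero => simp
      | add x y hx hy => simp only [map_add, hx, hy]
      | tmul a b => simp [p, q, inLeft]
  rw [← key]
  congr 1
  ext h
  simp [B.compat]

namespace Bos

/-- The map `r ↦ r₍₋₁₎ ⊗ f(r₍₀₎)` from `R` to `(R # H) ⊗ T`. -/
def hat (f : R →ₗ[k] T) : R →ₗ[k] B.Bos ⊗[k] T :=
  TensorProduct.map (inH B).toLinearMap f ∘ₗ B.coact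

/-- Multiplicativity of `hat` for convolution expresses that `Δ` of `R` is colinear over `H`. -/
theorem hat_conv (f g : R →ₗ[k] T) : hat B (conv f g) = conv (hat B f) (hat B g) := by
  ext r
  have h1 : hat B (conv f g) r = TensorProduct.map (inH B).toLinearMap
      (LinearMap.mul' k T ∘ₗ TensorProduct.map f g) (Coalgebra.comul.lTensor H (B.coact r)) := by
    rw [hat, LinearMap.comp_apply]
    generalize B.coact r = x
    induction x with
    | zero => simp
    | add x y hx hy => simp only [map_add, hx, hy]
    | tmul h s => simp [conv_apply]
  rw [h1, B.comul_coact, conv_apply]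
  generalize Coalgebra.comul (R := k) r = d
  induction d with
  | zero => simp
  | add x y hx hy => simp only [map_add, hx, hy]
  | tmul s t =>
    rw [tensorCoact_eq, TensorProduct.map_tmul, LinearMap.mul'_apply]
    simp only [hat, LinearMap.comp_apply]
    generalize B.coact s = x
    generalize B.coact t = y
    induction x with
    | zero => simp
    | add x x' hx hx' => simp only [map_add, TensorProduct.add_tmul, add_mul, hx, hx']
    | tmul a v =>
      induction y with
      | zero => simp
      | add y y' hy hy' => simp only [map_add, TensorProduct.tmul_add, mul_add, hy, hy']
      | tmul b w => simp [mulTensor_tmul]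

/-- The map `r ↦ r ⊗ 1`. -/
def comulFst (T : Type u) [Ring T] [Algebra k T] : R →ₐ[k] B.Bos ⊗[k] T :=
  Algebra.TensorProduct.includeLeft.comp (inR B)

/-- The map `r ↦ r₍₋₁₎ ⊗ r₍₀₎`. -/
def comulSnd : R →ₐ[k] B.Bos ⊗[k] B.Bos :=
  (Algebra.TensorProduct.map (inH B) (inR B)).comp B.coactAlg

theorem comulSnd_toLinearMap : (comulSnd B).toLinearMap = hat B (inR B).toLinearMap := rfl

/-- The comultiplication of `H` in the bosonization. -/
def comulH : H →ₐ[k] B.Bos ⊗[k] B.Bos :=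
  (Algebra.TensorProduct.map (inH B) (inH B)).comp (Bialgebra.comulAlgHom k H)

theorem comulH_apply (h : H) : comulH B h =
    TensorProduct.map (inH B).toLinearMap (inH B).toLinearMap (Coalgebra.comul (R := k) h) := rfl

/-- The map `h ↦ h ⊗ 1`. -/
def inH₁ : H →ₐ[k] B.Bos ⊗[k] B.Bos := Algebra.TensorProduct.includeLeft.comp (inH B)

/-- The map `h ↦ 1 ⊗ h`. -/
def inH₂ : H →ₐ[k] B.Bos ⊗[k] B.Bos := Algebra.TensorProduct.includeRight.comp (inH B)

theorem comulH_eq_conv :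
    (comulH B).toLinearMap = conv (inH₁ B).toLinearMap (inH₂ B).toLinearMap := by
  ext h
  rw [AlgHom.toLinearMap_apply, comulH_apply, conv_apply]
  generalize Coalgebra.comul (R := k) h = d
  induction d with
  | zero => simp
  | add x y hx hy => simp only [map_add, hx, hy]
  | tmul a b => simp [inH₁, inH₂]

/-- Moving `r₍₋₁₎ ⊗ r₍₀₎` past `s ⊗ 1` by the smash relation produces `r₍₋₂₎ · s` followed by `r₍₋₁₎
⊗ r₍₀₎`: the braiding appears, by coassociativity of the coaction. -/
theorem comulSnd_mul_comulFst (r s : R) : comulSnd B r * comulFst B B.Bos s =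
    LinearMap.mul' k _ (TensorProduct.map (comulFst B B.Bos).toLinearMap (comulSnd B).toLinearMap
      (braiding B.coact B.act.toLinearMap (r ⊗ₜ s))) := by
  let Q : H ⊗[k] (H ⊗[k] R) →ₗ[k] B.Bos ⊗[k] B.Bos := LinearMap.mul' k _ ∘ₗ
    TensorProduct.map ((comulFst B B.Bos).toLinearMap ∘ₗ B.actOn s)
      (TensorProduct.map (inH B).toLinearMap (inR B).toLinearMap)
  have h1 : ∀ x : H ⊗[k] R, TensorProduct.map (inH B).toLinearMap (inR B).toLinearMap x *
      comulFst B B.Bos s = Q (TensorProduct.assoc k H H R (Coalgebra.comul.rTensor R x)) := by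
    intro x
    induction x with
    | zero => simp
    | add x y hx hy => simp only [map_add, add_mul, hx, hy]
    | tmul h t =>
      have h2 := LinearMap.congr_fun (compat_in B s) h
      simp only [LinearMap.comp_apply, LinearMap.mulRight_apply, AlgHom.toLinearMap_apply,
        conv_apply] at h2
      simp only [TensorProduct.map_tmul, AlgHom.toLinearMap_apply, comulFst, AlgHom.comp_apply,
        Algebra.TensorProduct.includeLeft_apply, Algebra.TensorProduct.tmul_mul_tmul, h2, mul_one,
        LinearMap.rTensor_tmul]
      generalize Coalgebra.comul (R := k) h = d
      induction d with
      | zero => simp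
      | add x y hx hy => simp only [map_add, TensorProduct.add_tmul, hx, hy]
      | tmul a b => simp [Q, comulFst]
  have h3 : ∀ x : H ⊗[k] R, LinearMap.mul' k _ (TensorProduct.map
      (comulFst B B.Bos).toLinearMap (comulSnd B).toLinearMap
      ((TensorProduct.lift B.act.toLinearMap).rTensor R ((TensorProduct.assoc k H R R).symm
        ((TensorProduct.comm k R R).toLinearMap.lTensor H (TensorProduct.assoc k H R R
          (x ⊗ₜ s)))))) = Q (B.coact.lTensor H x) := by
    intro x
    induction x with
    | zero => simp
    | add x y hx hy => simp only [map_add, TensorProduct.add_tmul, hx, hy]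
    | tmul h t => simp [Q, comulSnd_toLinearMap, hat]
  refine (h1 (B.coact r)).trans ?_
  rw [B.isCoaction.coassoc, ← h3]
  rfl

/-- The comultiplication of `R` in the bosonization. -/
def comulRLin : R →ₗ[k] B.Bos ⊗[k] B.Bos :=
  conv (comulFst B B.Bos).toLinearMap (comulSnd B).toLinearMap

/-- Exchanging the two middle factors of the product brings in the braiding exactly as in the
twisted product on `R ⊗ R`, so this follows from multiplicativity of the braided `Δ`. -/
theorem comulRLin_mul (r s : R) : comulRLin B (r * s) = comulRLin B r * comulRLin B s := by
  rw [comulRLin, conv_apply, conv_apply, conv_apply, B.comul_mul]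
  generalize Coalgebra.comul (R := k) r = x
  generalize Coalgebra.comul (R := k) s = y
  induction x with
  | zero => simp
  | add x x' hx hx' => simp only [map_add, TensorProduct.add_tmul, add_mul, hx, hx']
  | tmul a b =>
    induction y with
    | zero => simp
    | add y y' hy hy' => simp only [map_add, TensorProduct.tmul_add, mul_add, hy, hy']
    | tmul c d =>
      have h1 := comulSnd_mul_comulFst B b c
      simp only [TensorProduct.map_tmul, LinearMap.mul'_apply, AlgHom.toLinearMap_apply]
      rw [mul_assoc, ← mul_assoc (comulSnd B b), h1]
      simp only [twistedMul, LinearMap.comp_apply, LinearEquiv.coe_coe, TensorProduct.assoc_tmul,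
        LinearMap.lTensor_tmul, TensorProduct.assoc_symm_tmul, LinearMap.rTensor_tmul]
      generalize braiding B.coact B.act.toLinearMap (b ⊗ₜ c) = z
      induction z with
      | zero => simp
      | add y y' hy hy' =>
        simp only [map_add, TensorProduct.tmul_add, TensorProduct.add_tmul, add_mul, mul_add, hy,
          hy']
      | tmul u v => simp [mul_assoc]

/-- The comultiplication of `R` in the bosonization. -/
def comulR : R →ₐ[k] B.Bos ⊗[k] B.Bos :=
  AlgHom.ofLinearMap (comulRLin B) (by rw [comulRLin, conv_apply, B.comul_one]; simp)
    (comulRLin_mul B)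

theorem comulR_toLinearMap : (comulR B).toLinearMap =
    conv (comulFst B B.Bos).toLinearMap (hat B (inR B).toLinearMap) := rfl

/-- Only the first leg of `Δ(h)` interacts with `s ⊗ 1`, where the smash relation applies; the
second leg commutes with it. -/
theorem compat_comulFst : B.Compat (comulFst B B.Bos).toLinearMap (comulH B).toLinearMap := by
  intro s
  have h1 : LinearMap.mulRight k (comulFst B B.Bos s) ∘ₗ (inH₂ B).toLinearMap =
      LinearMap.mulLeft k (comulFst B B.Bos s) ∘ₗ (inH₂ B).toLinearMap := by
    ext h
    simp [comulFst, inH₂]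
  have h2 := (compat_in B).map (Algebra.TensorProduct.includeLeft : B.Bos →ₐ[k] B.Bos ⊗[k] B.Bos) s
  rw [comulH_eq_conv, AlgHom.toLinearMap_apply, mulRight_comp_conv, h1, conv_mulLeft, ← conv_assoc]
  congr 1

/-- This is where the Yetter–Drinfeld condition enters, in the antipode-free form
`conv_coact_actOn`. The rule is proved with an arbitrary `y ∈ H ⊗ R` in place of the coaction of
`s`. -/
theorem compat_comulSnd : B.Compat (comulSnd B).toLinearMap (comulH B).toLinearMap := by
  intro s
  let K : H ⊗[k] R →ₐ[k] B.Bos ⊗[k] B.Bos := Algebra.TensorProduct.map (inH B) (inR B)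
  have h1 : (inH₁ B).toLinearMap = K.toLinearMap ∘ₗ inLeft.toLinearMap := by
    ext h; simp [K, inH₁, inLeft]
  have h2 : (comulSnd B).toLinearMap ∘ₗ B.actOn s = K.toLinearMap ∘ₗ B.coact ∘ₗ B.actOn s := rfl
  have key : ∀ y : H ⊗[k] R, LinearMap.mulRight k (K y) ∘ₗ
      conv (inH₁ B).toLinearMap (inH₂ B).toLinearMap =
      conv (K.toLinearMap ∘ₗ (tensorAct (LinearMap.mul k H) B.act.toLinearMap).flip y)
        (inH₂ B).toLinearMap := by
    intro y
    induction y with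
    | zero => ext h; simp [conv_apply]
    | add x y hx hy =>
      rw [map_add, mulRight_add_eq, LinearMap.add_comp, hx, hy, map_add]
      ext h
      simp only [conv_apply, LinearMap.comp_add, TensorProduct.map_add_left, LinearMap.add_apply,
        map_add]
    | tmul x w =>
      let r₂ : R →ₐ[k] B.Bos ⊗[k] B.Bos := Algebra.TensorProduct.includeRight.comp (inR B)
      let p : H →ₗ[k] B.Bos ⊗[k] B.Bos := (inH₁ B).toLinearMap ∘ₗ LinearMap.mulRight k x
      have h3 := (compat_in B).map
        (Algebra.TensorProduct.includeRight : B.Bos →ₐ[k] B.Bos ⊗[k] B.Bos) w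
      have h4 : K.toLinearMap ∘ₗ (tensorAct (LinearMap.mul k H) B.act.toLinearMap).flip (x ⊗ₜ w) =
          conv p (r₂.toLinearMap ∘ₗ B.actOn w) := by
        ext h
        rw [LinearMap.comp_apply, LinearMap.flip_apply, tensorAct_tmul, conv_apply]
        generalize Coalgebra.comul (R := k) h = d
        induction d with
        | zero => simp
        | add x y hx hy => simp only [map_add, hx, hy]
        | tmul a b => simp [K, p, r₂, inH₁]
      rw [h4, conv_assoc]
      refine Eq.trans ?_ (congrArg (conv p) h3)
      ext h
      rw [LinearMap.comp_apply, conv_apply, conv_apply]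
      generalize Coalgebra.comul (R := k) h = d
      induction d with
      | zero => simp
      | add x y hx hy => simp only [map_add, hx, hy]
      | tmul a b => simp [K, p, inH₁, inH₂]
  rw [comulH_eq_conv, h2, h1, ← conv_assoc, ← algHom_conv, conv_coact_actOn, ← h1, ← key]
  rfl

theorem compat_comul : B.Compat (comulR B).toLinearMap (comulH B).toLinearMap :=
  (compat_comulFst B).conv (compat_comulSnd B)

/-- The comultiplication of the bosonization. -/
def comulAlg : B.Bos →ₐ[k] B.Bos ⊗[k] B.Bos := lift (comulR B) (comulH B) (compat_comul B)

theorem comulAlg_inR (r : R) : comulAlg B (inR B r) = comulR B r := lift_inR _ _ _ r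

theorem comulAlg_inH (h : H) : comulAlg B (inH B h) = comulH B h := lift_inH _ _ _ h

/-! ### The counit of the bosonization -/

/-- The counit of `R` as a morphism of algebras. -/
def counitR : R →ₐ[k] k := AlgHom.ofLinearMap Coalgebra.counit B.counit_one B.counit_mul

theorem compat_counit :
    B.Compat (counitR B).toLinearMap (Bialgebra.counitAlgHom k H).toLinearMap := by
  intro s
  have h1 : (counitR B).toLinearMap ∘ₗ B.actOn s =
      LinearMap.mulRight k (Coalgebra.counit (R := k) s) ∘ₗ
        (Algebra.linearMap k k ∘ₗ Coalgebra.counit) := by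
    ext h
    simp [counitR, B.counit_act]
  rw [h1, ← conv_mulLeft, conv_of_counit_left]
  ext h
  simp [counitR, mul_comm]

/-- The counit of the bosonization. -/
def counitAlg : B.Bos →ₐ[k] k :=
  lift (counitR B) (Bialgebra.counitAlgHom k H) (compat_counit B)

theorem counitAlg_inR (r : R) : counitAlg B (inR B r) = Coalgebra.counit (R := k) r :=
  lift_inR _ _ _ r

theorem counitAlg_inH (h : H) : counitAlg B (inH B h) = Coalgebra.counit (R := k) h :=
  lift_inH _ _ _ h

end Bos

end BraidedHopfAlgebra

end

end BraidedCoFrob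

namespace BraidedCoFrob
noncomputable section

namespace BraidedHopfAlgebra

variable {k H R T T' : Type u} [Field k] [Ring H] [HopfAlgebra k H]
  [Ring R] [Algebra k R] [Coalgebra k R] [Ring T] [Algebra k T] [Ring T'] [Algebra k T']
  (B : BraidedHopfAlgebra k H R)

namespace Bos

/-! ### The bosonization as a Hopf algebra -/

theorem coassoc_inH :
    (((Algebra.TensorProduct.assoc k k k B.Bos B.Bos B.Bos).toAlgHom.comp
      (Algebra.TensorProduct.map (comulAlg B) (.id k B.Bos))).toLinearMap ∘ₗ
        (comulH B).toLinearMap) =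
    (Algebra.TensorProduct.map (.id k B.Bos) (comulAlg B)).toLinearMap ∘ₗ
      (comulH B).toLinearMap := by
  let N := TensorProduct.map (inH B).toLinearMap
    (TensorProduct.map (inH B).toLinearMap (inH B).toLinearMap)
  have h1 : ∀ d : H ⊗[k] H, (((Algebra.TensorProduct.assoc k k k B.Bos B.Bos B.Bos).toAlgHom.comp
      (Algebra.TensorProduct.map (comulAlg B) (.id k B.Bos))))
      (TensorProduct.map (inH B).toLinearMap (inH B).toLinearMap d) =
      N (TensorProduct.assoc k H H H (Coalgebra.comul.rTensor H d)) := by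
    intro d
    induction d with
    | zero => simp
    | add x y hx hy => simp only [map_add, hx, hy]
    | tmul x y =>
      simp only [TensorProduct.map_tmul, AlgHom.toLinearMap_apply, AlgHom.comp_apply,
        Algebra.TensorProduct.map_tmul, comulAlg_inH, comulH_apply, LinearMap.rTensor_tmul,
        AlgHom.coe_id, id]
      generalize Coalgebra.comul (R := k) x = e
      induction e with
      | zero => simp
      | add x y hx hy => simp only [map_add, TensorProduct.add_tmul, hx, hy]
      | tmul a b => simp [N]
  have h2 : ∀ d : H ⊗[k] H, (Algebra.TensorProduct.map (.id k B.Bos) (comulAlg B))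
      (TensorProduct.map (inH B).toLinearMap (inH B).toLinearMap d) =
      N (Coalgebra.comul.lTensor H d) := by
    intro d
    induction d with
    | zero => simp
    | add x y hx hy => simp only [map_add, hx, hy]
    | tmul x y => simp [N, comulAlg_inH, comulH_apply]
  ext h
  exact (h1 _).trans ((congrArg N (Coalgebra.coassoc_apply h)).trans (h2 _).symm)

/-- Coassociativity of the `H`-coaction on `R`, written with `hat`. -/
theorem assoc_comul_hat :
    ((Algebra.TensorProduct.assoc k k k B.Bos B.Bos B.Bos).toAlgHom.comp
      (Algebra.TensorProduct.map (comulAlg B) (.id k B.Bos))).toLinearMap ∘ₗ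
        hat B (inR B).toLinearMap = hat B (hat B (inR B).toLinearMap) := by
  let N := TensorProduct.map (inH B).toLinearMap
    (TensorProduct.map (inH B).toLinearMap (inR B).toLinearMap)
  have h1 : ∀ d : H ⊗[k] R, ((Algebra.TensorProduct.assoc k k k B.Bos B.Bos B.Bos).toAlgHom.comp
      (Algebra.TensorProduct.map (comulAlg B) (.id k B.Bos)))
      (TensorProduct.map (inH B).toLinearMap (inR B).toLinearMap d) =
      N (TensorProduct.assoc k H H R (Coalgebra.comul.rTensor R d)) := by
    intro d
    induction d with
    | zero => simp
    | add x y hx hy => simp only [map_add, hx, hy]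
    | tmul x y =>
      simp only [TensorProduct.map_tmul, AlgHom.toLinearMap_apply, AlgHom.comp_apply,
        Algebra.TensorProduct.map_tmul, comulAlg_inH, comulH_apply, LinearMap.rTensor_tmul,
        AlgHom.coe_id, id]
      generalize Coalgebra.comul (R := k) x = e
      induction e with
      | zero => simp
      | add x y hx hy => simp only [map_add, TensorProduct.add_tmul, hx, hy]
      | tmul a b => simp [N]
  have h2 : ∀ d : H ⊗[k] R, TensorProduct.map (inH B).toLinearMap
      (hat B (inR B).toLinearMap) d = N (B.coact.lTensor H d) := by
    intro d
    induction d with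
    | zero => simp
    | add x y hx hy => simp only [map_add, hx, hy]
    | tmul x y => simp [N, hat]
  ext r
  exact (h1 _).trans ((congrArg N (B.isCoaction.coassoc r)).trans (h2 _).symm)

theorem assoc_comul_comulFst :
    ((Algebra.TensorProduct.assoc k k k B.Bos B.Bos B.Bos).toAlgHom.comp
      (Algebra.TensorProduct.map (comulAlg B) (.id k B.Bos))).toLinearMap ∘ₗ
        (comulFst B B.Bos).toLinearMap =
      conv (comulFst B (B.Bos ⊗[k] B.Bos)).toLinearMap
        (hat B (comulFst B B.Bos).toLinearMap) := by
  let J : B.Bos ⊗[k] B.Bos →ₐ[k] B.Bos ⊗[k] (B.Bos ⊗[k] B.Bos) :=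
    Algebra.TensorProduct.map (.id k B.Bos) Algebra.TensorProduct.includeLeft
  have h1 : ((Algebra.TensorProduct.assoc k k k B.Bos B.Bos B.Bos).toAlgHom.comp
      (Algebra.TensorProduct.map (comulAlg B) (.id k B.Bos))).toLinearMap ∘ₗ
        (comulFst B B.Bos).toLinearMap = J.toLinearMap ∘ₗ (comulR B).toLinearMap := by
    ext r
    simp only [LinearMap.comp_apply, AlgHom.toLinearMap_apply, comulFst, AlgHom.comp_apply,
      Algebra.TensorProduct.includeLeft_apply, Algebra.TensorProduct.map_tmul, comulAlg_inR,
      map_one]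
    generalize comulR B r = d
    induction d with
    | zero => simp
    | add x y hx hy => simp only [map_add, TensorProduct.add_tmul, hx, hy]
    | tmul a b => simp [J]
  rw [h1, comulR_toLinearMap]
  refine (algHom_conv (C := R) (T := B.Bos ⊗[k] B.Bos)
    (T' := B.Bos ⊗[k] (B.Bos ⊗[k] B.Bos)) J _ _).trans ?_
  congr 1
  ext r
  simp only [LinearMap.comp_apply, hat]
  generalize B.coact r = d
  induction d with
  | zero => simp
  | add x y hx hy => simp only [map_add, hx, hy]
  | tmul a b => simp [J, comulFst]

theorem lTensor_comul_hat :
    (Algebra.TensorProduct.map (.id k B.Bos) (comulAlg B)).toLinearMap ∘ₗ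
      hat B (inR B).toLinearMap = hat B (comulR B).toLinearMap := by
  ext r
  simp only [LinearMap.comp_apply, hat]
  generalize B.coact r = d
  induction d with
  | zero => simp
  | add x y hx hy => simp only [map_add, hx, hy]
  | tmul a b => simp [comulAlg_inR]

/-- Both sides are the same threefold convolution: `hat_conv` expands one of them,
`assoc_comul_comulFst` the other, and associativity of convolution identifies them. -/
theorem coassoc_inR :
    (((Algebra.TensorProduct.assoc k k k B.Bos B.Bos B.Bos).toAlgHom.comp
      (Algebra.TensorProduct.map (comulAlg B) (.id k B.Bos))).toLinearMap ∘ₗ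
        (comulR B).toLinearMap) =
    (Algebra.TensorProduct.map (.id k B.Bos) (comulAlg B)).toLinearMap ∘ₗ
      (comulR B).toLinearMap := by
  have h1 : (Algebra.TensorProduct.map (.id k B.Bos) (comulAlg B)).toLinearMap ∘ₗ
      (comulFst B B.Bos).toLinearMap = (comulFst B (B.Bos ⊗[k] B.Bos)).toLinearMap := by
    ext r; simp [comulFst]
  rw [comulR_toLinearMap, algHom_conv, algHom_conv, assoc_comul_hat, assoc_comul_comulFst, h1,
    lTensor_comul_hat, comulR_toLinearMap, hat_conv, conv_assoc]

theorem comulAlg_comp_inR :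
    (comulAlg B).toLinearMap ∘ₗ (inR B).toLinearMap = (comulR B).toLinearMap :=
  LinearMap.ext (comulAlg_inR B)

theorem comulAlg_comp_inH :
    (comulAlg B).toLinearMap ∘ₗ (inH B).toLinearMap = (comulH B).toLinearMap :=
  LinearMap.ext (comulAlg_inH B)

theorem rTensor_counit_hat :
    (Algebra.TensorProduct.map (counitAlg B) (.id k B.Bos)).toLinearMap ∘ₗ
      hat B (inR B).toLinearMap = TensorProduct.mk k k B.Bos 1 ∘ₗ (inR B).toLinearMap := by
  have h1 : ∀ d : H ⊗[k] R, Algebra.TensorProduct.map (counitAlg B) (.id k B.Bos)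
      (TensorProduct.map (inH B).toLinearMap (inR B).toLinearMap d) =
      1 ⊗ₜ inR B (contract Coalgebra.counit d) := by
    intro d
    induction d with
    | zero => simp
    | add x y hx hy => simp only [map_add, TensorProduct.tmul_add, hx, hy]
    | tmul x y =>
      rw [contract_tmul, map_smul, ← TensorProduct.smul_tmul]
      simp [counitAlg_inH]
  ext r
  refine (h1 _).trans ?_
  rw [B.isCoaction.contract_counit]
  rfl

theorem lTensor_counit_hat :
    (Algebra.TensorProduct.map (.id k B.Bos) (counitAlg B)).toLinearMap ∘ₗ
      hat B (inR B).toLinearMap = Algebra.linearMap k _ ∘ₗ Coalgebra.counit := by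
  have h1 : ∀ d : H ⊗[k] R, Algebra.TensorProduct.map (.id k B.Bos) (counitAlg B)
      (TensorProduct.map (inH B).toLinearMap (inR B).toLinearMap d) =
      inH B (TensorProduct.rid k H (Coalgebra.counit.lTensor H d)) ⊗ₜ 1 := by
    intro d
    induction d with
    | zero => simp
    | add x y hx hy => simp only [map_add, TensorProduct.add_tmul, hx, hy]
    | tmul x y =>
      simp [counitAlg_inR, TensorProduct.smul_tmul]
  ext r
  refine (h1 _).trans ?_
  rw [B.counit_coact]
  simp [Algebra.algebraMap_eq_smul_one, TensorProduct.smul_tmul',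
    Algebra.TensorProduct.one_def]

/-- The comultiplication and counit are algebra maps, so the coalgebra axioms need only be checked
on the generators from `R` and from `H`. -/
instance : Bialgebra k B.Bos := Bialgebra.ofAlgHom (comulAlg B) (counitAlg B)
  (algHom_ext
    (by
      have := coassoc_inR B
      rw [← comulAlg_comp_inR] at this
      exact this)
    (by
      have := coassoc_inH B
      rw [← comulAlg_comp_inH] at this
      exact this))
  (algHom_ext
    (by
      change (Algebra.TensorProduct.map (counitAlg B) (.id k B.Bos)).toLinearMap ∘ₗ
        ((comulAlg B).toLinearMap ∘ₗ (inR B).toLinearMap) = _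
      rw [comulAlg_comp_inR, comulR_toLinearMap, algHom_conv, rTensor_counit_hat]
      have h1 : (Algebra.TensorProduct.map (counitAlg B) (.id k B.Bos)).toLinearMap ∘ₗ
          (comulFst B B.Bos).toLinearMap = Algebra.linearMap k _ ∘ₗ Coalgebra.counit := by
        ext r
        simp [comulFst, counitAlg_inR]
      rw [h1, conv_of_counit_left]
      ext r
      simp)
    (by
      ext h
      change Algebra.TensorProduct.map (counitAlg B) (.id k B.Bos) (comulAlg B (inH B h)) = _
      rw [comulAlg_inH, comulH_apply]
      have h1 : ∀ d : H ⊗[k] H, Algebra.TensorProduct.map (counitAlg B) (.id k B.Bos)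
          (TensorProduct.map (inH B).toLinearMap (inH B).toLinearMap d) =
          (inH B).toLinearMap.lTensor k (Coalgebra.counit.rTensor H d) := by
        intro d
        induction d with
        | zero => simp
        | add x y hx hy => simp only [map_add, hx, hy]
        | tmul x y => simp [counitAlg_inH]
      rw [h1, Coalgebra.rTensor_counit_comul]
      simp))
  (algHom_ext
    (by
      change (Algebra.TensorProduct.map (.id k B.Bos) (counitAlg B)).toLinearMap ∘ₗ
        ((comulAlg B).toLinearMap ∘ₗ (inR B).toLinearMap) = _
      rw [comulAlg_comp_inR, comulR_toLinearMap, algHom_conv, lTensor_counit_hat,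
        conv_of_counit_right]
      ext r
      simp [comulFst])
    (by
      ext h
      change Algebra.TensorProduct.map (.id k B.Bos) (counitAlg B) (comulAlg B (inH B h)) = _
      rw [comulAlg_inH, comulH_apply]
      have h1 : ∀ d : H ⊗[k] H, Algebra.TensorProduct.map (.id k B.Bos) (counitAlg B)
          (TensorProduct.map (inH B).toLinearMap (inH B).toLinearMap d) =
          (inH B).toLinearMap.rTensor k (Coalgebra.counit.lTensor H d) := by
        intro d
        induction d with
        | zero => simp
        | add x y hx hy => simp only [map_add, hx, hy]
        | tmul x y => simp [counitAlg_inH]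
      rw [h1, Coalgebra.lTensor_counit_comul]
      simp))

theorem comul_eq (a : B.Bos) : Coalgebra.comul (R := k) a = comulAlg B a := rfl

theorem counit_eq (a : B.Bos) : Coalgebra.counit (R := k) a = counitAlg B a := rfl

/-! ### The antipode of the bosonization -/

/-- The antipode of the bosonization restricted to `R`. -/
def antipodeR : R →ₗ[k] B.Bos :=
  LinearMap.mul' k _ ∘ₗ TensorProduct.map ((inH B).toLinearMap ∘ₗ HopfAlgebra.antipode k)
    ((inR B).toLinearMap ∘ₗ B.antipode) ∘ₗ B.coact

/-- The antipode of the bosonization. -/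
def antipodeLin : B.Bos →ₗ[k] B.Bos :=
  LinearMap.mul' k _ ∘ₗ (TensorProduct.comm k _ _).toLinearMap ∘ₗ
    TensorProduct.map (antipodeR B) ((inH B).toLinearMap ∘ₗ HopfAlgebra.antipode k) ∘ₗ
      (of B).symm.toLinearMap

theorem antipodeLin_mul (r : R) (h : H) : antipodeLin B (inR B r * inH B h) =
    inH B (HopfAlgebra.antipode k h) * antipodeR B r := by
  simp [antipodeLin, inR_mul_inH]

theorem antipodeLin_inR (r : R) : antipodeLin B (inR B r) = antipodeR B r := by
  have := antipodeLin_mul B r 1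
  simpa using this

theorem antipodeLin_mul_inH (a : B.Bos) (h : H) : antipodeLin B (a * inH B h) =
    inH B (HopfAlgebra.antipode k h) * antipodeLin B a := by
  induction a using Bos.induction with
  | zero => simp
  | add a b ha hb => simp only [add_mul, map_add, mul_add, ha, hb]
  | mul r g =>
    rw [mul_assoc, ← map_mul, antipodeLin_mul, antipodeLin_mul,
      HopfAlgebra.antipode_mul_antidistrib, map_mul, mul_assoc]

/-- Collecting the `H`-legs gives `S(r⁽¹⁾₍₋₁₎ r⁽²⁾₍₋₁₎)`. By colinearity of `Δ` this is `S(r₍₋₁₎)`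
with `Δ` applied to `r₍₀₎`, and the braided antipode then cancels. -/
theorem antipode_left_inR (r : R) :
    LinearMap.mul' k _ ((antipodeLin B).rTensor B.Bos (comulR B r)) =
      algebraMap k B.Bos (Coalgebra.counit (R := k) r) := by
  let G : H ⊗[k] (R ⊗[k] R) →ₗ[k] B.Bos := LinearMap.mul' k _ ∘ₗ
    TensorProduct.map ((inH B).toLinearMap ∘ₗ HopfAlgebra.antipode k)
      ((inR B).toLinearMap ∘ₗ LinearMap.mul' k R ∘ₗ B.antipode.rTensor R)
  have h1 : ∀ d : R ⊗[k] R, LinearMap.mul' k _ ((antipodeLin B).rTensor B.Bos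
      (LinearMap.mul' k _ (TensorProduct.map (comulFst B B.Bos).toLinearMap
        (hat B (inR B).toLinearMap) d))) = G (tensorCoact B.coact B.coact d) := by
    intro d
    induction d with
    | zero => simp
    | add x y hx hy => simp only [map_add, hx, hy]
    | tmul s t =>
      rw [tensorCoact_eq]
      simp only [TensorProduct.map_tmul, LinearMap.mul'_apply, hat, LinearMap.comp_apply]
      generalize B.coact t = y
      induction y with
      | zero => simp
      | add x y hx hy => simp only [map_add, mul_add, TensorProduct.tmul_add, hx, hy]
      | tmul x t =>
        simp only [TensorProduct.map_tmul, AlgHom.toLinearMap_apply, comulFst, AlgHom.comp_apply,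
          Algebra.TensorProduct.includeLeft_apply, Algebra.TensorProduct.tmul_mul_tmul, one_mul,
          LinearMap.rTensor_tmul, LinearMap.mul'_apply, antipodeLin_mul, antipodeR,
          LinearMap.comp_apply]
        generalize B.coact s = z
        induction z with
        | zero => simp
        | add x y hx hy =>
          simp only [map_add, mul_add, add_mul, TensorProduct.add_tmul, hx, hy]
        | tmul z s =>
          simp [mulTensor_tmul, G, HopfAlgebra.antipode_mul_antidistrib, mul_assoc]
  have h2 : ∀ x : H ⊗[k] R, G (Coalgebra.comul.lTensor H x) =
      inH B (HopfAlgebra.antipode k (TensorProduct.rid k H (Coalgebra.counit.lTensor H x))) := by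
    intro x
    induction x with
    | zero => simp
    | add x y hx hy => simp only [map_add, hx, hy]
    | tmul x s =>
      simp [G, B.mul_antipode_left]
  refine (h1 _).trans ?_
  rw [← B.comul_coact, h2, B.counit_coact]
  simp [Algebra.algebraMap_eq_smul_one]

/-- The `H`-legs of the second factor meet as `t₍₋₂₎ S(t₍₋₁₎)` and disappear first; what remains is
the braided antipode identity in `R`. -/
theorem antipode_right_inR (r : R) :
    LinearMap.mul' k _ ((antipodeLin B).lTensor B.Bos (comulR B r)) =
      algebraMap k B.Bos (Coalgebra.counit (R := k) r) := by
  let P : H ⊗[k] R →ₗ[k] B.Bos := LinearMap.mul' k _ ∘ₗ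
    TensorProduct.map (inH B).toLinearMap ((inR B).toLinearMap ∘ₗ B.antipode)
  have h0 : ∀ y : H ⊗[k] R, LinearMap.mul' k _ (TensorProduct.map (inH B).toLinearMap
      (antipodeR B) y) = P (LComod.mulAntipodeRight R (B.coact.lTensor H y)) := by
    intro y
    induction y with
    | zero => simp
    | add x y hx hy => simp only [map_add, hx, hy]
    | tmul x t =>
      simp only [TensorProduct.map_tmul, LinearMap.mul'_apply, antipodeR, LinearMap.comp_apply,
        LinearMap.lTensor_tmul]
      generalize B.coact t = z
      induction z with
      | zero => simp
      | add x y hx hy => simp only [map_add, mul_add, TensorProduct.tmul_add, hx, hy]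
      | tmul z s => simp [P, mul_assoc]
  have h1 : ∀ d : R ⊗[k] R, LinearMap.mul' k _ ((antipodeLin B).lTensor B.Bos
      (LinearMap.mul' k _ (TensorProduct.map (comulFst B B.Bos).toLinearMap
        (hat B (inR B).toLinearMap) d))) =
      inR B (LinearMap.mul' k R (B.antipode.lTensor R d)) := by
    intro d
    induction d with
    | zero => simp
    | add x y hx hy => simp only [map_add, hx, hy]
    | tmul s t =>
      have h2 : ∀ y : H ⊗[k] R, LinearMap.mul' k _ ((antipodeLin B).lTensor B.Bos
          (comulFst B B.Bos s * TensorProduct.map (inH B).toLinearMap (inR B).toLinearMap y)) =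
          inR B s * LinearMap.mul' k _ (TensorProduct.map (inH B).toLinearMap
            (antipodeR B) y) := by
        intro y
        induction y with
        | zero => simp
        | add x y hx hy => simp only [map_add, mul_add, hx, hy]
        | tmul x t => simp [comulFst, antipodeLin_inR, mul_assoc]
      refine (h2 (B.coact t)).trans ?_
      rw [h0, ← B.isCoaction.coassoc, LComod.mulAntipodeRight_comul,
        B.isCoaction.contract_counit]
      simp [P]
  refine (h1 _).trans ?_
  rw [B.mul_antipode_right]
  simp [Algebra.algebraMap_eq_smul_one]

theorem antipode_left_mul_comulH (x : B.Bos ⊗[k] B.Bos) (h : H) :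
    LinearMap.mul' k _ ((antipodeLin B).rTensor B.Bos (x * comulH B h)) =
      conv (LinearMap.mulRight k (LinearMap.mul' k _ ((antipodeLin B).rTensor B.Bos x)) ∘ₗ
        (inH B).toLinearMap ∘ₗ HopfAlgebra.antipode k) (inH B).toLinearMap h := by
  rw [conv_apply, comulH_apply]
  generalize Coalgebra.comul (R := k) h = d
  induction d with
  | zero => simp
  | add x y hx hy => simp only [map_add, mul_add, hx, hy]
  | tmul a b =>
    induction x with
    | zero => simp
    | add x y hx hy =>
      rw [add_mul, map_add, map_add, hx, hy, map_add, map_add, mulRight_add_eq, LinearMap.add_comp,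
        TensorProduct.map_add_left, LinearMap.add_apply, map_add]
    | tmul p q => simp [antipodeLin_mul_inH, mul_assoc]

theorem antipode_right_mul_comulH (x : B.Bos ⊗[k] B.Bos) (h : H) :
    LinearMap.mul' k _ ((antipodeLin B).lTensor B.Bos (x * comulH B h)) =
      Coalgebra.counit (R := k) h • LinearMap.mul' k _ ((antipodeLin B).lTensor B.Bos x) := by
  induction x with
  | zero => simp
  | add x y hx hy => simp only [map_add, add_mul, smul_add, hx, hy]
  | tmul p q =>
    have h1 : ∀ d : H ⊗[k] H, LinearMap.mul' k _ ((antipodeLin B).lTensor B.Bos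
        (p ⊗ₜ q * TensorProduct.map (inH B).toLinearMap (inH B).toLinearMap d)) =
        p * inH B (LinearMap.mul' k H ((HopfAlgebra.antipode k).lTensor H d)) *
          antipodeLin B q := by
      intro d
      induction d with
      | zero => simp
      | add x y hx hy => simp only [map_add, mul_add, add_mul, hx, hy]
      | tmul a b => simp [antipodeLin_mul_inH, mul_assoc]
    rw [comulH_apply, h1, HopfAlgebra.mul_antipode_lTensor_comul_apply]
    simp [Algebra.algebraMap_eq_smul_one]

theorem comulAlg_mul (r : R) (h : H) :
    comulAlg B (inR B r * inH B h) = comulR B r * comulH B h := by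
  rw [map_mul, comulAlg_inR, comulAlg_inH]

instance : HopfAlgebra k B.Bos where
  antipode := antipodeLin B
  mul_antipode_rTensor_comul := by
    ext a
    change LinearMap.mul' k _ ((antipodeLin B).rTensor B.Bos (comulAlg B a)) =
      algebraMap k _ (counitAlg B a)
    induction a using Bos.induction with
    | zero => simp
    | add a b ha hb => simp only [map_add, ha, hb]
    | mul r h =>
      have h2 : LinearMap.mul' k _ (TensorProduct.map ((inH B).toLinearMap ∘ₗ
          HopfAlgebra.antipode k) (inH B).toLinearMap (Coalgebra.comul (R := k) h)) =
          algebraMap k _ (Coalgebra.counit (R := k) h) := by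
        have h3 := LinearMap.congr_fun (algHom_conv (inH B) (HopfAlgebra.antipode k)
          LinearMap.id) h
        refine h3.symm.trans ?_
        rw [LinearMap.comp_apply, conv_apply]
        change inH B (LinearMap.mul' k H ((HopfAlgebra.antipode k).rTensor H _)) = _
        rw [HopfAlgebra.mul_antipode_rTensor_comul_apply]
        simp
      rw [comulAlg_mul, antipode_left_mul_comulH, antipode_left_inR, map_mul, counitAlg_inR,
        counitAlg_inH, map_mul, ← h2]
      rw [conv_apply]
      generalize Coalgebra.comul (R := k) h = d
      induction d with
      | zero => simp
      | add x y hx hy => simp only [map_add, mul_add, hx, hy]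
      | tmul a b => simp [Algebra.algebraMap_eq_smul_one]
  mul_antipode_lTensor_comul := by
    ext a
    change LinearMap.mul' k _ ((antipodeLin B).lTensor B.Bos (comulAlg B a)) =
      algebraMap k _ (counitAlg B a)
    induction a using Bos.induction with
    | zero => simp
    | add a b ha hb => simp only [map_add, ha, hb]
    | mul r h =>
      rw [comulAlg_mul, antipode_right_mul_comulH, antipode_right_inR, map_mul, counitAlg_inR,
        counitAlg_inH, map_mul]
      rw [Algebra.smul_def, Algebra.commutes]

end Bos

end BraidedHopfAlgebra

end

end BraidedCoFrob

namespace BraidedCoFrob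
noncomputable section

namespace BraidedHopfAlgebra

variable {k H R : Type u} [Field k] [Ring H] [HopfAlgebra k H]
  [Ring R] [Algebra k R] [Coalgebra k R] (B : BraidedHopfAlgebra k H R)

namespace Bos

/-! ### The projections of the bosonization -/

/-- The projection `r # h ↦ ε(h) r`. -/
def toR : B.Bos →ₗ[k] R :=
  (TensorProduct.rid k R).toLinearMap ∘ₗ Coalgebra.counit.lTensor R ∘ₗ (of B).symm.toLinearMap

/-- The projection `r # h ↦ ε(r) h`. -/
def toH : B.Bos →ₗ[k] H :=
  (TensorProduct.lid k H).toLinearMap ∘ₗ Coalgebra.counit.rTensor H ∘ₗ (of B).symm.toLinearMap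

theorem toR_mul (r : R) (h : H) :
    toR B (inR B r * inH B h) = Coalgebra.counit (R := k) h • r := by
  simp [toR, inR_mul_inH]

theorem toH_mul (r : R) (h : H) :
    toH B (inR B r * inH B h) = Coalgebra.counit (R := k) r • h := by
  simp [toH, inR_mul_inH]

theorem toR_inR (r : R) : toR B (inR B r) = r := by simpa using toR_mul B r 1

theorem toH_inR (r : R) : toH B (inR B r) = Coalgebra.counit (R := k) r • (1 : H) := by
  simpa using toH_mul B r 1

theorem toR_mul_inH (a : B.Bos) (h : H) :
    toR B (a * inH B h) = Coalgebra.counit (R := k) h • toR B a := by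
  induction a using Bos.induction with
  | zero => simp
  | add a b ha hb => simp only [add_mul, map_add, smul_add, ha, hb]
  | mul r g => rw [mul_assoc, ← map_mul, toR_mul, toR_mul, Bialgebra.counit_mul, mul_comm, mul_smul]

theorem toH_mul_inH (a : B.Bos) (h : H) : toH B (a * inH B h) = toH B a * h := by
  induction a using Bos.induction with
  | zero => simp
  | add a b ha hb => simp only [add_mul, map_add, ha, hb]
  | mul r g => rw [mul_assoc, ← map_mul, toH_mul, toH_mul, smul_mul_assoc]

theorem of_symm_mul (r : R) (h : H) : (of B).symm (inR B r * inH B h) = r ⊗ₜ h := by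
  simp [inR_mul_inH]

theorem comulFst_mul_map (s : R) (h : H) (t : R) :
    comulFst B B.Bos s * TensorProduct.map (inH B).toLinearMap (inR B).toLinearMap (h ⊗ₜ t) =
      (inR B s * inH B h) ⊗ₜ inR B t := by
  simp [comulFst]

theorem comulR_apply (r : R) : comulR B r = LinearMap.mul' k _
    (TensorProduct.map (comulFst B B.Bos).toLinearMap
      (TensorProduct.map (inH B).toLinearMap (inR B).toLinearMap ∘ₗ B.coact)
        (Coalgebra.comul (R := k) r)) := rfl

theorem map_toR_toR_comulR (r : R) :
    TensorProduct.map (toR B) (toR B) (comulR B r) = Coalgebra.comul (R := k) r := by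
  have h1 : ∀ (s : R) (y : H ⊗[k] R), TensorProduct.map (toR B) (toR B) (comulFst B B.Bos s *
      TensorProduct.map (inH B).toLinearMap (inR B).toLinearMap y) =
      s ⊗ₜ contract Coalgebra.counit y := by
    intro s y
    induction y with
    | zero => simp
    | add x y hx hy => simp only [map_add, mul_add, TensorProduct.tmul_add, hx, hy]
    | tmul x t =>
      rw [comulFst_mul_map, TensorProduct.map_tmul, toR_mul, toR_inR, contract_tmul,
        TensorProduct.smul_tmul]
  rw [comulR_apply]
  generalize Coalgebra.comul (R := k) r = d
  induction d with
  | zero => simp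
  | add x y hx hy => simp only [map_add, hx, hy]
  | tmul s t =>
    exact (h1 s (B.coact t)).trans (by rw [B.isCoaction.contract_counit])

theorem map_toR_toH_comulR (r : R) :
    TensorProduct.map (toR B) (toH B) (comulR B r) = r ⊗ₜ 1 := by
  have h1 : ∀ (s : R) (y : H ⊗[k] R), TensorProduct.map (toR B) (toH B) (comulFst B B.Bos s *
      TensorProduct.map (inH B).toLinearMap (inR B).toLinearMap y) =
      (Coalgebra.counit (R := k) (TensorProduct.rid k H (Coalgebra.counit.lTensor H y)) • s)
        ⊗ₜ 1 := by
    intro s y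
    induction y with
    | zero => simp
    | add x y hx hy => simp only [map_add, mul_add, add_smul, TensorProduct.add_tmul, hx, hy]
    | tmul x t =>
      rw [comulFst_mul_map, TensorProduct.map_tmul, toR_mul, toH_inR, ← TensorProduct.smul_tmul]
      simp [smul_smul]
  have h2 : ∀ d : R ⊗[k] R, TensorProduct.map (toR B) (toH B) (LinearMap.mul' k _
      (TensorProduct.map (comulFst B B.Bos).toLinearMap
        (TensorProduct.map (inH B).toLinearMap (inR B).toLinearMap ∘ₗ B.coact) d)) =
      (TensorProduct.rid k R (Coalgebra.counit.lTensor R d)) ⊗ₜ 1 := by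
    intro d
    induction d with
    | zero => simp
    | add x y hx hy => simp only [map_add, TensorProduct.add_tmul, hx, hy]
    | tmul s t =>
      refine (h1 s (B.coact t)).trans ?_
      rw [B.counit_coact]
      simp
  rw [comulR_apply, h2, Coalgebra.lTensor_counit_comul]
  simp

theorem map_toH_toH_comulR (r : R) :
    TensorProduct.map (toH B) (toH B) (comulR B r) = Coalgebra.counit (R := k) r • 1 ⊗ₜ 1 := by
  have h1 : ∀ (s : R) (y : H ⊗[k] R), TensorProduct.map (toH B) (toH B) (comulFst B B.Bos s *
      TensorProduct.map (inH B).toLinearMap (inR B).toLinearMap y) =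
      (Coalgebra.counit (R := k) s • TensorProduct.rid k H (Coalgebra.counit.lTensor H y))
        ⊗ₜ 1 := by
    intro s y
    induction y with
    | zero => simp
    | add x y hx hy => simp only [map_add, mul_add, smul_add, TensorProduct.add_tmul, hx, hy]
    | tmul x t =>
      rw [comulFst_mul_map, TensorProduct.map_tmul, toH_mul, toH_inR, ← TensorProduct.smul_tmul,
        smul_comm]
      simp
  have h2 : ∀ d : R ⊗[k] R, TensorProduct.map (toH B) (toH B) (LinearMap.mul' k _
      (TensorProduct.map (comulFst B B.Bos).toLinearMap
        (TensorProduct.map (inH B).toLinearMap (inR B).toLinearMap ∘ₗ B.coact) d)) =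
      Coalgebra.counit (R := k) (TensorProduct.rid k R (Coalgebra.counit.lTensor R d)) •
        1 ⊗ₜ 1 := by
    intro d
    induction d with
    | zero => simp
    | add x y hx hy => simp only [map_add, add_smul, hx, hy]
    | tmul s t =>
      refine (h1 s (B.coact t)).trans ?_
      rw [B.counit_coact]
      simp [TensorProduct.smul_tmul', smul_smul, mul_comm]
  rw [comulR_apply, h2, Coalgebra.lTensor_counit_comul]
  simp

theorem map_toH_toR_comulR (r : R) :
    TensorProduct.map (toH B) (toR B) (comulR B r) = B.coact r := by
  have h1 : ∀ (s : R) (y : H ⊗[k] R), TensorProduct.map (toH B) (toR B) (comulFst B B.Bos s *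
      TensorProduct.map (inH B).toLinearMap (inR B).toLinearMap y) =
      Coalgebra.counit (R := k) s • y := by
    intro s y
    induction y with
    | zero => simp
    | add x y hx hy => simp only [map_add, mul_add, smul_add, hx, hy]
    | tmul x t =>
      rw [comulFst_mul_map, TensorProduct.map_tmul, toH_mul, toR_inR, TensorProduct.smul_tmul']
  have h2 : ∀ d : R ⊗[k] R, TensorProduct.map (toH B) (toR B) (LinearMap.mul' k _
      (TensorProduct.map (comulFst B B.Bos).toLinearMap
        (TensorProduct.map (inH B).toLinearMap (inR B).toLinearMap ∘ₗ B.coact) d)) =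
      B.coact (contract Coalgebra.counit d) := by
    intro d
    induction d with
    | zero => simp
    | add x y hx hy => simp only [map_add, hx, hy]
    | tmul s t =>
      refine (h1 s (B.coact t)).trans ?_
      rw [contract_tmul, map_smul]
  rw [comulR_apply, h2, contract, LinearMap.comp_apply, Coalgebra.rTensor_counit_comul]
  simp

/-- Reduces identities for `Δ(r # h)` to the case `h = 1`, as long as the two maps transform under
right multiplication by `H`. -/
theorem map_mul_comulH {V W : Type u} [AddCommGroup V] [Module k V] [AddCommGroup W] [Module k W]
    (f : B.Bos →ₗ[k] V) (g : B.Bos →ₗ[k] W) (φ : H →ₗ[k] Module.End k V)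
    (γ : H →ₗ[k] Module.End k W) (hf : ∀ a h, f (a * inH B h) = φ h (f a))
    (hg : ∀ a h, g (a * inH B h) = γ h (g a)) (x : B.Bos ⊗[k] B.Bos) (h : H) :
    TensorProduct.map f g (x * comulH B h) = tensorAct φ γ h (TensorProduct.map f g x) := by
  rw [comulH_apply, tensorAct, LinearMap.comp_apply, LinearMap.comp_apply]
  generalize Coalgebra.comul (R := k) h = d
  induction d with
  | zero => simp
  | add x y hx hy => simp only [map_add, mul_add, LinearMap.add_apply, hx, hy]
  | tmul u v =>
    induction x with
    | zero => simp
    | add x y hx hy => simp only [map_add, add_mul, hx, hy]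
    | tmul p q => simp [hf, hg]

/-- The trivial action of `H` on a vector space. -/
def trivAct (V : Type u) [AddCommGroup V] [Module k V] : H →ₗ[k] Module.End k V :=
  (Algebra.linearMap k (Module.End k V)) ∘ₗ Coalgebra.counit

theorem trivAct_apply (V : Type u) [AddCommGroup V] [Module k V] (h : H) (v : V) :
    trivAct (k := k) V h v = Coalgebra.counit (R := k) h • v := by
  simp [trivAct]

theorem toR_mul_inH' (a : B.Bos) (h : H) : toR B (a * inH B h) = trivAct (k := k) R h (toR B a) := by
  rw [toR_mul_inH, trivAct_apply]

theorem toH_mul_inH' (a : B.Bos) (h : H) :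
    toH B (a * inH B h) = (LinearMap.mul k H).flip h (toH B a) := toH_mul_inH B a h

theorem map_toR_toR_comul (a : B.Bos) : TensorProduct.map (toR B) (toR B)
    (Coalgebra.comul (R := k) a) = Coalgebra.comul (R := k) (toR B a) := by
  rw [comul_eq]
  induction a using Bos.induction with
  | zero => simp
  | add a b ha hb => simp only [map_add, ha, hb]
  | mul r h =>
    rw [comulAlg_mul, map_mul_comulH B _ _ _ _ (toR_mul_inH' B) (toR_mul_inH' B),
      map_toR_toR_comulR, toR_mul, map_smul]
    generalize Coalgebra.comul (R := k) r = d
    induction d with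
    | zero => simp
    | add x y hx hy => simp only [map_add, smul_add, hx, hy]
    | tmul s t =>
      rw [tensorAct_tmul]
      have h1 : ∀ e : H ⊗[k] H, TensorProduct.map ((trivAct (k := k) (H := H) R).flip s)
          ((trivAct (k := k) (H := H) R).flip t) e =
          Coalgebra.counit (R := k) (TensorProduct.lid k H (Coalgebra.counit.rTensor H e)) •
            s ⊗ₜ t := by
        intro e
        induction e with
        | zero => simp
        | add x y hx hy => simp only [map_add, add_smul, hx, hy]
        | tmul u v => simp [trivAct_apply, TensorProduct.smul_tmul', TensorProduct.tmul_smul,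
            smul_smul, mul_comm]
      rw [h1, Coalgebra.rTensor_counit_comul]
      simp

/-- The two projections applied to `Δ(a)` recover `a`. Hence a coaction of the bosonization is
determined by its corestrictions to `R` and to `H`. -/
theorem map_toR_toH_comul (a : B.Bos) : TensorProduct.map (toR B) (toH B)
    (Coalgebra.comul (R := k) a) = (of B).symm a := by
  rw [comul_eq]
  induction a using Bos.induction with
  | zero => simp
  | add a b ha hb => simp only [map_add, ha, hb]
  | mul r h =>
    rw [comulAlg_mul, map_mul_comulH B _ _ _ _ (toR_mul_inH' B) (toH_mul_inH' B),
      map_toR_toH_comulR, of_symm_mul, tensorAct_tmul]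
    have h1 : ∀ e : H ⊗[k] H, TensorProduct.map ((trivAct (k := k) (H := H) R).flip r)
        ((LinearMap.mul k H).flip.flip 1) e =
        r ⊗ₜ TensorProduct.lid k H (Coalgebra.counit.rTensor H e) := by
      intro e
      induction e with
      | zero => simp
      | add x y hx hy => simp only [map_add, TensorProduct.tmul_add, hx, hy]
      | tmul u v => simp [trivAct_apply, TensorProduct.smul_tmul]
    rw [h1, Coalgebra.rTensor_counit_comul]
    simp

theorem map_toH_toH_comul (a : B.Bos) : TensorProduct.map (toH B) (toH B)
    (Coalgebra.comul (R := k) a) = Coalgebra.comul (R := k) (toH B a) := by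
  rw [comul_eq]
  induction a using Bos.induction with
  | zero => simp
  | add a b ha hb => simp only [map_add, ha, hb]
  | mul r h =>
    rw [comulAlg_mul, map_mul_comulH B _ _ _ _ (toH_mul_inH' B) (toH_mul_inH' B),
      map_toH_toH_comulR, toH_mul, map_smul, map_smul, tensorAct_tmul]
    have h1 : (LinearMap.mul k H).flip.flip 1 = LinearMap.id := by ext; simp
    rw [h1, TensorProduct.map_id]
    rfl

/-- The opposite order of projections yields `r₍₋₁₎ h ⊗ r₍₀₎`; this is what makes the corestricted
`R`-coaction colinear over `H`. -/
theorem map_toH_toR_comul (a : B.Bos) : TensorProduct.map (toH B) (toR B)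
    (Coalgebra.comul (R := k) a) = LinearMap.mul' k _ (TensorProduct.map B.coact
      (inLeft (k := k) (H := H) (R := R)).toLinearMap ((of B).symm a)) := by
  rw [comul_eq]
  induction a using Bos.induction with
  | zero => simp
  | add a b ha hb => simp only [map_add, ha, hb]
  | mul r h =>
    rw [comulAlg_mul, map_mul_comulH B _ _ _ _ (toH_mul_inH' B) (toR_mul_inH' B),
      map_toH_toR_comulR, of_symm_mul, TensorProduct.map_tmul, LinearMap.mul'_apply]
    generalize B.coact r = y
    induction y with
    | zero => simp
    | add x y hx hy => simp only [map_add, add_mul, hx, hy]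
    | tmul x t =>
      rw [tensorAct_tmul]
      have h1 : ∀ e : H ⊗[k] H, TensorProduct.map ((LinearMap.mul k H).flip.flip x)
          ((trivAct (k := k) (H := H) R).flip t) e =
          (x * TensorProduct.rid k H (Coalgebra.counit.lTensor H e)) ⊗ₜ t := by
        intro e
        induction e with
        | zero => simp
        | add x y hx hy => simp only [map_add, mul_add, TensorProduct.add_tmul, hx, hy]
        | tmul u v => simp [trivAct_apply, TensorProduct.smul_tmul']
      rw [h1, Coalgebra.lTensor_counit_comul]
      simp [inLeft]

theorem counit_toR (a : B.Bos) :
    Coalgebra.counit (R := k) (toR B a) = Coalgebra.counit (R := k) a := by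
  rw [counit_eq]
  induction a using Bos.induction with
  | zero => simp
  | add a b ha hb => simp only [map_add, ha, hb]
  | mul r h => rw [toR_mul, map_mul, counitAlg_inR, counitAlg_inH, map_smul, smul_eq_mul, mul_comm]

theorem counit_toH (a : B.Bos) :
    Coalgebra.counit (R := k) (toH B a) = Coalgebra.counit (R := k) a := by
  rw [counit_eq]
  induction a using Bos.induction with
  | zero => simp
  | add a b ha hb => simp only [map_add, ha, hb]
  | mul r h => rw [toH_mul, map_mul, counitAlg_inR, counitAlg_inH, map_smul, smul_eq_mul]

end Bos

end BraidedHopfAlgebra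

end

end BraidedCoFrob

namespace BraidedCoFrob
noncomputable section

/-! ### Corestriction of coactions -/

section Corestrict

variable {k C D V W M : Type u} [Field k] [AddCommGroup C] [Module k C] [Coalgebra k C]
  [AddCommGroup D] [Module k D] [Coalgebra k D] [AddCommGroup V] [Module k V]
  [AddCommGroup W] [Module k W] [AddCommGroup M] [Module k M]

/-- By coassociativity, performing two corestrictions in succession is one corestriction along `Δ`.
-/
theorem IsCoaction.lTensor_rTensor {ρ : M →ₗ[k] C ⊗[k] M} (hρ : IsCoaction ρ) (f : C →ₗ[k] V)
    (g : C →ₗ[k] W) (m : M) : (g.rTensor M ∘ₗ ρ).lTensor V (f.rTensor M (ρ m)) =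
      TensorProduct.assoc k V W M ((TensorProduct.map f g ∘ₗ Coalgebra.comul).rTensor M (ρ m)) := by
  have h1 : ∀ x : C ⊗[k] M, (g.rTensor M ∘ₗ ρ).lTensor V (f.rTensor M x) =
      TensorProduct.map f (g.rTensor M) (ρ.lTensor C x) := by
    intro x
    induction x with
    | zero => simp
    | add x y hx hy => simp only [map_add, hx, hy]
    | tmul c v => simp
  have h2 : ∀ x : (C ⊗[k] C) ⊗[k] M, TensorProduct.map f (g.rTensor M)
      (TensorProduct.assoc k C C M x) =
      TensorProduct.assoc k V W M ((TensorProduct.map f g).rTensor M x) := by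
    intro x
    induction x with
    | zero => simp
    | add x y hx hy => simp only [map_add, hx, hy]
    | tmul c v =>
      induction c with
      | zero => simp
      | add x y hx hy => simp only [map_add, TensorProduct.add_tmul, hx, hy]
      | tmul a b => simp
  rw [h1, ← hρ.coassoc, h2, LinearMap.rTensor_comp_apply]

theorem IsCoaction.corestrict {ρ : M →ₗ[k] C ⊗[k] M} (hρ : IsCoaction ρ) (f : C →ₗ[k] D)
    (hf : ∀ c, TensorProduct.map f f (Coalgebra.comul (R := k) c) = Coalgebra.comul (R := k) (f c))
    (hε : ∀ c, Coalgebra.counit (R := k) (f c) = Coalgebra.counit (R := k) c) :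
    IsCoaction (f.rTensor M ∘ₗ ρ) where
  coassoc m := by
    have h1 : TensorProduct.map f f ∘ₗ Coalgebra.comul (R := k) = Coalgebra.comul ∘ₗ f :=
      LinearMap.ext hf
    rw [LinearMap.comp_apply, hρ.lTensor_rTensor, h1, LinearMap.rTensor_comp_apply]
  counit m := by
    have h1 : Coalgebra.counit (R := k) ∘ₗ f = Coalgebra.counit := LinearMap.ext hε
    rw [LinearMap.comp_apply, ← LinearMap.rTensor_comp_apply, h1, hρ.counit]

end Corestrict

namespace BraidedHopfAlgebra

variable {k H R : Type u} [Field k] [Ring H] [HopfAlgebra k H]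
  [Ring R] [Algebra k R] [Coalgebra k R] (B : BraidedHopfAlgebra k H R)

namespace Bos

/-! ### Comodules over the bosonization -/

section Glue

variable (V W : Type u) [AddCommGroup V] [Module k V] [AddCommGroup W] [Module k W]

/-- The isomorphism `r ⊗ (h ⊗ v) ↦ (r # h) ⊗ v`. -/
def glue : R ⊗[k] (H ⊗[k] V) →ₗ[k] B.Bos ⊗[k] V :=
  (of B).toLinearMap.rTensor V ∘ₗ (TensorProduct.assoc k R H V).symm.toLinearMap

theorem glue_tmul (r : R) (h : H) (v : V) :
    glue B V (r ⊗ₜ (h ⊗ₜ v)) = (inR B r * inH B h) ⊗ₜ v := by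
  simp [glue, inR_mul_inH]

variable {V W}

theorem glue_lTensor (f : V →ₗ[k] W) (x : R ⊗[k] (H ⊗[k] V)) :
    glue B W ((f.lTensor H).lTensor R x) = f.lTensor B.Bos (glue B V x) := by
  induction x with
  | zero => simp
  | add x y hx hy => simp only [map_add, hx, hy]
  | tmul r y =>
    induction y with
    | zero => simp
    | add x y hx hy => simp only [map_add, TensorProduct.tmul_add, hx, hy]
    | tmul h v => simp [glue_tmul]

theorem rTensor_toR_glue (x : R ⊗[k] (H ⊗[k] V)) :
    (toR B).rTensor V (glue B V x) = (contract Coalgebra.counit).lTensor R x := by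
  induction x with
  | zero => simp
  | add x y hx hy => simp only [map_add, hx, hy]
  | tmul r y =>
    induction y with
    | zero => simp
    | add x y hx hy => simp only [map_add, TensorProduct.tmul_add, hx, hy]
    | tmul h v => simp [glue_tmul, toR_mul, TensorProduct.smul_tmul]

theorem rTensor_toH_glue (x : R ⊗[k] (H ⊗[k] V)) :
    (toH B).rTensor V (glue B V x) = contract Coalgebra.counit x := by
  induction x with
  | zero => simp
  | add x y hx hy => simp only [map_add, hx, hy]
  | tmul r y =>
    induction y with
    | zero => simp
    | add x y hx hy => simp only [map_add, TensorProduct.tmul_add, hx, hy]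
    | tmul h v => simp [glue_tmul, toH_mul, TensorProduct.smul_tmul']

theorem contract_counit_glue (x : R ⊗[k] (H ⊗[k] V)) :
    contract Coalgebra.counit (glue B V x) =
      contract Coalgebra.counit ((contract Coalgebra.counit).lTensor R x) := by
  have h1 : Coalgebra.counit (R := k) ∘ₗ toR B = Coalgebra.counit := LinearMap.ext (counit_toR B)
  rw [← rTensor_toR_glue, contract, contract, LinearMap.comp_apply, LinearMap.comp_apply,
    ← LinearMap.rTensor_comp_apply, h1]

/-- The `H`-part of this coassociativity is that of `ρ`; the `R`-part leaves the codiagonal coaction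
on `R ⊗ V`, ready for the colinearity axiom of a braided comodule. -/
theorem assoc_comul_glue {ρ : V →ₗ[k] H ⊗[k] V} (hρ : IsCoaction ρ) (r : R) (v : V) :
    TensorProduct.assoc k _ _ _ (Coalgebra.comul.rTensor V (glue B V (r ⊗ₜ ρ v))) =
      (glue B V ∘ₗ ρ.lTensor R).lTensor B.Bos (glue B (R ⊗[k] V)
        ((tensorCoact B.coact ρ).lTensor R
          (TensorProduct.assoc k R R V (Coalgebra.comul (R := k) r ⊗ₜ v)))) := by
  let Q (s : R) (x : H) (t : R) : H ⊗[k] (H ⊗[k] V) →ₗ[k] B.Bos ⊗[k] (B.Bos ⊗[k] V) :=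
    TensorProduct.map (LinearMap.mulLeft k (inR B s * inH B x) ∘ₗ (inH B).toLinearMap)
      (glue B V ∘ₗ TensorProduct.mk k R (H ⊗[k] V) t)
  have h1 : ∀ (s : R) (x : H) (t : R) (w : H ⊗[k] V), TensorProduct.assoc k _ _ _
      ((LinearMap.mulLeft k ((inR B s * inH B x) ⊗ₜ inR B t) ∘ₗ
        (comulH B).toLinearMap).rTensor V w) =
      Q s x t (TensorProduct.assoc k H H V (Coalgebra.comul.rTensor V w)) := by
    intro s x t w
    induction w with
    | zero => simp
    | add x y hx hy => simp only [map_add, hx, hy]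
    | tmul h v =>
      simp only [LinearMap.rTensor_tmul, LinearMap.comp_apply, AlgHom.toLinearMap_apply,
        comulH_apply]
      generalize Coalgebra.comul (R := k) h = d
      induction d with
      | zero => simp
      | add x y hx hy => simp only [map_add, TensorProduct.add_tmul, hx, hy]
      | tmul a b => simp [Q, glue_tmul, mul_assoc]
  have h2 : ∀ (s : R) (x : H) (t : R) (w : H ⊗[k] V),
      (glue B V ∘ₗ ρ.lTensor R).lTensor B.Bos (glue B (R ⊗[k] V)
        (s ⊗ₜ mulTensor k H R V ((x ⊗ₜ t) ⊗ₜ w))) = Q s x t (ρ.lTensor H w) := by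
    intro s x t w
    induction w with
    | zero => simp
    | add x y hx hy => simp only [map_add, TensorProduct.tmul_add, hx, hy]
    | tmul h v => simp [Q, mulTensor_tmul, glue_tmul]
  have hadd : ∀ x y : B.Bos ⊗[k] B.Bos,
      (LinearMap.mulLeft k (x + y) ∘ₗ (comulH B).toLinearMap).rTensor V =
      (LinearMap.mulLeft k x ∘ₗ (comulH B).toLinearMap).rTensor V +
        (LinearMap.mulLeft k y ∘ₗ (comulH B).toLinearMap).rTensor V := by
    intro x y
    rw [← LinearMap.rTensor_add, ← LinearMap.add_comp]
    congr 2
    exact LinearMap.ext fun z => add_mul x y z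
  have h3 : ∀ (s : R) (y : H ⊗[k] R), TensorProduct.assoc k _ _ _
      ((LinearMap.mulLeft k (comulFst B B.Bos s *
        TensorProduct.map (inH B).toLinearMap (inR B).toLinearMap y) ∘ₗ
        (comulH B).toLinearMap).rTensor V (ρ v)) =
      (glue B V ∘ₗ ρ.lTensor R).lTensor B.Bos (glue B (R ⊗[k] V)
        (s ⊗ₜ mulTensor k H R V (y ⊗ₜ ρ v))) := by
    intro s y
    induction y with
    | zero => simp
    | add x y hx hy =>
      simp only [map_add, mul_add, TensorProduct.tmul_add, TensorProduct.add_tmul, hadd,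
        LinearMap.add_apply, ← hx, ← hy]
    | tmul x t => rw [comulFst_mul_map, h1, h2, hρ.coassoc]
  have h4 : ∀ w : H ⊗[k] V, Coalgebra.comul.rTensor V (glue B V (r ⊗ₜ w)) =
      (LinearMap.mulLeft k (comulR B r) ∘ₗ (comulH B).toLinearMap).rTensor V w := by
    intro w
    induction w with
    | zero => simp
    | add x y hx hy => simp only [map_add, TensorProduct.tmul_add, hx, hy]
    | tmul h v =>
      rw [glue_tmul, LinearMap.rTensor_tmul, comul_eq, comulAlg_mul]
      simp
  rw [h4, comulR_apply]
  generalize Coalgebra.comul (R := k) r = d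
  induction d with
  | zero => simp
  | add x y hx hy =>
    simp only [map_add, TensorProduct.add_tmul, hadd,
        LinearMap.add_apply, ← hx, ← hy]
  | tmul s t => exact h3 s (B.coact t)

end Glue

variable {B} in
/-- The coaction of the bosonization on a comodule in the braided sense. -/
def bosCoact (M : BrComod B) : M.carrier →ₗ[k] B.Bos ⊗[k] M.carrier :=
  glue B M.carrier ∘ₗ M.hcoact.lTensor R ∘ₗ M.rcoact

variable {B} in
theorem contract_hcoact (M : BrComod B) :
    contract (Coalgebra.counit (R := k)) ∘ₗ M.hcoact = LinearMap.id :=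
  LinearMap.ext M.hcoact_isCoaction.contract_counit

variable {B} in
theorem rTensor_toR_bosCoact (M : BrComod B) (m : M.carrier) :
    (toR B).rTensor M.carrier (bosCoact M m) = M.rcoact m := by
  rw [bosCoact, LinearMap.comp_apply, rTensor_toR_glue, LinearMap.comp_apply,
    ← LinearMap.lTensor_comp_apply, contract_hcoact, LinearMap.lTensor_id, LinearMap.id_apply]

variable {B} in
theorem rTensor_toH_bosCoact (M : BrComod B) (m : M.carrier) :
    (toH B).rTensor M.carrier (bosCoact M m) = M.hcoact m := by
  rw [bosCoact, LinearMap.comp_apply, rTensor_toH_glue, LinearMap.comp_apply, contract_lTensor,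
    M.rcoact_isCoaction.contract_counit]

-- Coassociativity combines those of the two coactions with the fact that the `R`-coaction is
-- `H`-colinear.
variable {B} in
theorem isCoaction_bosCoact (M : BrComod B) : IsCoaction (bosCoact M) where
  coassoc m := by
    have h1 : ∀ x : R ⊗[k] M.carrier, TensorProduct.assoc k _ _ _
        (Coalgebra.comul.rTensor M.carrier (glue B M.carrier (M.hcoact.lTensor R x))) =
        (glue B M.carrier ∘ₗ M.hcoact.lTensor R).lTensor B.Bos (glue B (R ⊗[k] M.carrier)
          ((tensorCoact B.coact M.hcoact).lTensor R (TensorProduct.assoc k R R M.carrier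
            (Coalgebra.comul.rTensor M.carrier x)))) := by
      intro x
      induction x with
      | zero => simp
      | add x y hx hy => simp only [map_add, hx, hy]
      | tmul r v => exact assoc_comul_glue B M.hcoact_isCoaction r v
    have h2 : tensorCoact B.coact M.hcoact ∘ₗ M.rcoact = M.rcoact.lTensor H ∘ₗ M.hcoact :=
      LinearMap.ext fun v => (M.colinear v).symm
    refine (h1 (M.rcoact m)).trans ?_
    rw [M.rcoact_isCoaction.coassoc, ← LinearMap.lTensor_comp_apply, h2,
      LinearMap.lTensor_comp_apply R, glue_lTensor, ← LinearMap.lTensor_comp_apply]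
    rfl
  counit m := by
    change contract _ (glue B M.carrier (M.hcoact.lTensor R (M.rcoact m))) = m
    rw [contract_counit_glue, ← LinearMap.lTensor_comp_apply, contract_hcoact,
      LinearMap.lTensor_id, LinearMap.id_apply, M.rcoact_isCoaction.contract_counit]

/-- The functor from comodules in the braided sense to comodules over the bosonization. -/
def toBos : BrComod B ⥤ LComod k B.Bos where
  obj M := { carrier := M.carrier, coact := bosCoact M, isCoaction := isCoaction_bosCoact M }
  map {M N} f := LComod.Hom.mk (BrComod.lin f) fun m => by
    have h1 : N.hcoact ∘ₗ BrComod.lin f = (BrComod.lin f).lTensor H ∘ₗ M.hcoact :=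
      LinearMap.ext f.hcolinear
    change glue B _ (N.hcoact.lTensor R (N.rcoact (BrComod.lin f m))) = _
    rw [show N.rcoact (BrComod.lin f m) = (BrComod.lin f).lTensor R (M.rcoact m) from
      f.rcolinear m, ← LinearMap.lTensor_comp_apply, h1, LinearMap.lTensor_comp_apply,
      glue_lTensor]
    rfl

instance : (toBos B).Faithful where
  map_injective h := BrComod.Hom.ext (congrArg LComod.lin h)

/-- The coactions of `R` and `H` are corestrictions of the glued coaction, so a map colinear over
the bosonization is colinear over both. -/
instance : (toBos B).Full where
  map_surjective {M N} f := by
    let g : M.carrier →ₗ[k] N.carrier := LComod.lin f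
    have hf : ∀ m, bosCoact N (g m) = g.lTensor B.Bos (bosCoact M m) := LComod.lin_colinear f
    refine ⟨BrComod.Hom.mk g (fun m => ?_) fun m => ?_, rfl⟩
    · rw [← rTensor_toH_bosCoact, ← rTensor_toH_bosCoact, hf]
      exact LinearMap.congr_fun ((LinearMap.rTensor_comp_lTensor _ _ _).trans
        (LinearMap.lTensor_comp_rTensor _ _ _).symm) (bosCoact M m)
    · rw [← rTensor_toR_bosCoact, ← rTensor_toR_bosCoact, hf]
      exact LinearMap.congr_fun ((LinearMap.rTensor_comp_lTensor _ _ _).trans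
        (LinearMap.lTensor_comp_rTensor _ _ _).symm) (bosCoact M m)

/-- The comodule in the braided sense underlying a comodule over the bosonization. -/
def ofBos (N : LComod k B.Bos) : BrComod B where
  carrier := N.carrier
  hcoact := (toH B).rTensor N.carrier ∘ₗ N.coact
  rcoact := (toR B).rTensor N.carrier ∘ₗ N.coact
  hcoact_isCoaction := N.isCoaction.corestrict _ (map_toH_toH_comul B) (counit_toH B)
  rcoact_isCoaction := N.isCoaction.corestrict _ (map_toR_toR_comul B) (counit_toR B)
  colinear v := by
    let σ : N.carrier →ₗ[k] H ⊗[k] N.carrier := (toH B).rTensor N.carrier ∘ₗ N.coact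
    have h1 : ∀ x : R ⊗[k] N.carrier, tensorCoact B.coact σ x =
        mulTensor k H R N.carrier (B.coact.rTensor (H ⊗[k] N.carrier) (σ.lTensor R x)) := by
      intro x
      induction x with
      | zero => simp
      | add x y hx hy => simp only [map_add, hx, hy]
      | tmul r v => simp [tensorCoact_eq]
    have h2 : ∀ (z : R ⊗[k] H) (v : N.carrier), TensorProduct.assoc k H R N.carrier
        (LinearMap.mul' k _ (TensorProduct.map B.coact
          (inLeft (k := k) (H := H) (R := R)).toLinearMap z) ⊗ₜ v) =
        mulTensor k H R N.carrier (B.coact.rTensor (H ⊗[k] N.carrier)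
          (TensorProduct.assoc k R H N.carrier (z ⊗ₜ v))) := by
      intro z v
      induction z with
      | zero => simp
      | add x y hx hy => simp only [map_add, TensorProduct.add_tmul, hx, hy]
      | tmul r h =>
        simp only [TensorProduct.map_tmul, LinearMap.mul'_apply, TensorProduct.assoc_tmul,
          LinearMap.rTensor_tmul]
        generalize B.coact r = y
        induction y with
        | zero => simp
        | add x y hx hy => simp only [map_add, TensorProduct.add_tmul, add_mul, hx, hy]
        | tmul x t => simp [inLeft, mulTensor_tmul]
    -- Both sides become corestrictions of the given coaction along `Δ`, composed with the two
    -- orders of the projections.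
    rw [LinearMap.comp_apply, N.isCoaction.lTensor_rTensor]
    refine Eq.trans ?_ (h1 _).symm
    rw [LinearMap.comp_apply, N.isCoaction.lTensor_rTensor]
    generalize N.coact v = x
    induction x with
    | zero => simp
    | add x y hx hy => simp only [map_add, hx, hy]
    | tmul a v =>
      rw [LinearMap.rTensor_tmul, LinearMap.rTensor_tmul, LinearMap.comp_apply,
        LinearMap.comp_apply, map_toH_toR_comul, map_toR_toH_comul, h2]

theorem bosCoact_ofBos (N : LComod k B.Bos) : bosCoact (ofBos B N) = N.coact := by
  have h1 : TensorProduct.map (toR B) (toH B) ∘ₗ Coalgebra.comul = (of B).symm.toLinearMap :=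
    LinearMap.ext (map_toR_toH_comul B)
  have h2 : (of B).toLinearMap ∘ₗ (of B).symm.toLinearMap = LinearMap.id := by ext; simp
  refine LinearMap.ext fun (n : N.carrier) => ?_
  change glue B N.carrier (((toH B).rTensor N.carrier ∘ₗ N.coact).lTensor R
    ((toR B).rTensor N.carrier (N.coact n))) = _
  rw [N.isCoaction.lTensor_rTensor, h1, glue, LinearMap.comp_apply, LinearEquiv.coe_coe,
    LinearEquiv.symm_apply_apply, ← LinearMap.rTensor_comp_apply, h2, LinearMap.rTensor_id]
  rfl

theorem toBos_obj_ofBos (N : LComod k B.Bos) : (toBos B).obj (ofBos B N) = N := by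
  have h := bosCoact_ofBos B N
  obtain ⟨V, ρ, hρ⟩ := N
  change LComod.mk V (bosCoact (ofBos B ⟨V, ρ, hρ⟩)) _ = _
  congr

/-- Surjectivity holds up to equality, not merely isomorphism, so quantifiers over comodules of the
bosonization transfer literally. -/
theorem toBos_obj_surjective : Function.Surjective (toBos B).obj :=
  fun N => ⟨_, toBos_obj_ofBos B N⟩

instance : (toBos B).EssSurj where
  mem_essImage N := ⟨ofBos B N, ⟨eqToIso (toBos_obj_ofBos B N)⟩⟩

instance : (toBos B).IsEquivalence where

end Bos

end BraidedHopfAlgebra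

end

end BraidedCoFrob

namespace BraidedCoFrob
noncomputable section

namespace BraidedHopfAlgebra

variable {k H R : Type u} [Field k] [Ring H] [HopfAlgebra k H]
  [Ring R] [Algebra k R] [Coalgebra k R] (B : BraidedHopfAlgebra k H R)

namespace Bos

open MonoidalCategory

/-! ### Transport along the equivalence -/

variable {B}

theorem injective_toBos_iff (M : BrComod B) : Injective ((toBos B).obj M) ↔ Injective M :=
  (toBos B).asEquivalence.map_injective_iff M

theorem projective_toBos_iff (M : BrComod B) : Projective ((toBos B).obj M) ↔ Projective M :=
  (toBos B).asEquivalence.map_projective_iff M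

theorem nonZero_toBos_iff (M : BrComod B) : ((toBos B).obj M).NonZero ↔ M.NonZero := Iff.rfl

theorem finDim_toBos_iff (M : BrComod B) : ((toBos B).obj M).FinDim ↔ M.FinDim := Iff.rfl

theorem toBos_map_eq_zero_iff {M N : BrComod B} (f : M ⟶ N) : (toBos B).map f = 0 ↔ f = 0 :=
  ⟨fun h => (toBos B).map_injective h, fun h => h ▸ rfl⟩

theorem simple_toBos_iff (S : BrComod B) : Simple ((toBos B).obj S) ↔ Simple S := by
  constructor
  · intro h
    refine ⟨fun {Y} f hf => ?_⟩
    have : Mono ((toBos B).map f) := inferInstance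
    rw [← isIso_iff_of_reflects_iso f (toBos B), h.mono_isIso_iff_nonzero, Ne,
      toBos_map_eq_zero_iff]
  · intro h
    refine ⟨fun {Y} f hf => ?_⟩
    obtain ⟨Y, rfl⟩ := toBos_obj_surjective B Y
    obtain ⟨f, rfl⟩ := (toBos B).map_surjective f
    have : Mono f := (toBos B).mono_of_mono_map hf
    rw [isIso_iff_of_reflects_iso f (toBos B), h.mono_isIso_iff_nonzero, Ne, Ne,
      toBos_map_eq_zero_iff]

theorem isInjectiveHull_toBos_iff {M E : BrComod B} (i : M ⟶ E) :
    LComod.IsInjectiveHull ((toBos B).map i) ↔ BrComod.IsInjectiveHull i := by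
  constructor
  · intro h
    refine ⟨(injective_toBos_iff E).mp h.injective, (toBos B).mono_of_mono_map h.mono, ?_⟩
    intro X g hg
    refine (toBos B).mono_of_mono_map (h.essential ((toBos B).map g) ?_)
    rw [← Functor.map_comp]
    infer_instance
  · intro h
    have := h.mono
    refine ⟨(injective_toBos_iff E).mpr h.injective, inferInstance, ?_⟩
    intro X g hg
    obtain ⟨X, rfl⟩ := toBos_obj_surjective B X
    obtain ⟨g, rfl⟩ := (toBos B).map_surjective g
    rw [← Functor.map_comp] at hg
    have := h.essential g ((toBos B).mono_of_mono_map hg)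
    infer_instance

theorem isProjectiveCover_toBos_iff {P M : BrComod B} (p : P ⟶ M) :
    LComod.IsProjectiveCover ((toBos B).map p) ↔ BrComod.IsProjectiveCover p := by
  constructor
  · intro h
    refine ⟨(projective_toBos_iff P).mp h.projective, (toBos B).epi_of_epi_map h.epi, ?_⟩
    intro X g hg
    refine (toBos B).epi_of_epi_map (h.superfluous ((toBos B).map g) ?_)
    rw [← Functor.map_comp]
    infer_instance
  · intro h
    have := h.epi
    refine ⟨(projective_toBos_iff P).mpr h.projective, inferInstance, ?_⟩
    intro X g hg
    obtain ⟨X, rfl⟩ := toBos_obj_surjective B X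
    obtain ⟨g, rfl⟩ := (toBos B).map_surjective g
    rw [← Functor.map_comp] at hg
    have := h.superfluous g ((toBos B).epi_of_epi_map hg)
    infer_instance

theorem hasFinDimInjectiveHull_toBos_iff (M : BrComod B) :
    ((toBos B).obj M).HasFinDimInjectiveHull ↔ M.HasFinDimInjectiveHull := by
  constructor
  · rintro ⟨E, i, hi, hE⟩
    obtain ⟨E, rfl⟩ := toBos_obj_surjective B E
    obtain ⟨i, rfl⟩ := (toBos B).map_surjective i
    exact ⟨E, i, (isInjectiveHull_toBos_iff i).mp hi, hE⟩
  · rintro ⟨E, i, hi, hE⟩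
    exact ⟨(toBos B).obj E, (toBos B).map i, (isInjectiveHull_toBos_iff i).mpr hi, hE⟩

theorem hasProjectiveCover_toBos_iff (M : BrComod B) :
    ((toBos B).obj M).HasProjectiveCover ↔ M.HasProjectiveCover := by
  constructor
  · rintro ⟨P, p, hp⟩
    obtain ⟨P, rfl⟩ := toBos_obj_surjective B P
    obtain ⟨p, rfl⟩ := (toBos B).map_surjective p
    exact ⟨P, p, (isProjectiveCover_toBos_iff p).mp hp⟩
  · rintro ⟨P, p, hp⟩
    exact ⟨(toBos B).obj P, (toBos B).map p, (isProjectiveCover_toBos_iff p).mpr hp⟩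

theorem hasFinDimQuotient_toBos_iff (M : BrComod B) :
    ((toBos B).obj M).HasFinDimQuotient ↔ M.HasFinDimQuotient := by
  constructor
  · rintro ⟨N, p, hp, hN, hN'⟩
    obtain ⟨N, rfl⟩ := toBos_obj_surjective B N
    obtain ⟨p, rfl⟩ := (toBos B).map_surjective p
    exact ⟨N, p, hp, hN, hN'⟩
  · rintro ⟨N, p, hp, hN, hN'⟩
    exact ⟨(toBos B).obj N, (toBos B).map p, hp, hN, hN'⟩

variable (B)

theorem toBos_obj_unit : (toBos B).obj (BrComod.unit B) = 𝟙_ (LComod k B.Bos) := by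
  have h : bosCoact (BrComod.unit B) = TensorProduct.mk k B.Bos k 1 := by
    ext
    change glue B k (1 ⊗ₜ (1 ⊗ₜ 1)) = 1 ⊗ₜ 1
    rw [glue_tmul, map_one, map_one, one_mul]
  change LComod.mk k (bosCoact (BrComod.unit B)) _ = LComod.mk k (TensorProduct.mk k B.Bos k 1) _
  congr

/-- The equivalence preserves and reflects every notion involved, including the underlying spaces
and the unit object, so the list for the bosonization is transported entry by entry. -/
theorem tfae_brComod : List.TFAE [
    IsLeftCoFrobenius k B.Bos,
    ∀ S : BrComod B, Simple S → S.HasFinDimInjectiveHull,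
    (BrComod.unit B).HasFinDimInjectiveHull,
    ∃ M : BrComod B, M.NonZero ∧ Injective M ∧ M.FinDim,
    ∀ M : BrComod B, M.NonZero → M.HasFinDimQuotient,
    ∀ M : BrComod B, M.NonZero → Injective M → M.HasFinDimQuotient,
    ∃ M : BrComod B, M.NonZero ∧ Injective M ∧ M.HasFinDimQuotient,
    ∃ P : BrComod B, P.NonZero ∧ Projective P,
    ∀ M : BrComod B, M.HasProjectiveCover,
    ∀ M : BrComod B, Injective M → Projective M] := by
  have h := LComod.tfae_isLeftCoFrobenius k B.Bos
  rw [← toBos_obj_unit] at h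
  simpa only [(toBos_obj_surjective B).forall, (toBos_obj_surjective B).exists,
    injective_toBos_iff, projective_toBos_iff, nonZero_toBos_iff, finDim_toBos_iff,
    simple_toBos_iff, hasFinDimInjectiveHull_toBos_iff, hasProjectiveCover_toBos_iff,
    hasFinDimQuotient_toBos_iff] using h

end Bos

end BraidedHopfAlgebra

end

end BraidedCoFrob

namespace BraidedCoFrob
noncomputable section

/-! ### The inverse of the antipode -/

section AntipodeInv

variable {k H : Type u} [Field k] [Ring H] [HopfAlgebra k H]
  (hS : Function.Bijective (HopfAlgebra.antipode k (A := H)))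

/-- The inverse of a bijective antipode. -/
def antipodeInv : H →ₗ[k] H :=
  (LinearEquiv.ofBijective (HopfAlgebra.antipode k (A := H)) hS).symm.toLinearMap

theorem antipode_antipodeInv (x : H) : HopfAlgebra.antipode k (antipodeInv hS x) = x :=
  (LinearEquiv.ofBijective (HopfAlgebra.antipode k (A := H)) hS).apply_symm_apply x

theorem antipodeInv_mul (x y : H) :
    antipodeInv hS (x * y) = antipodeInv hS y * antipodeInv hS x := by
  apply hS.1
  rw [HopfAlgebra.antipode_mul_antidistrib, antipode_antipodeInv, antipode_antipodeInv,
    antipode_antipodeInv]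

/-- The map `x ⊗ y ↦ S⁻¹(y) x`. -/
def invMul : H ⊗[k] H →ₗ[k] H :=
  LinearMap.mul' k H ∘ₗ (antipodeInv hS).rTensor H ∘ₗ (TensorProduct.comm k H H).toLinearMap

/-- The map `x ⊗ y ↦ y S⁻¹(x)`. -/
def mulInv : H ⊗[k] H →ₗ[k] H :=
  LinearMap.mul' k H ∘ₗ (antipodeInv hS).lTensor H ∘ₗ (TensorProduct.comm k H H).toLinearMap

@[simp]
theorem invMul_tmul (x y : H) : invMul hS (x ⊗ₜ y) = antipodeInv hS y * x := by simp [invMul]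

@[simp]
theorem mulInv_tmul (x y : H) : mulInv hS (x ⊗ₜ y) = y * antipodeInv hS x := by simp [mulInv]

/-- Applying the antipode turns `S⁻¹(x₍₂₎) x₍₁₎` into `S(x₍₁₎) x₍₂₎`. -/
theorem invMul_comul (x : H) :
    invMul hS (Coalgebra.comul (R := k) x) = algebraMap k H (Coalgebra.counit (R := k) x) := by
  apply hS.1
  have h1 : ∀ d : H ⊗[k] H, HopfAlgebra.antipode k (invMul hS d) =
      LinearMap.mul' k H ((HopfAlgebra.antipode k).rTensor H d) := by
    intro d
    induction d with
    | zero => simp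
    | add x y hx hy => simp only [map_add, hx, hy]
    | tmul a b => simp [HopfAlgebra.antipode_mul_antidistrib, antipode_antipodeInv]
  rw [h1, HopfAlgebra.mul_antipode_rTensor_comul_apply, Algebra.algebraMap_eq_smul_one, map_smul,
    HopfAlgebra.antipode_one]

theorem mulInv_comul (x : H) :
    mulInv hS (Coalgebra.comul (R := k) x) = algebraMap k H (Coalgebra.counit (R := k) x) := by
  apply hS.1
  have h1 : ∀ d : H ⊗[k] H, HopfAlgebra.antipode k (mulInv hS d) =
      LinearMap.mul' k H ((HopfAlgebra.antipode k).lTensor H d) := by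
    intro d
    induction d with
    | zero => simp
    | add x y hx hy => simp only [map_add, hx, hy]
    | tmul a b => simp [HopfAlgebra.antipode_mul_antidistrib, antipode_antipodeInv]
  rw [h1, HopfAlgebra.mul_antipode_lTensor_comul_apply, Algebra.algebraMap_eq_smul_one, map_smul,
    HopfAlgebra.antipode_one]

theorem IsCoaction.rTensor_of_comul {V : Type u} [AddCommGroup V] [Module k V]
    {ρ : V →ₗ[k] H ⊗[k] V} (hρ : IsCoaction ρ) {m : H ⊗[k] H →ₗ[k] H}
    (hm : ∀ x, m (Coalgebra.comul (R := k) x) = algebraMap k H (Coalgebra.counit (R := k) x))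
    (v : V) : m.rTensor V ((TensorProduct.assoc k H H V).symm (ρ.lTensor H (ρ v))) = 1 ⊗ₜ v := by
  have h1 : m ∘ₗ Coalgebra.comul = Algebra.linearMap k H ∘ₗ Coalgebra.counit := LinearMap.ext hm
  have h2 : ∀ y : H ⊗[k] V, (Algebra.linearMap k H ∘ₗ Coalgebra.counit).rTensor V y =
      1 ⊗ₜ contract Coalgebra.counit y := by
    intro y
    induction y with
    | zero => simp
    | add x y hx hy => simp only [map_add, TensorProduct.tmul_add, hx, hy]
    | tmul x v => simp [Algebra.algebraMap_eq_smul_one, TensorProduct.smul_tmul]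
  rw [← hρ.coassoc, LinearEquiv.symm_apply_apply, ← LinearMap.rTensor_comp_apply, h1, h2,
    hρ.contract_counit]

end AntipodeInv

namespace BraidedHopfAlgebra

variable {k H R : Type u} [Field k] [Ring H] [HopfAlgebra k H]
  [Ring R] [Algebra k R] [Coalgebra k R] (B : BraidedHopfAlgebra k H R)

namespace Bos

/-! ### Left integrals on the bosonization -/

/-- The map `r ↦ r₍₋₁₎ l(r₍₀₎)`. -/
def slice (l : Module.Dual k R) : R →ₗ[k] H :=
  (TensorProduct.rid k H).toLinearMap ∘ₗ l.lTensor H ∘ₗ B.coact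

/-- Coassociativity of the coaction: `slice` is colinear from `R` to the regular comodule `H`. -/
theorem lTensor_slice (l : Module.Dual k R) (r : R) :
    (slice B l).lTensor H (B.coact r) = Coalgebra.comul (R := k) (slice B l r) := by
  have h1 : ∀ y : (H ⊗[k] H) ⊗[k] R, ((TensorProduct.rid k H).toLinearMap ∘ₗ l.lTensor H).lTensor H
      (TensorProduct.assoc k H H R y) = TensorProduct.rid k _ (l.lTensor _ y) := by
    intro y
    induction y with
    | zero => simp
    | add x y hx hy => simp only [map_add, hx, hy]
    | tmul d r =>
      induction d with
      | zero => simp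
      | add x y hx hy => simp only [map_add, TensorProduct.add_tmul, hx, hy]
      | tmul a b => simp
  have h2 : ∀ y : H ⊗[k] R, TensorProduct.rid k _ (l.lTensor _ (Coalgebra.comul.rTensor R y)) =
      Coalgebra.comul (R := k) (TensorProduct.rid k H (l.lTensor H y)) := by
    intro y
    induction y with
    | zero => simp
    | add x y hx hy => simp only [map_add, hx, hy]
    | tmul x r => simp
  rw [slice, ← LinearMap.comp_assoc, LinearMap.lTensor_comp_apply, ← B.isCoaction.coassoc, h1, h2]
  rfl

theorem counit_slice (l : Module.Dual k R) (r : R) :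
    Coalgebra.counit (R := k) (slice B l r) = l r := by
  have h1 : ∀ y : H ⊗[k] R, Coalgebra.counit (R := k) (TensorProduct.rid k H (l.lTensor H y)) =
      l (contract Coalgebra.counit y) := by
    intro y
    induction y with
    | zero => simp
    | add x y hx hy => simp only [map_add, hx, hy]
    | tmul x r => simp [mul_comm]
  exact (h1 _).trans (by rw [B.isCoaction.contract_counit])

/-- For a left integral `l`, one has `r₍₁₎ ⊗ L(r₍₂₎) = 1 ⊗ L(r)` where `L(r) = r₍₋₁₎ l(r₍₀₎)`. -/
theorem lTensor_slice_comul (hS : Function.Bijective (HopfAlgebra.antipode k (A := H)))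
    {l : Module.Dual k R} (hl : IsLeftIntegral l) (r : R) :
    (slice B l).lTensor R (Coalgebra.comul (R := k) r) = 1 ⊗ₜ slice B l r := by
  let e : R ⊗[k] R →ₗ[k] R := (TensorProduct.rid k R).toLinearMap ∘ₗ l.lTensor R
  -- `θ(x ⊗ s) = S⁻¹(s₍₋₁₎) x ⊗ s₍₀₎` undoes the passage from `z ⊗ s` to `s₍₋₁₎ z ⊗ s₍₀₎`.
  let θ : H ⊗[k] R →ₗ[k] H ⊗[k] R := (invMul hS).rTensor R ∘ₗ
    (TensorProduct.assoc k H H R).symm.toLinearMap ∘ₗ B.coact.lTensor H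
  have h1 : ∀ y : H ⊗[k] R, e.lTensor H (Coalgebra.comul.lTensor H y) =
      TensorProduct.rid k H (l.lTensor H y) ⊗ₜ 1 := by
    intro y
    induction y with
    | zero => simp
    | add x y hx hy => simp only [map_add, TensorProduct.add_tmul, hx, hy]
    | tmul x r =>
      rw [LinearMap.lTensor_tmul, LinearMap.lTensor_tmul,
        show e (Coalgebra.comul (R := k) r) = l r • (1 : R) from hl r]
      simp [TensorProduct.smul_tmul]
  have h2 : ∀ y z : H ⊗[k] R, e.lTensor H (mulTensor k H R R (y ⊗ₜ z)) =
      (LinearMap.mulRight k (TensorProduct.rid k H (l.lTensor H z))).rTensor R y := by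
    intro y z
    induction y with
    | zero => simp
    | add x y hx hy => simp only [map_add, TensorProduct.add_tmul, hx, hy]
    | tmul x s =>
      induction z with
      | zero => simp
      | add x y hx hy => simp only [map_add, TensorProduct.tmul_add, hx, hy, LinearMap.rTensor_tmul,
          LinearMap.mulRight_apply, mul_add, TensorProduct.add_tmul]
      | tmul z t => simp [mulTensor_tmul, e, TensorProduct.smul_tmul']
  have h3 : ∀ (z : H) (y : H ⊗[k] R), θ ((LinearMap.mulRight k z).rTensor R y) =
      (LinearMap.mulRight k z).rTensor R (θ y) := by
    intro z y
    induction y with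
    | zero => simp
    | add x y hx hy => simp only [map_add, hx, hy]
    | tmul x s =>
      simp only [θ, LinearMap.comp_apply, LinearMap.rTensor_tmul, LinearMap.lTensor_tmul]
      generalize B.coact s = w
      induction w with
      | zero => simp
      | add x y hx hy => simp only [map_add, TensorProduct.tmul_add, hx, hy]
      | tmul w s => simp [mul_assoc]
  have h4 : ∀ (z : H) (s : R), θ ((LinearMap.mulRight k z).rTensor R (B.coact s)) = z ⊗ₜ s := by
    intro z s
    rw [h3, show θ (B.coact s) = 1 ⊗ₜ s from
      B.isCoaction.rTensor_of_comul (invMul_comul hS) s]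
    simp
  have h5 : ∀ d : R ⊗[k] R, θ (e.lTensor H (tensorCoact B.coact B.coact d)) =
      TensorProduct.comm k R H ((slice B l).lTensor R d) := by
    intro d
    induction d with
    | zero => simp
    | add x y hx hy => simp only [map_add, hx, hy]
    | tmul s t =>
      rw [tensorCoact_eq, h2, h4]
      rfl
  have h6 : θ (slice B l r ⊗ₜ 1) = slice B l r ⊗ₜ 1 := by
    have := h4 (slice B l r) 1
    rw [B.coact_one] at this
    simpa using this
  -- Apply `l` to the last leg of the colinearity of `Δ`. One side is `L(r) ⊗ 1` by the integral
  -- property; on the other, `θ` strips off the coaction of `r⁽¹⁾` and leaves `L(r⁽²⁾) ⊗ r⁽¹⁾`.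
  apply (TensorProduct.comm k R H).injective
  rw [← h5, ← B.comul_coact, h1]
  exact h6

theorem comul_mul (r : R) (h : H) : Coalgebra.comul (R := k) (inR B r * inH B h) =
    comulR B r * comulH B h := by
  rw [comul_eq, comulAlg_mul]

/-- The integral is `Λ(r # h) = μ(L(r) h)` with `L(r) = r₍₋₁₎ l(r₍₀₎)`. In the plain product `l(r)
μ(h)` the `H`-leg of `Δ(r)` would not be absorbed by `μ`; twisting by `L` makes `μ` see all of
`Δ(L(r) h)`. -/
theorem isLeftCoFrobenius_of_braided (hS : Function.Bijective (HopfAlgebra.antipode k (A := H)))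
    (hH : IsLeftCoFrobenius k H) (hR : IsLeftCoFrobenius k R) : IsLeftCoFrobenius k B.Bos := by
  obtain ⟨μ, hμ0, hμ⟩ := hH
  obtain ⟨l, hl0, hl⟩ := hR
  let Λ : Module.Dual k B.Bos := μ ∘ₗ LinearMap.mul' k H ∘ₗ (slice B l).rTensor H ∘ₗ
    (of B).symm.toLinearMap
  have hΛ : ∀ r h, Λ (inR B r * inH B h) = μ (slice B l r * h) := by
    intro r h
    simp [Λ, inR_mul_inH]
  refine ⟨Λ, fun h0 => ?_, fun a => ?_⟩
  · obtain ⟨r, hr⟩ := DFunLike.ne_iff.mp hl0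
    obtain ⟨h, hh⟩ := DFunLike.ne_iff.mp hμ0
    -- Summing `Λ(r₍₀₎ # S⁻¹(r₍₋₁₎) h)` gives `l(r) μ(h)`, so `Λ` is not zero.
    have h1 : ∀ y : H ⊗[k] R, μ (mulInv hS ((slice B l).lTensor H y) * h) = 0 := by
      intro y
      induction y with
      | zero => simp
      | add x y hx hy => simp only [map_add, add_mul, hx, hy, add_zero]
      | tmul x t =>
        rw [LinearMap.lTensor_tmul, mulInv_tmul, mul_assoc, ← hΛ, h0, LinearMap.zero_apply]
    have h2 := h1 (B.coact r)
    rw [lTensor_slice, mulInv_comul, counit_slice, ← Algebra.smul_def, map_smul, smul_eq_mul,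
      mul_eq_zero] at h2
    exact h2.elim hr hh
  · have h1 : ∀ (s : R) (y : H ⊗[k] R) (h : H), TensorProduct.rid k _ (Λ.lTensor _
        (comulFst B B.Bos s * TensorProduct.map (inH B).toLinearMap (inR B).toLinearMap y *
          comulH B h)) = inR B s * inH B (TensorProduct.rid k _ (μ.lTensor _
            ((slice B l).lTensor H y * Coalgebra.comul (R := k) h))) := by
      intro s y h
      induction y with
      | zero => simp
      | add x y hx hy => simp only [map_add, mul_add, add_mul, hx, hy]
      | tmul x t =>
        rw [comulFst_mul_map, comulH_apply]
        generalize Coalgebra.comul (R := k) h = d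
        induction d with
        | zero => simp
        | add x y hx hy => simp only [map_add, mul_add, hx, hy]
        | tmul a b => simp [hΛ, mul_assoc]
    have h2 : ∀ (d : R ⊗[k] R) (h : H), TensorProduct.rid k _ (Λ.lTensor _
        (LinearMap.mul' k _ (TensorProduct.map (comulFst B B.Bos).toLinearMap
          (TensorProduct.map (inH B).toLinearMap (inR B).toLinearMap ∘ₗ B.coact) d) *
          comulH B h)) = inR B (TensorProduct.rid k R ((μ ∘ₗ LinearMap.mulRight k h).lTensor R
            ((slice B l).lTensor R d))) := by
      intro d h
      induction d with
      | zero => simp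
      | add x y hx hy => simp only [map_add, add_mul, hx, hy]
      | tmul s t =>
        refine (h1 s (B.coact t) h).trans ?_
        rw [lTensor_slice, ← Bialgebra.comul_mul, hμ]
        simp
    induction a using Bos.induction with
    | zero => simp
    | add a b ha hb => simp only [map_add, ha, hb, add_smul]
    | mul r h =>
      rw [comul_mul, comulR_apply, h2, lTensor_slice_comul B hS hl, hΛ]
      simp

theorem map_toR_id_comul (r : R) (h : H) :
    (toR B).rTensor B.Bos (Coalgebra.comul (R := k) (inR B r * inH B h)) =
      (LinearMap.mulRight k (inH B h) ∘ₗ (inR B).toLinearMap).lTensor R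
        (Coalgebra.comul (R := k) r) := by
  have h1 : ∀ (s : R) (y : H ⊗[k] R), (toR B).rTensor B.Bos
      (comulFst B B.Bos s * TensorProduct.map (inH B).toLinearMap (inR B).toLinearMap y *
        comulH B h) = s ⊗ₜ (inR B (contract Coalgebra.counit y) * inH B h) := by
    intro s y
    induction y with
    | zero => simp
    | add x y hx hy => simp only [map_add, mul_add, add_mul, TensorProduct.tmul_add, hx, hy]
    | tmul x t =>
      have h2 : ∀ d : H ⊗[k] H, (toR B).rTensor B.Bos ((inR B s * inH B x) ⊗ₜ inR B t *
          TensorProduct.map (inH B).toLinearMap (inH B).toLinearMap d) =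
          Coalgebra.counit (R := k) x •
            s ⊗ₜ (inR B t * inH B (contract Coalgebra.counit d)) := by
        intro d
        induction d with
        | zero => simp
        | add x y hx hy =>
          simp only [map_add, mul_add, TensorProduct.tmul_add, smul_add, hx, hy]
        | tmul a b =>
          simp [toR_mul_inH, toR_inR, ← TensorProduct.smul_tmul', smul_smul, mul_comm]
      rw [comulFst_mul_map, comulH_apply, h2, contract_tmul, contract, LinearMap.comp_apply,
        Coalgebra.rTensor_counit_comul]
      simp
  rw [comul_mul, comulR_apply]
  generalize Coalgebra.comul (R := k) r = d
  induction d with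
  | zero => simp
  | add x y hx hy => simp only [map_add, add_mul, hx, hy]
  | tmul s t =>
    refine (h1 s (B.coact t)).trans ?_
    rw [B.isCoaction.contract_counit]
    rfl

theorem exists_ne_zero {Λ : Module.Dual k B.Bos} (h : Λ ≠ 0) :
    ∃ r h, Λ (inR B r * inH B h) ≠ 0 := by
  by_contra! h0
  refine h (LinearMap.ext fun a => ?_)
  induction a using Bos.induction with
  | zero => simp
  | add a b ha hb => simp only [map_add, ha, hb]
  | mul r h => exact h0 r h

/-- Fix `h` with `Λ(r # h) ≠ 0` for some `r`. Projecting the first leg of `Δ(r # h)` to `R` leaves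
`r⁽¹⁾ ⊗ (r⁽²⁾ # h)`, so `r ↦ Λ(r # h)` is a left integral. -/
theorem isLeftCoFrobenius_braided (hA : IsLeftCoFrobenius k B.Bos) : IsLeftCoFrobenius k R := by
  obtain ⟨Λ, hΛ0, hΛ⟩ := hA
  obtain ⟨r, h, hr⟩ := exists_ne_zero B hΛ0
  let f : R →ₗ[k] B.Bos := LinearMap.mulRight k (inH B h) ∘ₗ (inR B).toLinearMap
  refine ⟨Λ ∘ₗ f, fun h0 => hr (LinearMap.congr_fun h0 r), fun r => ?_⟩
  have h1 : ∀ x : B.Bos ⊗[k] B.Bos, toR B (TensorProduct.rid k _ (Λ.lTensor _ x)) =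
      TensorProduct.rid k _ (Λ.lTensor _ ((toR B).rTensor _ x)) := by
    intro x
    induction x with
    | zero => simp
    | add x y hx hy => simp only [map_add, hx, hy]
    | tmul a b => simp
  have h2 := congrArg (toR B) (hΛ (f r))
  rw [h1, show f r = inR B r * inH B h from rfl, map_toR_id_comul, map_smul,
    ← map_one (inR B), toR_inR] at h2
  rw [LinearMap.lTensor_comp_apply]
  exact h2

end Bos

end BraidedHopfAlgebra

end

end BraidedCoFrob

namespace BraidedCoFrob
noncomputable section

namespace BraidedHopfAlgebra

variable {k H R : Type u} [Field k] [Ring H] [HopfAlgebra k H]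
  [Ring R] [Algebra k R] [Coalgebra k R] (B : BraidedHopfAlgebra k H R)

namespace Bos

/-! ### Right integrals on the bosonization -/

/-- Here the plain product `l(r) μ(h)` works: contracting by `l` first leaves the coaction of `1`,
which is trivial, and then `μ` is a right integral on `H`. -/
theorem isRightCoFrobenius_of_braided (hH : IsRightCoFrobenius k H)
    (hR : IsRightCoFrobenius k R) : IsRightCoFrobenius k B.Bos := by
  obtain ⟨μ, hμ0, hμ⟩ := hH
  obtain ⟨l, hl0, hl⟩ := hR
  let Λ : Module.Dual k B.Bos := LinearMap.mul' k k ∘ₗ TensorProduct.map l μ ∘ₗ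
    (of B).symm.toLinearMap
  have hΛ : ∀ r h, Λ (inR B r * inH B h) = l r * μ h := by
    intro r h
    simp [Λ, inR_mul_inH]
  refine ⟨Λ, fun h0 => ?_, fun a => ?_⟩
  · obtain ⟨r, hr⟩ := DFunLike.ne_iff.mp hl0
    obtain ⟨h, hh⟩ := DFunLike.ne_iff.mp hμ0
    have h1 := hΛ r h
    rw [h0, LinearMap.zero_apply, eq_comm, mul_eq_zero] at h1
    exact h1.elim hr hh
  · let g (h : H) : H ⊗[k] R →ₗ[k] B.Bos := contract μ ∘ₗ
      LinearMap.mulRight k ((inH B).toLinearMap.lTensor H (Coalgebra.comul (R := k) h)) ∘ₗ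
        (inR B).toLinearMap.lTensor H
    have h1 : ∀ (s : R) (y : H ⊗[k] R) (h : H), contract Λ
        (comulFst B B.Bos s * TensorProduct.map (inH B).toLinearMap (inR B).toLinearMap y *
          comulH B h) = l s • g h y := by
      intro s y h
      induction y with
      | zero => simp
      | add x y hx hy => simp only [map_add, mul_add, add_mul, smul_add, hx, hy]
      | tmul x t =>
        simp only [comulFst_mul_map, comulH_apply, g, LinearMap.comp_apply,
          LinearMap.mulRight_apply]
        generalize Coalgebra.comul (R := k) h = d
        induction d with
        | zero => simp
        | add x y hx hy => simp only [map_add, mul_add, smul_add, hx, hy]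
        | tmul a b =>
          have h2 : Λ (inR B s * (inH B x * inH B a)) = l s * μ (x * a) := by
            rw [← map_mul, hΛ]
          simp [mul_assoc, h2, mul_smul]
    have h2 : ∀ (d : R ⊗[k] R) (h : H), contract Λ
        (LinearMap.mul' k _ (TensorProduct.map (comulFst B B.Bos).toLinearMap
          (TensorProduct.map (inH B).toLinearMap (inR B).toLinearMap ∘ₗ B.coact) d) *
          comulH B h) = g h (B.coact (contract l d)) := by
      intro d h
      induction d with
      | zero => simp
      | add x y hx hy => simp only [map_add, add_mul, hx, hy]
      | tmul s t =>
        refine (h1 s (B.coact t) h).trans ?_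
        rw [contract_tmul, map_smul, map_smul]
    have h3 : ∀ h, g h (1 ⊗ₜ 1) = μ h • 1 := by
      intro h
      have h4 : g h (1 ⊗ₜ 1) =
          contract μ ((inH B).toLinearMap.lTensor H (Coalgebra.comul (R := k) h)) := by
        have h5 : (inR B).toLinearMap.lTensor H ((1 : H) ⊗ₜ[k] (1 : R)) = 1 := by
          simp [Algebra.TensorProduct.one_def]
        simp only [g, LinearMap.comp_apply, LinearMap.mulRight_apply, h5, one_mul]
      rw [h4, contract_lTensor, show contract μ (Coalgebra.comul (R := k) h) = _ from hμ h]
      simp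
    change contract Λ _ = _
    induction a using Bos.induction with
    | zero => simp
    | add a b ha hb => simp only [map_add, ha, hb, add_smul]
    | mul r h =>
      rw [comul_mul, comulR_apply, h2, show contract l (Coalgebra.comul (R := k) r) = _ from hl r,
        map_smul, map_smul, B.coact_one, h3, hΛ, mul_smul]

theorem lTensor_toR_comul (r : R) (h : H) :
    (toR B).lTensor B.Bos (Coalgebra.comul (R := k) (inR B r * inH B h)) =
      (glue B R ∘ₗ ((LinearMap.mulRight k h).rTensor R ∘ₗ B.coact).lTensor R)
        (Coalgebra.comul (R := k) r) := by
  have h1 : ∀ (s : R) (y : H ⊗[k] R), (toR B).lTensor B.Bos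
      (comulFst B B.Bos s * TensorProduct.map (inH B).toLinearMap (inR B).toLinearMap y *
        comulH B h) = glue B R (s ⊗ₜ (LinearMap.mulRight k h).rTensor R y) := by
    intro s y
    induction y with
    | zero => simp
    | add x y hx hy => simp only [map_add, mul_add, add_mul, TensorProduct.tmul_add, hx, hy]
    | tmul x t =>
      have h2 : ∀ d : H ⊗[k] H, (toR B).lTensor B.Bos ((inR B s * inH B x) ⊗ₜ inR B t *
          TensorProduct.map (inH B).toLinearMap (inH B).toLinearMap d) =
          (inR B s * inH B x * inH B (TensorProduct.rid k H (Coalgebra.counit.lTensor H d))) ⊗ₜ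
            t := by
        intro d
        induction d with
        | zero => simp
        | add x y hx hy =>
          simp only [map_add, mul_add, TensorProduct.add_tmul, hx, hy]
        | tmul a b =>
          simp [toR_mul_inH, toR_inR, ← TensorProduct.smul_tmul']
      rw [comulFst_mul_map, comulH_apply, h2, Coalgebra.lTensor_counit_comul,
        LinearMap.rTensor_tmul, glue_tmul]
      simp [mul_assoc]
  rw [comul_mul, comulR_apply]
  generalize Coalgebra.comul (R := k) r = d
  induction d with
  | zero => simp
  | add x y hx hy => simp only [map_add, add_mul, hx, hy]
  | tmul s t => exact h1 s (B.coact t)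

/-! ### Restricting a right integral from the bosonization to the braided factor -/

section Restrict

variable (hS : Function.Bijective (HopfAlgebra.antipode k (A := H))) (Λ : Module.Dual k B.Bos)

/-- The functional `x ⊗ r ↦ Λ(r # S⁻¹(x) h)`. -/
def twist (h : H) : H ⊗[k] R →ₗ[k] k :=
  Λ ∘ₗ (of B).toLinearMap ∘ₗ (LinearMap.mulRight k h ∘ₗ antipodeInv hS).lTensor R ∘ₗ
    (TensorProduct.comm k H R).toLinearMap

theorem twist_tmul (h x : H) (r : R) :
    twist B hS Λ h (x ⊗ₜ r) = Λ (inR B r * inH B (antipodeInv hS x * h)) := by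
  rw [inR_mul_inH]
  simp [twist]

/-- Projecting the second leg of `Δ(r # h)` to `R` leaves an extra factor `r⁽²⁾₍₋₁₎` in the first
leg. Inserting `S⁻¹(r₍₋₁₎)`, which by colinearity of `Δ` is `S⁻¹(r⁽²⁾₍₋₁₎) S⁻¹(r⁽¹⁾₍₋₁₎)`, cancels
it. -/
theorem isRightIntegral_twist (hΛ : IsRightIntegral Λ) (h : H) :
    IsRightIntegral (twist B hS Λ h ∘ₗ B.coact) := by
  let K : H ⊗[k] R →ₗ[k] H ⊗[k] R := (LinearMap.mulRight k h).rTensor R ∘ₗ (mulInv hS).rTensor R ∘ₗ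
    (TensorProduct.assoc k H H R).symm.toLinearMap ∘ₗ B.coact.lTensor H
  have hK : ∀ (x : H) (t : R), K (x ⊗ₜ t) =
      (LinearMap.mulRight k (antipodeInv hS x * h)).rTensor R (B.coact t) := by
    intro x t
    simp only [K, LinearMap.comp_apply, LinearMap.lTensor_tmul]
    generalize B.coact t = w
    induction w with
    | zero => simp
    | add x y hx hy => simp only [map_add, TensorProduct.tmul_add, hx, hy]
    | tmul w s => simp [mul_assoc]
  -- `N(x ⊗ s ⊗ t) = Λ(s # t₍₋₁₎ S⁻¹(x) h) t₍₀₎`. It is evaluated on both sides of the colinearity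
  -- of `Δ`: the integral property applies to one side, the cancellation to the other.
  let N : H ⊗[k] (R ⊗[k] R) →ₗ[k] R := contract Λ ∘ₗ glue B R ∘ₗ K.lTensor R ∘ₗ
    (TensorProduct.leftComm k H R R).toLinearMap
  have h1 : ∀ (x : H) (u : R), N (x ⊗ₜ Coalgebra.comul (R := k) u) =
      twist B hS Λ h (x ⊗ₜ u) • 1 := by
    intro x u
    have h2 : ∀ d : R ⊗[k] R, N (x ⊗ₜ d) = contract Λ ((glue B R ∘ₗ
        ((LinearMap.mulRight k (antipodeInv hS x * h)).rTensor R ∘ₗ B.coact).lTensor R) d) := by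
      intro d
      induction d with
      | zero => simp
      | add x y hx hy => simp only [map_add, TensorProduct.tmul_add, hx, hy]
      | tmul s t => simp [N, hK]
    rw [h2, ← lTensor_toR_comul, contract_lTensor, twist_tmul,
      show contract Λ (Coalgebra.comul (R := k) _) = _ from hΛ _, map_smul, ← map_one (inR B),
      toR_inR]
  have h3 : ∀ y : H ⊗[k] R, N (Coalgebra.comul.lTensor H y) = twist B hS Λ h y • 1 := by
    intro y
    induction y with
    | zero => simp
    | add x y hx hy => simp only [map_add, add_smul, hx, hy]
    | tmul x u => exact h1 x u
  have h4 : ∀ (y : H ⊗[k] R) (t : R), N (mulTensor k H R R (y ⊗ₜ B.coact t)) =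
      twist B hS Λ h y • t := by
    intro y t
    induction y with
    | zero => simp
    | add x y hx hy => simp only [map_add, TensorProduct.add_tmul, add_smul, hx, hy]
    | tmul x s =>
      have h5 : ∀ w : H ⊗[k] R, N (mulTensor k H R R ((x ⊗ₜ s) ⊗ₜ w)) = contract Λ (glue B R
          (s ⊗ₜ (LinearMap.mulRight k (antipodeInv hS x * h)).rTensor R ((mulInv hS).rTensor R
            ((TensorProduct.assoc k H H R).symm (B.coact.lTensor H w))))) := by
        intro w
        induction w with
        | zero => simp
        | add x y hx hy => simp only [map_add, TensorProduct.tmul_add, hx, hy]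
        | tmul z t =>
          rw [mulTensor_tmul, show N ((x * z) ⊗ₜ (s ⊗ₜ t)) =
            contract Λ (glue B R (s ⊗ₜ K ((x * z) ⊗ₜ t))) from rfl, hK, antipodeInv_mul,
            LinearMap.lTensor_tmul]
          congr 3
          generalize B.coact t = v
          induction v with
          | zero => simp
          | add x y hx hy => simp only [map_add, TensorProduct.tmul_add, hx, hy]
          | tmul w s => simp [mul_assoc]
      rw [h5, B.isCoaction.rTensor_of_comul (mulInv_comul hS), LinearMap.rTensor_tmul, glue_tmul,
        contract_tmul, twist_tmul]
      simp
  have h6 : ∀ d : R ⊗[k] R, N (tensorCoact B.coact B.coact d) =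
      contract (twist B hS Λ h ∘ₗ B.coact) d := by
    intro d
    induction d with
    | zero => simp
    | add x y hx hy => simp only [map_add, hx, hy]
    | tmul s t => rw [tensorCoact_eq, h4, contract_tmul, LinearMap.comp_apply]
  intro r
  refine (h6 _).symm.trans ?_
  rw [← B.comul_coact, h3, LinearMap.comp_apply]

/-- The twist is invertible: replacing `h` by `r₍₋₂₎ h` and using `S⁻¹(r₍₋₁₎) r₍₋₂₎ = ε` recovers
`Λ(r # h)` from the twisted functionals. -/
theorem exists_twist_ne_zero {Λ : Module.Dual k B.Bos} (hΛ : Λ ≠ 0) :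
    ∃ h, twist B hS Λ h ∘ₗ B.coact ≠ 0 := by
  by_contra! h0
  obtain ⟨r, h, hr⟩ := exists_ne_zero B hΛ
  let Λ' : H ⊗[k] R →ₗ[k] k := Λ ∘ₗ (of B).toLinearMap ∘ₗ (LinearMap.mulRight k h).lTensor R ∘ₗ
    (TensorProduct.comm k H R).toLinearMap
  have hΛ' : ∀ x t, Λ' (x ⊗ₜ t) = Λ (inR B t * inH B (x * h)) := by
    intro x t
    rw [inR_mul_inH]
    simp [Λ']
  have h1 : ∀ (x : H) (w : H ⊗[k] R), Λ' ((invMul hS).rTensor R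
      ((TensorProduct.assoc k H H R).symm (x ⊗ₜ w))) = twist B hS Λ (x * h) w := by
    intro x w
    induction w with
    | zero => simp
    | add x y hx hy => simp only [map_add, TensorProduct.tmul_add, hx, hy]
    | tmul z t =>
      rw [TensorProduct.assoc_symm_tmul, LinearMap.rTensor_tmul, hΛ', twist_tmul, invMul_tmul,
        mul_assoc]
  have h2 : ∀ y : H ⊗[k] R, Λ' ((invMul hS).rTensor R
      ((TensorProduct.assoc k H H R).symm (B.coact.lTensor H y))) = 0 := by
    intro y
    induction y with
    | zero => simp
    | add x y hx hy => simp only [map_add, hx, hy, add_zero]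
    | tmul x t =>
      rw [LinearMap.lTensor_tmul, h1]
      exact LinearMap.congr_fun (h0 _) t
  have h3 := h2 (B.coact r)
  rw [B.isCoaction.rTensor_of_comul (invMul_comul hS), hΛ', one_mul] at h3
  exact hr h3

end Restrict

theorem isRightCoFrobenius_braided (hS : Function.Bijective (HopfAlgebra.antipode k (A := H)))
    (hA : IsRightCoFrobenius k B.Bos) : IsRightCoFrobenius k R := by
  obtain ⟨Λ, hΛ0, hΛ⟩ := hA
  obtain ⟨h, hh⟩ := exists_twist_ne_zero B hS hΛ0
  exact ⟨_, hh, isRightIntegral_twist B hS Λ hΛ h⟩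

theorem isLeftCoFrobenius_iff (hS : Function.Bijective (HopfAlgebra.antipode k (A := H)))
    (hH : IsLeftCoFrobenius k H) : IsLeftCoFrobenius k B.Bos ↔ IsLeftCoFrobenius k R :=
  ⟨isLeftCoFrobenius_braided B, isLeftCoFrobenius_of_braided B hS hH⟩

/-- Left-right symmetry is available for the ordinary Hopf algebras `H` and `R # H`. It is used for
both, and left-right symmetry for the braided `R` follows from it. -/
theorem isRightCoFrobenius_iff (hS : Function.Bijective (HopfAlgebra.antipode k (A := H)))
    (hH : IsLeftCoFrobenius k H) : IsLeftCoFrobenius k B.Bos ↔ IsRightCoFrobenius k R := by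
  rw [isLeftCoFrobenius_iff_isRightCoFrobenius k B.Bos]
  exact ⟨isRightCoFrobenius_braided B hS, isRightCoFrobenius_of_braided B
    ((isLeftCoFrobenius_iff_isRightCoFrobenius k H).mp hH)⟩

end Bos

end BraidedHopfAlgebra

end

end BraidedCoFrob

theorem mainTheorem1 {k H R : Type u} [Field k] [Ring H] [HopfAlgebra k H]
    [Ring R] [Algebra k R] [Coalgebra k R]
    (hS : Function.Bijective (HopfAlgebra.antipode k (A := H)))
    (hH : IsLeftCoFrobenius k H)
    (B : BraidedHopfAlgebra k H R) :
    List.TFAE [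
      IsLeftCoFrobenius k R,
      IsRightCoFrobenius k R,
      ∀ S : BrComod B, Simple S → S.HasFinDimInjectiveHull,
      (BrComod.unit B).HasFinDimInjectiveHull,
      ∃ M : BrComod B, M.NonZero ∧ Injective M ∧ M.FinDim,
      ∀ M : BrComod B, M.NonZero → M.HasFinDimQuotient,
      ∀ M : BrComod B, M.NonZero → Injective M → M.HasFinDimQuotient,
      ∃ M : BrComod B, M.NonZero ∧ Injective M ∧ M.HasFinDimQuotient,
      ∃ P : BrComod B, P.NonZero ∧ Projective P,
      ∀ M : BrComod B, M.HasProjectiveCover,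
      ∀ M : BrComod B, Injective M → Projective M] := by
  have h := BraidedHopfAlgebra.Bos.tfae_brComod B
  have hl := BraidedHopfAlgebra.Bos.isLeftCoFrobenius_iff B hS hH
  have hr := BraidedHopfAlgebra.Bos.isRightCoFrobenius_iff B hS hH
  -- The first entry of the list, an integral on the bosonization, is read as a right integral on
  -- `R`; the left integral is then joined to it through the bosonization.
  rw [hr] at h
  exact List.tfae_cons_cons.mpr ⟨hl.symm.trans hr, h⟩
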